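/- Let $k$ be a field and let $\mathcal V$ be the closed symmetric monoidal category $\mathsf{Vect}$ of $k$-vector spaces or the closed symmetric monoidal category $\mathsf{dgVect}$ of (unbounded) chain complexes over $k$, with internal hom $[-,-]$. Let $X$ be a set and let $P$ be a symmetric $\mathcal V$-operad coloured by $X$, with objects of operations $P^{\bar x}_y$ for $\bar x=x_1\dots x_n\in S(X)$ (finite sequences of colours, with their permutations, $n\ge 0$) and $y\in X$. For $C=(C^x)_{x\in X}\in\mathcal V^X$ write $C^{\otimes\bar x}=C^{x_1}\otimes\dots\otimes C^{x_n}$ and define $P^\wedge(C),P_2^\wedge(C)\in\mathcal V^X$ as the ends $$P^\wedge(C)^y=\int_{\bar x}\,[P^{\bar x}_y,\,C^{\otimes\bar x}],\qquad P_2^\wedge(C)^y=\int_{\bar x;\,\bar z_1,\dots,\bar z_n}\Bigl[P^{\bar x}_y\otimes\bigotimes_{i}P^{\bar z_i}_{x_i},\ \bigotimes_i C^{\otimes\bar z_i}\Bigr]$$ over the groupoid $S(X)$, respectively over the groupoid of sequences $(x_1,\bar z_1)\dots(x_n,\bar z_n)$ with $x_i\in X$, $\bar z_i\in S(X)$. Let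 $\epsilon:P^\wedge(C)\to C$ be evaluation at the units of $P$, let $\Delta:P^\wedge(C)\to P^\wedge_2(C)$ be induced by the composition of $P$, and let $\alpha:P^\wedge(P^\wedge(C))\to P_2^\wedge(C)$ be induced by the canonical maps $\bigotimes_i[P^{\bar z_i}_{x_i},C^{\otimes\bar z_i}]\to[\bigotimes_iP^{\bar z_i}_{x_i},\bigotimes_iC^{\otimes\bar z_i}]$; all three are natural in $C$. A $P$-coalgebra is an object $C\in\mathcal V^X$ with a map $\delta:C\to P^\wedge(C)$ such that $\epsilon\circ\delta=\mathrm{id}_C$ and $\alpha\circ P^\wedge(\delta)\circ\delta=\Delta\circ\delta$. Let $Q_1(C)$ be the fibre product of $\Delta$ and $\alpha$, with projections $\chi_1:Q_1(C)\to P^\wedge(C)$ and $\delta_1:Q_1(C)\to P^\wedge(P^\wedge(C))$; a map $f:C\to D$ in $\mathcal V^X$ induces $Q_1(f):Q_1(C)\to Q_1(D)$. Theorem. The map $\chi_1:Q_1(C)\to P^\wedge(C)$ is a monomorphism for every $C$; thus $Q_1(C)$ is the subobject of those elements of $P^\wedge(C)$ (the representative elements) whose diagonal $\Delta$ lies in $P^\wedge(P^\wedge(C))$.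 Moreover there is a family of maps $\delta_C:Q_1(C)\to P^\wedge(Q_1(C))$, $C\in\mathcal V^X$, such that 1. $(Q_1(C),\delta_C)$ is a $P$-coalgebra for every $C$; 2. $\delta_C$ lifts the diagonal: $P^\wedge(\chi_1)\circ\delta_C=\delta_1$; 3. the structure is natural in $C$: for every map $f:C\to D$ in $\mathcal V^X$ the map $Q_1(f)$ is a map of $P$-coalgebras, i.e. $P^\wedge(Q_1(f))\circ\delta_C=\delta_D\circ Q_1(f)$. -/

import Mathlib

open CategoryTheory MonoidalCategory Limits Functor.LaxMonoidal Functor.OplaxMonoidal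

universe v u w w₂

/-- Objects of the free symmetric monoidal category on `J`: formal (parenthesised) tensor words
in the objects of `J`. By coherence this category is equivalent to the category of finite sequences
of objects of `J`, whose morphisms are permutations decorated by morphisms of `J`. -/
inductive FreeSymm (J : Type u) : Type u
  | of : J → FreeSymm J
  | unit : FreeSymm J
  | tensor : FreeSymm J → FreeSymm J → FreeSymm J

namespace FreeSymm

section Homs

variable {J : Type u} [SmallCategory J]

/-- Formal morphisms. -/
inductive PreHom : FreeSymm J → FreeSymm J → Type u
  | of {x y : J} (f : x ⟶ y) : PreHom (of x) (of y)
  | id (a) : PreHom a a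
  | comp {a b c} (f : PreHom a b) (g : PreHom b c) : PreHom a c
  | tensor {a b c d} (f : PreHom a c) (g : PreHom b d) : PreHom (tensor a b) (tensor c d)
  | assocHom (a b c) : PreHom (tensor (tensor a b) c) (tensor a (tensor b c))
  | assocInv (a b c) : PreHom (tensor a (tensor b c)) (tensor (tensor a b) c)
  | leftHom (a) : PreHom (tensor unit a) a
  | leftInv (a) : PreHom a (tensor unit a)
  | rightHom (a) : PreHom (tensor a unit) a
  | rightInv (a) : PreHom a (tensor a unit)
  | braid (a b) : PreHom (tensor a b) (tensor b a)

/-- The congruence generated by functoriality of `of` and the axioms of symmetric monoidal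
categories. -/
inductive Rel : ∀ {a b : FreeSymm J}, PreHom a b → PreHom a b → Prop
  | refl {a b} (f : PreHom a b) : Rel f f
  | symm {a b} {f g : PreHom a b} : Rel f g → Rel g f
  | trans {a b} {f g h : PreHom a b} : Rel f g → Rel g h → Rel f h
  | comp {a b c} {f f' : PreHom a b} {g g' : PreHom b c} :
      Rel f f' → Rel g g' → Rel (f.comp g) (f'.comp g')
  | tensor {a b c d} {f f' : PreHom a c} {g g' : PreHom b d} :
      Rel f f' → Rel g g' → Rel (f.tensor g) (f'.tensor g')
  | id_comp {a b} (f : PreHom a b) : Rel ((PreHom.id a).comp f) f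
  | comp_id {a b} (f : PreHom a b) : Rel (f.comp (PreHom.id b)) f
  | assoc {a b c d} (f : PreHom a b) (g : PreHom b c) (h : PreHom c d) :
      Rel ((f.comp g).comp h) (f.comp (g.comp h))
  | of_id (x : J) : Rel (PreHom.of (𝟙 x)) (PreHom.id _)
  | of_comp {x y z : J} (f : x ⟶ y) (g : y ⟶ z) :
      Rel (PreHom.of (f ≫ g)) ((PreHom.of f).comp (PreHom.of g))
  | tensor_id (a b) : Rel ((PreHom.id a).tensor (PreHom.id b)) (PreHom.id _)
  | tensor_comp {a b c a' b' c'} (f : PreHom a b) (g : PreHom b c) (f' : PreHom a' b')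
      (g' : PreHom b' c') :
      Rel ((f.tensor f').comp (g.tensor g')) ((f.comp g).tensor (f'.comp g'))
  | assoc_hom_inv (a b c) :
      Rel ((PreHom.assocHom a b c).comp (PreHom.assocInv a b c)) (PreHom.id _)
  | assoc_inv_hom (a b c) :
      Rel ((PreHom.assocInv a b c).comp (PreHom.assocHom a b c)) (PreHom.id _)
  | assoc_nat {a b c a' b' c'} (f : PreHom a a') (g : PreHom b b') (h : PreHom c c') :
      Rel (((f.tensor g).tensor h).comp (PreHom.assocHom a' b' c'))
        ((PreHom.assocHom a b c).comp (f.tensor (g.tensor h)))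
  | left_hom_inv (a) : Rel ((PreHom.leftHom a).comp (PreHom.leftInv a)) (PreHom.id _)
  | left_inv_hom (a) : Rel ((PreHom.leftInv a).comp (PreHom.leftHom a)) (PreHom.id _)
  | left_nat {a b} (f : PreHom a b) :
      Rel (((PreHom.id unit).tensor f).comp (PreHom.leftHom b)) ((PreHom.leftHom a).comp f)
  | right_hom_inv (a) : Rel ((PreHom.rightHom a).comp (PreHom.rightInv a)) (PreHom.id _)
  | right_inv_hom (a) : Rel ((PreHom.rightInv a).comp (PreHom.rightHom a)) (PreHom.id _)
  | right_nat {a b} (f : PreHom a b) :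
      Rel ((f.tensor (PreHom.id unit)).comp (PreHom.rightHom b)) ((PreHom.rightHom a).comp f)
  | pentagon (a b c d) :
      Rel (((PreHom.assocHom a b c).tensor (PreHom.id d)).comp
          ((PreHom.assocHom a (tensor b c) d).comp
            ((PreHom.id a).tensor (PreHom.assocHom b c d))))
        ((PreHom.assocHom (tensor a b) c d).comp (PreHom.assocHom a b (tensor c d)))
  | triangle (a b) :
      Rel ((PreHom.assocHom a unit b).comp ((PreHom.id a).tensor (PreHom.leftHom b)))
        ((PreHom.rightHom a).tensor (PreHom.id b))
  | braid_nat {a b a' b'} (f : PreHom a a') (g : PreHom b b') :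
      Rel ((f.tensor g).comp (PreHom.braid a' b')) ((PreHom.braid a b).comp (g.tensor f))
  | braid_braid (a b) : Rel ((PreHom.braid a b).comp (PreHom.braid b a)) (PreHom.id _)
  | hexagon (a b c) :
      Rel ((PreHom.assocHom a b c).comp ((PreHom.braid a (tensor b c)).comp
          (PreHom.assocHom b c a)))
        (((PreHom.braid a b).tensor (PreHom.id c)).comp
          ((PreHom.assocHom b a c).comp ((PreHom.id b).tensor (PreHom.braid a c))))

instance homSetoid (a b : FreeSymm J) : Setoid (PreHom a b) :=
  ⟨Rel, ⟨Rel.refl, Rel.symm, Rel.trans⟩⟩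

instance category : SmallCategory (FreeSymm J) where
  Hom a b := Quotient (homSetoid a b)
  id a := ⟦PreHom.id a⟧
  comp := Quotient.map₂ PreHom.comp (fun _ _ hf _ _ hg => Rel.comp hf hg)
  id_comp := by rintro _ _ ⟨f⟩; exact Quotient.sound (Rel.id_comp f)
  comp_id := by rintro _ _ ⟨f⟩; exact Quotient.sound (Rel.comp_id f)
  assoc := by rintro _ _ _ _ ⟨f⟩ ⟨g⟩ ⟨h⟩; exact Quotient.sound (Rel.assoc f g h)

instance monoidalCategory : MonoidalCategory (FreeSymm J) where
  tensorObj := tensor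
  tensorUnit := unit
  tensorHom := Quotient.map₂ PreHom.tensor (fun _ _ hf _ _ hg => Rel.tensor hf hg)
  whiskerLeft a _ _ f := Quotient.map₂ PreHom.tensor (fun _ _ hf _ _ hg => Rel.tensor hf hg)
    ⟦PreHom.id a⟧ f
  whiskerRight f a := Quotient.map₂ PreHom.tensor (fun _ _ hf _ _ hg => Rel.tensor hf hg)
    f ⟦PreHom.id a⟧
  associator a b c := ⟨⟦PreHom.assocHom a b c⟧, ⟦PreHom.assocInv a b c⟧,
    Quotient.sound (Rel.assoc_hom_inv a b c), Quotient.sound (Rel.assoc_inv_hom a b c)⟩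
  leftUnitor a := ⟨⟦PreHom.leftHom a⟧, ⟦PreHom.leftInv a⟧,
    Quotient.sound (Rel.left_hom_inv a), Quotient.sound (Rel.left_inv_hom a)⟩
  rightUnitor a := ⟨⟦PreHom.rightHom a⟧, ⟦PreHom.rightInv a⟧,
    Quotient.sound (Rel.right_hom_inv a), Quotient.sound (Rel.right_inv_hom a)⟩
  tensorHom_def := by
    rintro _ _ _ _ ⟨f⟩ ⟨g⟩
    exact Quotient.sound (((Rel.tensor (Rel.comp_id f) (Rel.id_comp g)).symm).trans
      (Rel.tensor_comp _ _ _ _).symm)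
  id_tensorHom_id a b := Quotient.sound (Rel.tensor_id a b)
  tensorHom_comp_tensorHom := by
    rintro _ _ _ _ _ _ ⟨f⟩ ⟨f'⟩ ⟨g⟩ ⟨g'⟩
    exact Quotient.sound (Rel.tensor_comp f g f' g')
  whiskerLeft_id a b := Quotient.sound (Rel.tensor_id a b)
  id_whiskerRight a b := Quotient.sound (Rel.tensor_id a b)
  associator_naturality := by
    rintro _ _ _ _ _ _ ⟨f⟩ ⟨g⟩ ⟨h⟩
    exact Quotient.sound (Rel.assoc_nat f g h)
  leftUnitor_naturality := by rintro _ _ ⟨f⟩; exact Quotient.sound (Rel.left_nat f)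
  rightUnitor_naturality := by rintro _ _ ⟨f⟩; exact Quotient.sound (Rel.right_nat f)
  pentagon a b c d := Quotient.sound (Rel.pentagon a b c d)
  triangle a b := Quotient.sound (Rel.triangle a b)

/-- The symmetry of the free symmetric monoidal category. -/
def braidIso (a b : FreeSymm J) : a ⊗ b ≅ b ⊗ a :=
  ⟨⟦PreHom.braid a b⟧, ⟦PreHom.braid b a⟧,
    Quotient.sound (Rel.braid_braid a b), Quotient.sound (Rel.braid_braid b a)⟩

theorem braid_natural {a b a' b' : FreeSymm J} (f : a ⟶ a') (g : b ⟶ b') :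
    (f ⊗ₘ g) ≫ (braidIso a' b').hom = (braidIso a b).hom ≫ (g ⊗ₘ f) := by
  obtain ⟨f⟩ := f
  obtain ⟨g⟩ := g
  exact Quotient.sound (Rel.braid_nat f g)

theorem braid_hexagon (a b c : FreeSymm J) :
    (α_ a b c).hom ≫ (braidIso a (b ⊗ c)).hom ≫ (α_ b c a).hom =
      ((braidIso a b).hom ▷ c) ≫ (α_ b a c).hom ≫ (b ◁ (braidIso a c).hom) :=
  Quotient.sound (Rel.hexagon a b c)

instance symmetricCategory : SymmetricCategory (FreeSymm J) where
  braiding := braidIso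
  braiding_naturality_right a _ _ f := by
    rw [← id_tensorHom, ← tensorHom_id, braid_natural]
  braiding_naturality_left f a := by
    rw [← id_tensorHom, ← tensorHom_id, braid_natural]
  hexagon_forward := braid_hexagon
  hexagon_reverse a b c := by
    have h := congrArg Iso.inv (show (α_ c a b) ≪≫ braidIso c (a ⊗ b) ≪≫ α_ a b c =
      whiskerRightIso (braidIso c a) b ≪≫ α_ a c b ≪≫ whiskerLeftIso a (braidIso c b) from
      Iso.ext (braid_hexagon c a b))
    simpa using! h
  symmetry a b := (braidIso a b).hom_inv_id

/-- The inclusion of generators. -/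
def incl : J ⥤ FreeSymm J where
  obj := of
  map f := ⟦PreHom.of f⟧
  map_id x := Quotient.sound (Rel.of_id x)
  map_comp f g := Quotient.sound (Rel.of_comp f g)

/-- Induction on morphisms of the free symmetric monoidal category. -/
theorem hom_induction {motive : ∀ {a b : FreeSymm J}, (a ⟶ b) → Prop} {a b : FreeSymm J}
    (f : a ⟶ b)
    (of : ∀ {x y : J} (f : x ⟶ y), motive (incl.map f))
    (id : ∀ a : FreeSymm J, motive (𝟙 a))
    (comp : ∀ {a b c : FreeSymm J} (f : a ⟶ b) (g : b ⟶ c), motive f → motive g → motive (f ≫ g))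
    (tensor : ∀ {a b c d : FreeSymm J} (f : a ⟶ c) (g : b ⟶ d), motive f → motive g →
      motive (f ⊗ₘ g))
    (assocHom : ∀ a b c : FreeSymm J, motive (α_ a b c).hom)
    (assocInv : ∀ a b c : FreeSymm J, motive (α_ a b c).inv)
    (leftHom : ∀ a : FreeSymm J, motive (λ_ a).hom)
    (leftInv : ∀ a : FreeSymm J, motive (λ_ a).inv)
    (rightHom : ∀ a : FreeSymm J, motive (ρ_ a).hom)
    (rightInv : ∀ a : FreeSymm J, motive (ρ_ a).inv)
    (braid : ∀ a b : FreeSymm J, motive (β_ a b).hom) : motive f := by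
  induction f using Quotient.inductionOn with | _ f
  induction f with
  | of f => exact of f
  | id a => exact id a
  | comp f g hf hg => exact comp _ _ hf hg
  | tensor f g hf hg => exact tensor _ _ hf hg
  | assocHom a b c => exact assocHom a b c
  | assocInv a b c => exact assocInv a b c
  | leftHom a => exact leftHom a
  | leftInv a => exact leftInv a
  | rightHom a => exact rightHom a
  | rightInv a => exact rightInv a
  | braid a b => exact braid a b

end Homs

section Aux

variable {D : Type w₂} [Category.{w} D] [MonoidalCategory D]

theorem lift_aux₁ (x y z : D) : (𝟙 (x ⊗ y)) ▷ z ≫ 𝟙 ((x ⊗ y) ⊗ z) ≫ (α_ x y z).hom =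
    (α_ x y z).hom ≫ x ◁ 𝟙 (y ⊗ z) ≫ 𝟙 (x ⊗ y ⊗ z) := by simp

theorem lift_aux₂ (x : D) : (λ_ x).hom = 𝟙 (𝟙_ D) ▷ x ≫ 𝟙 (𝟙_ D ⊗ x) ≫ (λ_ x).hom := by simp

theorem lift_aux₃ (x : D) : (ρ_ x).hom = x ◁ 𝟙 (𝟙_ D) ≫ 𝟙 (x ⊗ 𝟙_ D) ≫ (ρ_ x).hom := by simp

end Aux

section Lift

variable {J : Type u} [SmallCategory J] {D : Type w₂} [Category.{w} D] [MonoidalCategory D]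
  [SymmetricCategory D] (F : J ⥤ D)

/-- The tensor product of the values of `F` along a word. -/
def liftObj : FreeSymm J → D
  | of x => F.obj x
  | unit => 𝟙_ D
  | tensor a b => liftObj a ⊗ liftObj b

/-- The action of formal morphisms. -/
def liftPre : ∀ {a b : FreeSymm J}, PreHom a b → (liftObj F a ⟶ liftObj F b)
  | _, _, .of f => F.map f
  | _, _, .id _ => 𝟙 _
  | _, _, .comp f g => liftPre f ≫ liftPre g
  | _, _, .tensor f g => liftPre f ⊗ₘ liftPre g
  | _, _, .assocHom _ _ _ => (α_ _ _ _).hom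
  | _, _, .assocInv _ _ _ => (α_ _ _ _).inv
  | _, _, .leftHom _ => (λ_ _).hom
  | _, _, .leftInv _ => (λ_ _).inv
  | _, _, .rightHom _ => (ρ_ _).hom
  | _, _, .rightInv _ => (ρ_ _).inv
  | _, _, .braid _ _ => (β_ _ _).hom

theorem liftPre_rel {a b : FreeSymm J} {f g : PreHom a b} (h : Rel f g) :
    liftPre F f = liftPre F g := by
  induction h with
  | refl => rfl
  | symm _ ih => exact ih.symm
  | trans _ _ ih ih' => exact ih.trans ih'
  | comp _ _ ih ih' => simp only [liftPre, ih, ih']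
  | tensor _ _ ih ih' => exact congrArg₂ (fun p q => p ⊗ₘ q) ih ih'
  | id_comp => simp only [liftPre, Category.id_comp]
  | comp_id => simp only [liftPre, Category.comp_id]
  | assoc => simp only [liftPre, Category.assoc]
  | of_id x => exact F.map_id x
  | of_comp f g => exact F.map_comp f g
  | tensor_id => exact id_tensorHom_id _ _
  | tensor_comp => exact tensorHom_comp_tensorHom _ _ _ _
  | assoc_hom_inv => exact (α_ _ _ _).hom_inv_id
  | assoc_inv_hom => exact (α_ _ _ _).inv_hom_id
  | assoc_nat => exact associator_naturality _ _ _
  | left_hom_inv => exact (λ_ _).hom_inv_id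
  | left_inv_hom => exact (λ_ _).inv_hom_id
  | left_nat =>
    have := leftUnitor_naturality (liftPre F ‹_›)
    rw [← id_tensorHom] at this
    exact this
  | right_hom_inv => exact (ρ_ _).hom_inv_id
  | right_inv_hom => exact (ρ_ _).inv_hom_id
  | right_nat =>
    have := rightUnitor_naturality (liftPre F ‹_›)
    rw [← tensorHom_id] at this
    exact this
  | pentagon a b c d =>
    have := MonoidalCategory.pentagon (liftObj F a) (liftObj F b) (liftObj F c) (liftObj F d)
    rw [← tensorHom_id, ← id_tensorHom] at this
    exact this
  | triangle a b =>
    have := MonoidalCategory.triangle (liftObj F a) (liftObj F b)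
    rw [← tensorHom_id, ← id_tensorHom] at this
    exact this
  | braid_nat => exact BraidedCategory.braiding_naturality _ _
  | braid_braid => exact SymmetricCategory.symmetry _ _
  | hexagon a b c =>
    have := BraidedCategory.hexagon_forward (liftObj F a) (liftObj F b) (liftObj F c)
    rw [← tensorHom_id, ← id_tensorHom] at this
    exact this

/-- The symmetric monoidal functor on the free symmetric monoidal category extending `F`. -/
def lift : FreeSymm J ⥤ D where
  obj := liftObj F
  map f := Quotient.lift (liftPre F) (fun _ _ h => liftPre_rel F h) f
  map_id _ := rfl
  map_comp := by rintro _ _ _ ⟨f⟩ ⟨g⟩; rfl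

theorem lift_map_tensorHom {a b c d : FreeSymm J} (f : a ⟶ c) (g : b ⟶ d) :
    (lift F).map (f ⊗ₘ g) = (lift F).map f ⊗ₘ (lift F).map g := by
  obtain ⟨f⟩ := f
  obtain ⟨g⟩ := g
  rfl

instance liftMonoidal : (lift F).Monoidal :=
  Functor.CoreMonoidal.toMonoidal
    { εIso := Iso.refl _
      μIso := fun _ _ => Iso.refl _
      μIso_hom_natural_left := fun {a b} f c => by
        have := lift_map_tensorHom F f (𝟙 c)
        rw [tensorHom_id, (lift F).map_id, tensorHom_id] at this
        exact (Category.comp_id _).trans (this.symm.trans (Category.id_comp _).symm)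
      μIso_hom_natural_right := fun {a b} c f => by
        have := lift_map_tensorHom F (𝟙 c) f
        rw [id_tensorHom, (lift F).map_id, id_tensorHom] at this
        exact (Category.comp_id _).trans (this.symm.trans (Category.id_comp _).symm)
      associativity := fun a b c => lift_aux₁ (liftObj F a) (liftObj F b) (liftObj F c)
      left_unitality := fun a => lift_aux₂ (liftObj F a)
      right_unitality := fun a => lift_aux₃ (liftObj F a) }

instance liftBraided : (lift F).Braided where
  braided a b := by
    have h : (lift F).map (β_ a b).hom = (β_ ((lift F).obj a) ((lift F).obj b)).hom := rfl
    rw [h]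
    exact (Category.id_comp _).trans (Category.comp_id _).symm

end Lift

section Extend

variable {J : Type u} [SmallCategory J] {D : Type w₂} [Category.{w} D] [MonoidalCategory D]

/-- The components of the monoidal transformation with given components on generators. -/
def extendApp (A B : FreeSymm J ⥤ D) [A.Monoidal] [B.Monoidal]
    (η : ∀ x : J, A.obj (incl.obj x) ⟶ B.obj (incl.obj x)) :
    ∀ w : FreeSymm J, A.obj w ⟶ B.obj w
  | of x => η x
  | unit => Functor.OplaxMonoidal.η A ≫ ε B
  | tensor a b => δ A a b ≫ (extendApp A B η a ⊗ₘ extendApp A B η b) ≫ μ B a b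

variable [SymmetricCategory D]

theorem extendApp_natural (A B : FreeSymm J ⥤ D) [A.Braided] [B.Braided]
    (η : ∀ x : J, A.obj (incl.obj x) ⟶ B.obj (incl.obj x))
    (hη : ∀ {x y : J} (f : x ⟶ y), A.map (incl.map f) ≫ η y = η x ≫ B.map (incl.map f))
    {a b : FreeSymm J} (f : a ⟶ b) :
    A.map f ≫ extendApp A B η b = extendApp A B η a ≫ B.map f := by
  have ht : ∀ a b, extendApp A B η (a ⊗ b) =
    δ A a b ≫ (extendApp A B η a ⊗ₘ extendApp A B η b) ≫ μ B a b := fun _ _ => rfl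
  have hu : extendApp A B η (𝟙_ _) = Functor.OplaxMonoidal.η A ≫ ε B := rfl
  have key : ∀ {a b : FreeSymm J} (e : a ≅ b),
      A.map e.hom ≫ extendApp A B η b = extendApp A B η a ≫ B.map e.hom →
      A.map e.inv ≫ extendApp A B η a = extendApp A B η b ≫ B.map e.inv := by
    intro a b e h
    rw [← cancel_epi (A.map e.hom), ← A.map_comp_assoc, reassoc_of% h, ← B.map_comp]
    simp
  have hα : ∀ a b c : FreeSymm J, A.map (α_ a b c).hom ≫ extendApp A B η (a ⊗ b ⊗ c) =
      extendApp A B η ((a ⊗ b) ⊗ c) ≫ B.map (α_ a b c).hom := by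
    intro a b c
    have e₁ : extendApp A B η a ⊗ₘ
        (δ A b c ≫ (extendApp A B η b ⊗ₘ extendApp A B η c) ≫ μ B b c) =
        A.obj a ◁ δ A b c ≫ (extendApp A B η a ⊗ₘ (extendApp A B η b ⊗ₘ extendApp A B η c)) ≫
          B.obj a ◁ μ B b c := by
      simp only [← id_tensorHom, tensorHom_comp_tensorHom, Category.id_comp, Category.comp_id]
    have e₂ : (δ A a b ≫ (extendApp A B η a ⊗ₘ extendApp A B η b) ≫ μ B a b) ⊗ₘ
        extendApp A B η c =
        δ A a b ▷ A.obj c ≫ ((extendApp A B η a ⊗ₘ extendApp A B η b) ⊗ₘ extendApp A B η c) ≫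
          μ B a b ▷ B.obj c := by
      simp only [← tensorHom_id, tensorHom_comp_tensorHom, Category.id_comp, Category.comp_id]
    rw [ht, ht, ht, ht, e₁, e₂]
    simp only [Category.assoc]
    rw [Functor.LaxMonoidal.associativity, associator_naturality_assoc,
      Functor.OplaxMonoidal.associativity_assoc]
  have hl : ∀ a : FreeSymm J, A.map (λ_ a).hom ≫ extendApp A B η a =
      extendApp A B η (𝟙_ _ ⊗ a) ≫ B.map (λ_ a).hom := by
    intro a
    have e : (Functor.OplaxMonoidal.η A ≫ ε B) ⊗ₘ extendApp A B η a =
        Functor.OplaxMonoidal.η A ▷ A.obj a ≫ (𝟙_ D ◁ extendApp A B η a) ≫ ε B ▷ B.obj a := by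
      simp only [← tensorHom_id, ← id_tensorHom, tensorHom_comp_tensorHom, Category.id_comp,
        Category.comp_id]
    rw [ht, hu, e]
    simp only [Category.assoc]
    rw [← Functor.LaxMonoidal.left_unitality, leftUnitor_naturality,
      Functor.Monoidal.map_leftUnitor]
    simp only [Category.assoc]
  have hr : ∀ a : FreeSymm J, A.map (ρ_ a).hom ≫ extendApp A B η a =
      extendApp A B η (a ⊗ 𝟙_ _) ≫ B.map (ρ_ a).hom := by
    intro a
    have e : extendApp A B η a ⊗ₘ (Functor.OplaxMonoidal.η A ≫ ε B) =
        A.obj a ◁ Functor.OplaxMonoidal.η A ≫ (extendApp A B η a ▷ 𝟙_ D) ≫ B.obj a ◁ ε B := by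
      simp only [← tensorHom_id, ← id_tensorHom, tensorHom_comp_tensorHom, Category.id_comp,
        Category.comp_id]
    rw [ht, hu, e]
    simp only [Category.assoc]
    rw [← Functor.LaxMonoidal.right_unitality, rightUnitor_naturality,
      Functor.Monoidal.map_rightUnitor]
    simp only [Category.assoc]
  induction f using hom_induction with
  | of f => exact hη f
  | id a => simp
  | comp f g hf hg => rw [A.map_comp, B.map_comp, Category.assoc, hg, reassoc_of% hf]
  | tensor f g hf hg =>
    rw [ht, ht]
    simp only [Functor.Monoidal.map_tensor, Category.assoc, Functor.Monoidal.μ_δ_assoc,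
      tensorHom_comp_tensorHom_assoc, hf, hg]
  | assocHom a b c => exact hα a b c
  | assocInv a b c => exact key _ (hα a b c)
  | leftHom a => exact hl a
  | leftInv a => exact key _ (hl a)
  | rightHom a => exact hr a
  | rightInv a => exact key _ (hr a)
  | braid a b =>
    rw [ht, ht]
    simp only [Functor.map_braiding, Category.assoc, Functor.Monoidal.μ_δ_assoc,
      BraidedCategory.braiding_naturality_assoc]

/-- The monoidal transformation with given components on generators. -/
def extend (A B : FreeSymm J ⥤ D) [A.Braided] [B.Braided]
    (η : ∀ x : J, A.obj (incl.obj x) ⟶ B.obj (incl.obj x))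
    (hη : ∀ {x y : J} (f : x ⟶ y), A.map (incl.map f) ≫ η y = η x ≫ B.map (incl.map f)) :
    A ⟶ B where
  app := extendApp A B η
  naturality _ _ f := extendApp_natural A B η hη f

end Extend

section PointwiseTensor

variable {J : Type u} [SmallCategory J] {D : Type w₂} [Category.{w} D] [MonoidalCategory D]
  [SymmetricCategory D]

/-- The pointwise tensor product of two functors. -/
def ptensor {C : Type u} [Category.{v} C] (A B : C ⥤ D) : C ⥤ D where
  obj w := A.obj w ⊗ B.obj w
  map f := A.map f ⊗ₘ B.map f
  map_id w := by rw [A.map_id, B.map_id, id_tensorHom_id]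
  map_comp f g := by rw [A.map_comp, B.map_comp, tensorHom_comp_tensorHom]

theorem tensorμ_braid (x y z t : D) :
    tensorμ x y z t ≫ ((β_ x z).hom ⊗ₘ (β_ y t).hom) =
      (β_ (x ⊗ y) (z ⊗ t)).hom ≫ tensorμ z t x y := by
  have h : z ◁ (β_ x t).hom ▷ y ≫ z ◁ (β_ t x).hom ▷ y = 𝟙 _ := by
    rw [← MonoidalCategory.whiskerLeft_comp, ← comp_whiskerRight, SymmetricCategory.symmetry,
      id_whiskerRight, MonoidalCategory.whiskerLeft_id]
  simp [tensorμ, MonoidalCategory.tensorHom_def, reassoc_of% h]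

section

variable {C : Type u} [Category.{v} C] [MonoidalCategory C] [SymmetricCategory C] (A B : C ⥤ D)
    [A.Braided] [B.Braided]

instance ptensorMonoidal : (ptensor A B).Monoidal :=
  Functor.CoreMonoidal.toMonoidal
    { εIso := (λ_ (𝟙_ D)).symm ≪≫ (Functor.Monoidal.εIso A ⊗ᵢ Functor.Monoidal.εIso B)
      μIso := fun a b =>
        { hom := tensorμ (A.obj a) (B.obj a) (A.obj b) (B.obj b) ≫ (μ A a b ⊗ₘ μ B a b)
          inv := (δ A a b ⊗ₘ δ B a b) ≫ tensorδ (A.obj a) (B.obj a) (A.obj b) (B.obj b)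
          hom_inv_id := by
            change (tensorμ _ _ _ _ ≫ (μ A a b ⊗ₘ μ B a b)) ≫ (δ A a b ⊗ₘ δ B a b) ≫
              tensorδ _ _ _ _ = 𝟙 ((A.obj a ⊗ B.obj a) ⊗ (A.obj b ⊗ B.obj b))
            simp only [Category.assoc, tensorHom_comp_tensorHom_assoc, Functor.Monoidal.μ_δ,
              id_tensorHom_id, Category.id_comp, tensorμ_tensorδ]
          inv_hom_id := by
            change ((δ A a b ⊗ₘ δ B a b) ≫ tensorδ _ _ _ _) ≫ tensorμ _ _ _ _ ≫
              (μ A a b ⊗ₘ μ B a b) = 𝟙 (A.obj (a ⊗ b) ⊗ B.obj (a ⊗ b))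
            simp only [Category.assoc, tensorδ_tensorμ_assoc, tensorHom_comp_tensorHom,
              Functor.Monoidal.δ_μ, id_tensorHom_id] }
      μIso_hom_natural_left := fun {a b} f c => by
        change (A.map f ⊗ₘ B.map f) ▷ (A.obj c ⊗ B.obj c) ≫ tensorμ _ _ _ _ ≫ (_ ⊗ₘ _) =
          (tensorμ _ _ _ _ ≫ (μ A a c ⊗ₘ μ B a c)) ≫ (A.map (f ▷ c) ⊗ₘ B.map (f ▷ c))
        rw [reassoc_of% tensorμ_natural_left]
        simp only [Category.assoc, tensorHom_comp_tensorHom, Functor.LaxMonoidal.μ_natural_left]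
      μIso_hom_natural_right := fun {a b} c f => by
        change (A.obj c ⊗ B.obj c) ◁ (A.map f ⊗ₘ B.map f) ≫ tensorμ _ _ _ _ ≫ (_ ⊗ₘ _) =
          (tensorμ _ _ _ _ ≫ (μ A c a ⊗ₘ μ B c a)) ≫ (A.map (c ◁ f) ⊗ₘ B.map (c ◁ f))
        rw [reassoc_of% tensorμ_natural_right]
        simp only [Category.assoc, tensorHom_comp_tensorHom, Functor.LaxMonoidal.μ_natural_right]
      associativity := fun a b c => by
        change (tensorμ _ _ _ _ ≫ (μ A a b ⊗ₘ μ B a b)) ▷ (A.obj c ⊗ B.obj c) ≫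
            (tensorμ _ _ _ _ ≫ (μ A (a ⊗ b) c ⊗ₘ μ B (a ⊗ b) c)) ≫
            (A.map (α_ a b c).hom ⊗ₘ B.map (α_ a b c).hom) =
          (α_ (A.obj a ⊗ B.obj a) (A.obj b ⊗ B.obj b) (A.obj c ⊗ B.obj c)).hom ≫
            (A.obj a ⊗ B.obj a) ◁ (tensorμ _ _ _ _ ≫ (μ A b c ⊗ₘ μ B b c)) ≫
              tensorμ _ _ _ _ ≫ (μ A a (b ⊗ c) ⊗ₘ μ B a (b ⊗ c))
        simp only [comp_whiskerRight, MonoidalCategory.whiskerLeft_comp, Category.assoc]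
        rw [reassoc_of% tensorμ_natural_left, reassoc_of% tensorμ_natural_right]
        simp only [tensorHom_comp_tensorHom, Functor.LaxMonoidal.associativity]
        have := tensor_associativity (A.obj a) (B.obj a) (A.obj b) (B.obj b) (A.obj c) (B.obj c)
        rw [← reassoc_of% this]
        simp only [tensorHom_comp_tensorHom]
      left_unitality := fun a => by
        change (λ_ (A.obj a ⊗ B.obj a)).hom =
          ((λ_ (𝟙_ D)).inv ≫ (ε A ⊗ₘ ε B)) ▷ (A.obj a ⊗ B.obj a) ≫
            (tensorμ _ _ _ _ ≫ (μ A (𝟙_ C) a ⊗ₘ μ B (𝟙_ C) a)) ≫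
            (A.map (λ_ a).hom ⊗ₘ B.map (λ_ a).hom)
        simp only [comp_whiskerRight, Category.assoc]
        rw [reassoc_of% tensorμ_natural_left]
        simp only [tensorHom_comp_tensorHom, ← Functor.LaxMonoidal.left_unitality]
        exact tensor_left_unitality _ _
      right_unitality := fun a => by
        change (ρ_ (A.obj a ⊗ B.obj a)).hom =
          (A.obj a ⊗ B.obj a) ◁ ((λ_ (𝟙_ D)).inv ≫ (ε A ⊗ₘ ε B)) ≫
            (tensorμ _ _ _ _ ≫ (μ A a (𝟙_ C) ⊗ₘ μ B a (𝟙_ C))) ≫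
            (A.map (ρ_ a).hom ⊗ₘ B.map (ρ_ a).hom)
        simp only [MonoidalCategory.whiskerLeft_comp, Category.assoc]
        rw [reassoc_of% tensorμ_natural_right]
        simp only [tensorHom_comp_tensorHom, ← Functor.LaxMonoidal.right_unitality]
        exact tensor_right_unitality _ _ }

instance : (ptensor A B).Braided where
  braided a b := by
    change (tensorμ _ _ _ _ ≫ (μ A a b ⊗ₘ μ B a b)) ≫ (A.map (β_ a b).hom ⊗ₘ B.map (β_ a b).hom) =
      (β_ (A.obj a ⊗ B.obj a) (A.obj b ⊗ B.obj b)).hom ≫ tensorμ _ _ _ _ ≫ (μ A b a ⊗ₘ μ B b a)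
    rw [← reassoc_of% tensorμ_braid]
    simp only [Category.assoc, tensorHom_comp_tensorHom, Functor.LaxBraided.braided]

end

end PointwiseTensor

section Calculus

variable {J : Type u} [SmallCategory J] {D : Type w₂} [Category.{w} D] [MonoidalCategory D]
  [SymmetricCategory D]

/-- The transformation of tensor words induced by a natural transformation of the letters. -/
def liftMap {F G : J ⥤ D} (τ : F ⟶ G) : lift F ⟶ lift G :=
  extend (lift F) (lift G) τ.app (fun f => τ.naturality f)

end Calculus

end FreeSymm

section NatHom

variable {J : Type u} [SmallCategory J] {V : Type (u + 1)} [Category.{u} V] [MonoidalCategory V]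
  [MonoidalClosed V] [HasLimits V]

/-- The object of natural transformations `∫_j [F j, G j]`. -/
noncomputable def NatHom (F G : J ⥤ V) : V :=
  end_ (F.op ⋙ MonoidalClosed.internalHom ⋙ (Functor.whiskeringLeft J V V).obj G)

namespace NatHom

variable {F G : J ⥤ V}

/-- The projections of the end. -/
noncomputable def proj (F G : J ⥤ V) (j : J) : NatHom F G ⟶ (ihom (F.obj j)).obj (G.obj j) :=
  end_.π (F.op ⋙ MonoidalClosed.internalHom ⋙ (Functor.whiskeringLeft J V V).obj G) j

/-- Evaluation of an internal natural transformation at `j`. -/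
noncomputable def ev (F G : J ⥤ V) (j : J) : F.obj j ⊗ NatHom F G ⟶ G.obj j :=
  MonoidalClosed.uncurry (proj F G j)

theorem ev_natural {i j : J} (f : i ⟶ j) :
    F.map f ▷ NatHom F G ≫ ev F G j = ev F G i ≫ G.map f := by
  have h : proj F G i ≫ (ihom (F.obj i)).map (G.map f) =
      proj F G j ≫ (MonoidalClosed.pre (F.map f)).app (G.obj j) := end_.condition
    (F.op ⋙ MonoidalClosed.internalHom ⋙ (Functor.whiskeringLeft J V V).obj G) f
  rw [ev, ev, ← MonoidalClosed.uncurry_pre_app, ← h, MonoidalClosed.uncurry_natural_right]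

/-- A family of maps `F j ⊗ T ⟶ G j`, natural in `j`, is a map `T ⟶ NatHom F G`. -/
noncomputable def lift {T : V} (φ : ∀ j, F.obj j ⊗ T ⟶ G.obj j)
    (hφ : ∀ {i j : J} (f : i ⟶ j), F.map f ▷ T ≫ φ j = φ i ≫ G.map f) : T ⟶ NatHom F G :=
  end_.lift (fun j => MonoidalClosed.curry (φ j)) (fun i j f => by
    have h₁ := MonoidalClosed.curry_natural_right (φ i) (G.map f)
    have h₂ := MonoidalClosed.curry_pre_app (F.map f) (φ j)
    exact h₁.symm.trans ((congrArg MonoidalClosed.curry (hφ f).symm).trans h₂.symm))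

theorem lift_ev {T : V} (φ : ∀ j, F.obj j ⊗ T ⟶ G.obj j)
    (hφ : ∀ {i j : J} (f : i ⟶ j), F.map f ▷ T ≫ φ j = φ i ≫ G.map f) (j : J) :
    F.obj j ◁ lift φ hφ ≫ ev F G j = φ j := by
  have h : lift φ hφ ≫ proj F G j = MonoidalClosed.curry (φ j) :=
    end_.lift_π (F := F.op ⋙ MonoidalClosed.internalHom ⋙
      (Functor.whiskeringLeft J V V).obj G) _ _ j
  rw [ev, ← MonoidalClosed.uncurry_natural_left, h, MonoidalClosed.uncurry_curry]

theorem hom_ext {T : V} {f g : T ⟶ NatHom F G}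
    (h : ∀ j, F.obj j ◁ f ≫ ev F G j = F.obj j ◁ g ≫ ev F G j) : f = g := by
  refine end_.hom_ext (fun j => ?_)
  change f ≫ proj F G j = g ≫ proj F G j
  apply MonoidalClosed.uncurry_injective
  rw [MonoidalClosed.uncurry_natural_left, MonoidalClosed.uncurry_natural_left]
  exact h j

theorem map_aux {G' : J ⥤ V} (τ : G ⟶ G') {i j : J} (f : i ⟶ j) :
    F.map f ▷ NatHom F G ≫ ev F G j ≫ τ.app j = (ev F G i ≫ τ.app i) ≫ G'.map f := by
  rw [← Category.assoc, ev_natural, Category.assoc, Category.assoc, τ.naturality]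

/-- Covariant functoriality. -/
noncomputable def map {G' : J ⥤ V} (τ : G ⟶ G') : NatHom F G ⟶ NatHom F G' :=
  lift (fun j => ev F G j ≫ τ.app j) (map_aux τ)

theorem pre_aux {F' : J ⥤ V} (σ : F' ⟶ F) {i j : J} (f : i ⟶ j) :
    F'.map f ▷ NatHom F G ≫ σ.app j ▷ NatHom F G ≫ ev F G j =
      (σ.app i ▷ NatHom F G ≫ ev F G i) ≫ G.map f := by
  rw [← comp_whiskerRight_assoc, σ.naturality, comp_whiskerRight_assoc, ev_natural,
    Category.assoc]

/-- Contravariant functoriality. -/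
noncomputable def pre {F' : J ⥤ V} (σ : F' ⟶ F) : NatHom F G ⟶ NatHom F' G :=
  lift (fun j => σ.app j ▷ NatHom F G ≫ ev F G j) (pre_aux σ)

/-- Restriction along a functor. -/
noncomputable def restrict {I : Type u} [SmallCategory I] (K : I ⥤ J) :
    NatHom F G ⟶ NatHom (K ⋙ F) (K ⋙ G) :=
  lift (fun i => ev F G (K.obj i)) (fun f => ev_natural (K.map f))

theorem map_ev {G' : J ⥤ V} (τ : G ⟶ G') (j : J) :
    F.obj j ◁ map τ ≫ ev F G' j = ev F G j ≫ τ.app j :=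
  lift_ev _ (map_aux τ) j

theorem pre_ev {F' : J ⥤ V} (σ : F' ⟶ F) (j : J) :
    F'.obj j ◁ pre σ ≫ ev F' G j = σ.app j ▷ NatHom F G ≫ ev F G j :=
  lift_ev _ (pre_aux σ) j

theorem restrict_ev {I : Type u} [SmallCategory I] (K : I ⥤ J) (i : I) :
    F.obj (K.obj i) ◁ restrict K ≫ ev (K ⋙ F) (K ⋙ G) i = ev F G (K.obj i) :=
  lift_ev (F := K ⋙ F) (G := K ⋙ G) (fun i => ev F G (K.obj i))
    (fun f => ev_natural (K.map f)) i

theorem map_comp {G' G'' : J ⥤ V} (τ : G ⟶ G') (τ' : G' ⟶ G'') :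
    map (F := F) τ ≫ map τ' = map (τ ≫ τ') := hom_ext (fun j => by
  rw [map_ev, MonoidalCategory.whiskerLeft_comp, Category.assoc, map_ev, ← Category.assoc,
    map_ev, Category.assoc, NatTrans.comp_app])

theorem pre_map {F' G' : J ⥤ V} (σ : F' ⟶ F) (τ : G ⟶ G') :
    pre (G := G) σ ≫ map τ = map τ ≫ pre σ := hom_ext (fun j => by
  rw [MonoidalCategory.whiskerLeft_comp, Category.assoc, map_ev, ← Category.assoc, pre_ev,
    MonoidalCategory.whiskerLeft_comp, Category.assoc, Category.assoc, pre_ev,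
    whisker_exchange_assoc, map_ev])

theorem restrict_map {I : Type u} [SmallCategory I] (K : I ⥤ J) {G' : J ⥤ V} (τ : G ⟶ G') :
    restrict (F := F) K ≫ map (Functor.whiskerLeft K τ) = map τ ≫ restrict K :=
  hom_ext (fun i => by
    change F.obj (K.obj i) ◁ (restrict (F := F) K ≫ map (Functor.whiskerLeft K τ)) ≫ _ =
      F.obj (K.obj i) ◁ (map τ ≫ restrict K) ≫ _
    have h₁ : F.obj (K.obj i) ◁ map (Functor.whiskerLeft K τ) ≫ ev (K ⋙ F) (K ⋙ G') i =
      ev (K ⋙ F) (K ⋙ G) i ≫ τ.app (K.obj i) := map_ev (F := K ⋙ F) _ i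
    rw [MonoidalCategory.whiskerLeft_comp, Category.assoc, h₁, ← Category.assoc,
      restrict_ev, ← map_ev, MonoidalCategory.whiskerLeft_comp, Category.assoc, restrict_ev])

end NatHom

end NatHom

section Words

open FreeSymm

/-- `S(X)`, the free symmetric monoidal category on the set `X` of colours: words `x₁…xₙ` in the
colours and their permutations. It is a groupoid, and so is identified with its opposite. -/
abbrev Words (X : Type u) : Type u := FreeSymm (Discrete X)

/-- Words `(x₁,z₁)…(xₙ,zₙ)` of colours `xᵢ`, each decorated by a word `zᵢ` of colours. Morphisms
permute the letters and permute inside each `zᵢ`. -/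
abbrev Words₂ (X : Type u) : Type u := FreeSymm (Discrete X × Words X)

/-- Words `(x₁,W₁)…(xₙ,Wₙ)` of colours `xᵢ`, each decorated by an object `Wᵢ` of `Words₂ X`. -/
abbrev Words₃ (X : Type u) : Type u := FreeSymm (Discrete X × Words₂ X)

variable {X : Type u}

/-- The one-letter word. -/
abbrev letter (x : X) : Words X := incl.obj (Discrete.mk x)

/-- `(x₁,z₁)…(xₙ,zₙ) ↦ x₁…xₙ` -/
abbrev head : Words₂ X ⥤ Words X := lift (CategoryTheory.Prod.fst _ _ ⋙ incl)

/-- `(x₁,z₁)…(xₙ,zₙ) ↦ z₁…zₙ` -/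
abbrev join : Words₂ X ⥤ Words X := lift (CategoryTheory.Prod.snd _ _)

/-- `x₁…xₙ ↦ (x₁,x₁)…(xₙ,xₙ)` -/
abbrev double : Words X ⥤ Words₂ X :=
  lift (Discrete.functor fun x => incl.obj (Discrete.mk x, letter x))

/-- `(x₁,W₁)…(xₙ,Wₙ) ↦ (x₁,head W₁)…(xₙ,head Wₙ)` -/
abbrev heads : Words₃ X ⥤ Words₂ X := lift ((𝟭 (Discrete X)).prod head ⋙ incl)

/-- `(x₁,W₁)…(xₙ,Wₙ) ↦ (x₁,join W₁)…(xₙ,join Wₙ)` -/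
abbrev joins : Words₃ X ⥤ Words₂ X := lift ((𝟭 (Discrete X)).prod join ⋙ incl)

/-- `(x₁,W₁)…(xₙ,Wₙ) ↦ W₁…Wₙ` -/
abbrev join₂ : Words₃ X ⥤ Words₂ X := lift (CategoryTheory.Prod.snd _ _)

/-- The canonical morphism `w ⟶ head (double w)`. -/
def toHeadDouble : ∀ w : Words X, w ⟶ head.obj (double.obj w) :=
  extendApp (𝟭 _) (double ⋙ head) (fun x => 𝟙 (incl.obj x))

/-- The canonical morphism `join (double w) ⟶ w`. -/
def joinDouble : ∀ w : Words X, join.obj (double.obj w) ⟶ w :=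
  extendApp (double ⋙ join) (𝟭 _) (fun x => 𝟙 (incl.obj x))

/-- The canonical morphism `head (heads W) ⟶ head (joins W)`. -/
def headHeads : ∀ W : Words₃ X, head.obj (heads.obj W) ⟶ head.obj (joins.obj W) :=
  extendApp (heads ⋙ head) (joins ⋙ head) (fun g => 𝟙 (incl.obj g.1))

/-- The canonical morphism `join (heads W) ⟶ head (join₂ W)`. -/
def joinHeads : ∀ W : Words₃ X, join.obj (heads.obj W) ⟶ head.obj (join₂.obj W) :=
  extendApp (heads ⋙ join) (join₂ ⋙ head) (fun g => 𝟙 (head.obj g.2))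

/-- The canonical morphism `join (joins W) ⟶ join (join₂ W)`. -/
def joinJoins : ∀ W : Words₃ X, join.obj (joins.obj W) ⟶ join.obj (join₂.obj W) :=
  extendApp (joins ⋙ join) (join₂ ⋙ join) (fun g => 𝟙 (join.obj g.2))

end Words

section Operads

open FreeSymm

variable {X : Type u} {V : Type (u + 1)} [Category.{u} V] [MonoidalCategory V]
  [SymmetricCategory V]

/-- `(x₁,z₁)…(xₙ,zₙ) ↦ P(z₁;x₁) ⊗ ⋯ ⊗ P(zₙ;xₙ)` -/
abbrev tens (P : X → Words X ⥤ V) : Words₂ X ⥤ V :=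
  lift (Functor.uncurry.obj (Discrete.functor P))

/-- `η ⊗ ⋯ ⊗ η : 𝟙 ⟶ P(x₁;x₁) ⊗ ⋯ ⊗ P(xₙ;xₙ)` -/
def units (P : X → Words X ⥤ V) (one : ∀ x, 𝟙_ V ⟶ (P x).obj (letter x)) :
    ∀ w : Words X, 𝟙_ V ⟶ (tens P).obj (double.obj w)
  | .of x => one x.as
  | .unit => 𝟙 (𝟙_ V)
  | .tensor a b => (λ_ (𝟙_ V)).inv ≫ (units P one a ⊗ₘ units P one b)

/-- For `W = (x₁,W₁)…(xₙ,Wₙ)`, the tensor product over `i` of the compositions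
`P(head Wᵢ;xᵢ) ⊗ tens P Wᵢ ⟶ P(join Wᵢ;xᵢ)`. -/
def innerComp (P : X → Words X ⥤ V)
    (comp : ∀ y, ptensor (head ⋙ P y) (tens P) ⟶ join ⋙ P y) (W : Words₃ X) :
    (tens P).obj (heads.obj W) ⊗ (tens P).obj (join₂.obj W) ⟶ (tens P).obj (joins.obj W) :=
  extendApp (ptensor (heads ⋙ tens P) (join₂ ⋙ tens P)) (joins ⋙ tens P)
    (fun g => (comp g.1.as).app g.2) W

/-- A symmetric operad in `V` with set of colours `X`: objects of operations `P(w;y)` with inputs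
`w = x₁…xₙ` and output `y`, functorial for permutations of the inputs, units `𝟙 ⟶ P(x;x)`, and
compositions `P(x₁…xₙ;y) ⊗ (P(z₁;x₁) ⊗ ⋯ ⊗ P(zₙ;xₙ)) ⟶ P(z₁⋯zₙ;y)`, equivariant for all
permutations, unital and associative. -/
structure ColoredOperad (X : Type u) (V : Type (u + 1)) [Category.{u} V] [MonoidalCategory V]
    [SymmetricCategory V] where
  ops : X → Words X ⥤ V
  one : ∀ x, 𝟙_ V ⟶ (ops x).obj (letter x)
  comp : ∀ y, ptensor (head ⋙ ops y) (tens ops) ⟶ join ⋙ ops y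
  one_comp : ∀ (y : X) (z : Words X),
    (λ_ ((ops y).obj z)).inv ≫ one y ▷ (ops y).obj z ≫
      (comp y).app (incl.obj (Discrete.mk y, z)) = 𝟙 ((ops y).obj z)
  comp_one : ∀ (y : X) (w : Words X),
    (ρ_ ((ops y).obj w)).inv ≫ ((ops y).map (toHeadDouble w) ⊗ₘ units ops one w) ≫
      (comp y).app (double.obj w) ≫ (ops y).map (joinDouble w) = 𝟙 ((ops y).obj w)
  assoc : ∀ (y : X) (W : Words₃ X),
    ((ops y).map (headHeads W) ⊗ₘ innerComp ops comp W) ≫ (comp y).app (joins.obj W) ≫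
        (ops y).map (joinJoins W) =
      (α_ ((ops y).obj (head.obj (heads.obj W))) ((tens ops).obj (heads.obj W))
        ((tens ops).obj (join₂.obj W))).inv ≫
        ((comp y).app (heads.obj W) ≫ (ops y).map (joinHeads W)) ▷
          (tens ops).obj (join₂.obj W) ≫
        (comp y).app (join₂.obj W)

/-- `x₁…xₙ ↦ C x₁ ⊗ ⋯ ⊗ C xₙ` -/
abbrev tpow (C : X → V) : Words X ⥤ V := lift (Discrete.functor C)

theorem FreeSymm.extendApp_square {J : Type u} [SmallCategory J] {D : Type w₂} [Category.{w} D]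
    [MonoidalCategory D] {A A' B B' : FreeSymm J ⥤ D} [A.Monoidal] [A'.Monoidal] [B.Monoidal]
    [B'.Monoidal] (η : ∀ x : J, A.obj (incl.obj x) ⟶ B.obj (incl.obj x))
    (η' : ∀ x : J, A'.obj (incl.obj x) ⟶ B'.obj (incl.obj x))
    (σ : ∀ w, A.obj w ⟶ A'.obj w) (τ : ∀ w, B.obj w ⟶ B'.obj w)
    (hσ₁ : ε A ≫ σ (𝟙_ _) = ε A')
    (hσ₂ : ∀ a b, μ A a b ≫ σ (a ⊗ b) = (σ a ⊗ₘ σ b) ≫ μ A' a b)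
    (hτ₁ : ε B ≫ τ (𝟙_ _) = ε B')
    (hτ₂ : ∀ a b, μ B a b ≫ τ (a ⊗ b) = (τ a ⊗ₘ τ b) ≫ μ B' a b)
    (h : ∀ x, η x ≫ τ (incl.obj x) = σ (incl.obj x) ≫ η' x) (w : FreeSymm J) :
    extendApp A B η w ≫ τ w = σ w ≫ extendApp A' B' η' w := by
  induction w with
  | of x => exact h x
  | unit =>
    change (Functor.OplaxMonoidal.η A ≫ ε B) ≫ τ (𝟙_ _) =
      σ (𝟙_ _) ≫ Functor.OplaxMonoidal.η A' ≫ ε B'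
    rw [Category.assoc, hτ₁, ← cancel_epi (ε A), reassoc_of% hσ₁]
    simp
  | tensor a b iha ihb =>
    change (δ A a b ≫ (extendApp A B η a ⊗ₘ extendApp A B η b) ≫ μ B a b) ≫ τ (a ⊗ b) =
      σ (a ⊗ b) ≫ δ A' a b ≫ (extendApp A' B' η' a ⊗ₘ extendApp A' B' η' b) ≫ μ B' a b
    rw [← cancel_epi (μ A a b), reassoc_of% hσ₂]
    simp only [Category.assoc, Functor.Monoidal.μ_δ_assoc, hτ₂, tensorHom_comp_tensorHom_assoc,
      iha, ihb]

/-- Functoriality of tensor powers. -/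
def tpowMap {C D : X → V} (f : ∀ x, C x ⟶ D x) : tpow C ⟶ tpow D :=
  liftMap (Discrete.natTrans fun x => f x.as)

theorem tpowMap_tensor {C D : X → V} (f : ∀ x, C x ⟶ D x) (a b : Words X) :
    (tpowMap f).app (a ⊗ b) = (tpowMap f).app a ⊗ₘ (tpowMap f).app b :=
  (Category.id_comp _).trans (Category.comp_id _)

theorem tpowMap_unit {C D : X → V} (f : ∀ x, C x ⟶ D x) :
    (tpowMap f).app (𝟙_ _) = 𝟙 (𝟙_ V) :=
  Category.comp_id _

theorem tpowMap_letter {C D : X → V} (f : ∀ x, C x ⟶ D x) (x : X) :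
    (tpowMap f).app (letter x) = f x := rfl

theorem tpowMap_comp {C D E : X → V} (f : ∀ x, C x ⟶ D x) (g : ∀ x, D x ⟶ E x) (w : Words X) :
    (tpowMap (fun x => f x ≫ g x)).app w = (tpowMap f).app w ≫ (tpowMap g).app w := by
  induction w with
  | of x => rfl
  | unit =>
    refine (tpowMap_unit _).trans ?_
    refine Eq.trans ?_ (congrArg₂ (fun p q : 𝟙_ V ⟶ 𝟙_ V => p ≫ q) (tpowMap_unit f)
      (tpowMap_unit g)).symm
    exact (Category.id_comp (𝟙 (𝟙_ V))).symm
  | tensor a b iha ihb =>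
    refine (tpowMap_tensor _ a b).trans ?_
    rw [iha, ihb, ← tensorHom_comp_tensorHom, ← tpowMap_tensor, ← tpowMap_tensor]
    rfl

theorem contract_aux {A A' B B' T G G' H H' : V} (a : A ⟶ A') (b : B ⟶ B') (g : G ⟶ G')
    (h : H ⟶ H') (e : A ⊗ T ⟶ G) (e' : A' ⊗ T ⟶ G') (p : B ⊗ G ⟶ H) (p' : B' ⊗ G' ⟶ H')
    (he : a ▷ T ≫ e' = e ≫ g) (hp : (b ⊗ₘ g) ≫ p' = p ≫ h) :
    (a ⊗ₘ b) ▷ T ≫ (β_ A' B').hom ▷ T ≫ (α_ B' A' T).hom ≫ B' ◁ e' ≫ p' =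
      ((β_ A B).hom ▷ T ≫ (α_ B A T).hom ≫ B ◁ e ≫ p) ≫ h := by
  simp only [Category.assoc]
  rw [← hp, ← comp_whiskerRight_assoc, BraidedCategory.braiding_naturality,
    comp_whiskerRight_assoc, MonoidalCategory.tensorHom_def' b a,
    MonoidalCategory.tensorHom_def' b g]
  simp only [comp_whiskerRight, Category.assoc, associator_naturality_middle_assoc,
    associator_naturality_left_assoc]
  rw [← whisker_exchange_assoc, ← MonoidalCategory.whiskerLeft_comp_assoc,
    ← MonoidalCategory.whiskerLeft_comp_assoc, he]

/-- Given `E : F i ⊗ G₀ (K i) ⟶ H i`, the map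
`[F₀, G₀] ⟶ [(F₀ ∘ K) ⊗ F, H]` sending `φ` to `x ⊗ y ↦ E (y ⊗ φ x)`. -/
noncomputable def NatHom.contract [MonoidalClosed V] [HasLimits V] {I J : Type u} [SmallCategory I]
    [SmallCategory J] (K : I ⥤ J) (F₀ G₀ : J ⥤ V) (F H : I ⥤ V)
    (E : ptensor F (K ⋙ G₀) ⟶ H) : NatHom F₀ G₀ ⟶ NatHom (ptensor (K ⋙ F₀) F) H :=
  NatHom.lift (fun i => (β_ (F₀.obj (K.obj i)) (F.obj i)).hom ▷ NatHom F₀ G₀ ≫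
      (α_ (F.obj i) (F₀.obj (K.obj i)) (NatHom F₀ G₀)).hom ≫
        F.obj i ◁ NatHom.ev F₀ G₀ (K.obj i) ≫ E.app i)
    (fun {i j} f => contract_aux (F₀.map (K.map f)) (F.map f) (G₀.map (K.map f)) (H.map f)
      (NatHom.ev F₀ G₀ (K.obj i)) (NatHom.ev F₀ G₀ (K.obj j)) (E.app i) (E.app j)
      (NatHom.ev_natural (K.map f)) (E.naturality f))

theorem evWord_aux {A A' B B' : V} (X Y : V) (t : A ⟶ A') (t' : B ⟶ B') (r : A ⊗ B ⟶ A' ⊗ B')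
    (hr : r = t ⊗ₘ t') :
    (tensorμ X A Y B ≫ (𝟙 (X ⊗ Y) ⊗ₘ (𝟙 (A ⊗ B) ≫ 𝟙 (A ⊗ B)))) ≫ (X ⊗ Y) ◁ r =
      (X ◁ t ⊗ₘ Y ◁ t') ≫ (tensorμ X A' Y B' ≫ (𝟙 (X ⊗ Y) ⊗ₘ (𝟙 (A' ⊗ B') ≫ 𝟙 (A' ⊗ B')))) := by
  have h := tensorμ_natural (𝟙 X) t (𝟙 Y) t'
  rw [id_tensorHom, id_tensorHom, id_tensorHom_id, id_tensorHom] at h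
  subst hr
  simp only [Category.comp_id, id_tensorHom_id]
  exact h.symm

theorem NatHom.contract_ev [MonoidalClosed V] [HasLimits V] {I J : Type u} [SmallCategory I]
    [SmallCategory J] (K : I ⥤ J) (F₀ G₀ : J ⥤ V) (F H : I ⥤ V)
    (E : ptensor F (K ⋙ G₀) ⟶ H) (i : I) :
    (F₀.obj (K.obj i) ⊗ F.obj i) ◁ NatHom.contract K F₀ G₀ F H E ≫
      NatHom.ev (ptensor (K ⋙ F₀) F) H i =
    (β_ (F₀.obj (K.obj i)) (F.obj i)).hom ▷ NatHom F₀ G₀ ≫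
      (α_ (F.obj i) (F₀.obj (K.obj i)) (NatHom F₀ G₀)).hom ≫
        F.obj i ◁ NatHom.ev F₀ G₀ (K.obj i) ≫ E.app i := by
  exact NatHom.lift_ev (F := ptensor (K ⋙ F₀) F) (G := H) _
    (fun {i j} f => contract_aux (F₀.map (K.map f)) (F.map f) (G₀.map (K.map f)) (H.map f)
      (NatHom.ev F₀ G₀ (K.obj i)) (NatHom.ev F₀ G₀ (K.obj j)) (E.app i) (E.app j)
      (NatHom.ev_natural (K.map f)) (E.naturality f)) i

theorem contract_aux₂ {A B T T₁ N N₁ G G₁ H H₁ : V} {c : T ⟶ N} {c₁ : T₁ ⟶ N₁} {m : N ⟶ N₁}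
    {r : T ⟶ T₁} {e : A ⊗ T ⟶ G} {e₁ : A ⊗ T₁ ⟶ G₁} {v : (A ⊗ B) ⊗ N ⟶ H}
    {v₁ : (A ⊗ B) ⊗ N₁ ⟶ H₁} {p : B ⊗ G ⟶ H} {p₁ : B ⊗ G₁ ⟶ H₁} {g : G ⟶ G₁} {h : H ⟶ H₁}
    (hc : (A ⊗ B) ◁ c ≫ v = (β_ A B).hom ▷ T ≫ (α_ B A T).hom ≫ B ◁ e ≫ p)
    (hc₁ : (A ⊗ B) ◁ c₁ ≫ v₁ = (β_ A B).hom ▷ T₁ ≫ (α_ B A T₁).hom ≫ B ◁ e₁ ≫ p₁)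
    (hm : (A ⊗ B) ◁ m ≫ v₁ = v ≫ h) (hr : A ◁ r ≫ e₁ = e ≫ g) (hp : p ≫ h = B ◁ g ≫ p₁) :
    (A ⊗ B) ◁ (c ≫ m) ≫ v₁ = (A ⊗ B) ◁ (r ≫ c₁) ≫ v₁ := by
  rw [MonoidalCategory.whiskerLeft_comp, Category.assoc, hm,
    MonoidalCategory.whiskerLeft_comp, Category.assoc, hc₁, ← Category.assoc, hc]
  simp only [Category.assoc]
  rw [hp, whisker_exchange_assoc, tensor_whiskerLeft]
  simp only [Category.assoc, Iso.inv_hom_id_assoc]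
  rw [← MonoidalCategory.whiskerLeft_comp_assoc, ← MonoidalCategory.whiskerLeft_comp_assoc, hr]

theorem NatHom.contract_natural [MonoidalClosed V] [HasLimits V] {I J : Type u} [SmallCategory I]
    [SmallCategory J] (K : I ⥤ J) (F₀ G₀ G₁ : J ⥤ V) (F H H₁ : I ⥤ V)
    (E : ptensor F (K ⋙ G₀) ⟶ H) (E₁ : ptensor F (K ⋙ G₁) ⟶ H₁) (ρ : G₀ ⟶ G₁) (θ : H ⟶ H₁)
    (h : ∀ i, E.app i ≫ θ.app i = F.obj i ◁ ρ.app (K.obj i) ≫ E₁.app i) :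
    NatHom.contract K F₀ G₀ F H E ≫ NatHom.map θ =
      NatHom.map ρ ≫ NatHom.contract K F₀ G₁ F H₁ E₁ := by
  refine NatHom.hom_ext (fun i => ?_)
  exact contract_aux₂ (contract_ev K F₀ G₀ F H E i) (contract_ev K F₀ G₁ F H₁ E₁ i)
    (NatHom.map_ev (F := ptensor (K ⋙ F₀) F) θ i) (NatHom.map_ev ρ (K.obj i)) (h i)

namespace ColoredOperad

variable [MonoidalClosed V] [HasLimits V] (P : ColoredOperad X V)

/-- `P^∧(C)^y = ∫_w [P(w;y), C^{⊗w}]` -/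
noncomputable abbrev coan (C : X → V) (y : X) : V := NatHom (P.ops y) (tpow C)

/-- `P^∧(f)` -/
noncomputable def coanMap {C D : X → V} (f : ∀ x, C x ⟶ D x) (y : X) : P.coan C y ⟶ P.coan D y :=
  NatHom.map (tpowMap f)

/-- `P₂^∧(C)^y`, the end over `W = (x₁,z₁)…(xₙ,zₙ)` of
`[P(x₁…xₙ;y) ⊗ (P(z₁;x₁) ⊗ ⋯ ⊗ P(zₙ;xₙ)), C^{⊗z₁⋯zₙ}]`. -/
noncomputable abbrev coan₂ (C : X → V) (y : X) : V :=
  NatHom (ptensor (head ⋙ P.ops y) (tens P.ops)) (join ⋙ tpow C)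

/-- `P₂^∧(f)` -/
noncomputable def coan₂Map {C D : X → V} (f : ∀ x, C x ⟶ D x) (y : X) :
    P.coan₂ C y ⟶ P.coan₂ D y :=
  NatHom.map (Functor.whiskerLeft join (tpowMap f))

/-- `Δ : P^∧(C) ⟶ P₂^∧(C)`, precomposition with the composition of the operad. -/
noncomputable def diag (C : X → V) (y : X) : P.coan C y ⟶ P.coan₂ C y :=
  NatHom.restrict join ≫ NatHom.pre (P.comp y)

/-- For `W = (x₁,z₁)…(xₙ,zₙ)`, the map
`(P(z₁;x₁) ⊗ ⋯ ⊗ P(zₙ;xₙ)) ⊗ (P^∧(C)^x₁ ⊗ ⋯ ⊗ P^∧(C)^xₙ) ⟶ C^{⊗z₁} ⊗ ⋯ ⊗ C^{⊗zₙ}`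
given by the tensor product of the evaluations (after the obvious permutation of factors). It is
the transpose of the canonical map into `[⊗ᵢ P(zᵢ;xᵢ), ⊗ᵢ C^{⊗zᵢ}]`. -/
noncomputable def evWord (C : X → V) :
    ptensor (tens P.ops) (head ⋙ tpow (P.coan C)) ⟶ join ⋙ tpow C :=
  extend _ _ (fun g => NatHom.ev (P.ops g.1.as) (tpow C) g.2) (by
    rintro ⟨⟨x⟩, w⟩ ⟨⟨y⟩, z⟩ ⟨φ, ψ⟩
    obtain rfl : x = y := Discrete.eq_of_hom φ
    obtain rfl : φ = 𝟙 _ := Subsingleton.elim _ _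
    have h := NatHom.ev_natural (F := P.ops x) (G := tpow C) ψ
    rw [← tensorHom_id] at h
    have e : (Functor.uncurry.obj (Discrete.functor P.ops)).map
       (X := (Discrete.mk x, w)) (Y := (Discrete.mk x, z)) (𝟙 _, ψ) = (P.ops x).map ψ :=
      Category.id_comp _
    refine Eq.trans ?_ h
    exact congrArg (fun t : (P.ops x).obj w ⟶ (P.ops x).obj z =>
      (t ⊗ₘ 𝟙 (P.coan C x)) ≫ NatHom.ev (P.ops x) (tpow C) z) e)

/-- `α : P^∧(P^∧(C)) ⟶ P₂^∧(C)`, induced by the canonical maps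
`⊗ᵢ [P(zᵢ;xᵢ), C^{⊗zᵢ}] ⟶ [⊗ᵢ P(zᵢ;xᵢ), ⊗ᵢ C^{⊗zᵢ}]`. -/
noncomputable def alpha (C : X → V) (y : X) : P.coan (P.coan C) y ⟶ P.coan₂ C y :=
  NatHom.contract head (P.ops y) (tpow (P.coan C)) (tens P.ops) (join ⋙ tpow C) (P.evWord C)

/-- The counit `P^∧(C) ⟶ C`, evaluation at the unit of the operad. -/
noncomputable def counit (C : X → V) (y : X) : P.coan C y ⟶ C y :=
  (λ_ (P.coan C y)).inv ≫ P.one y ▷ P.coan C y ≫ NatHom.ev (P.ops y) (tpow C) (letter y)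

theorem diag_natural {C D : X → V} (f : ∀ x, C x ⟶ D x) (y : X) :
    P.diag C y ≫ P.coan₂Map f y = P.coanMap f y ≫ P.diag D y := by
  rw [diag, coan₂Map, coanMap, Category.assoc]
  rw [NatHom.pre_map, ← Category.assoc, NatHom.restrict_map, Category.assoc, diag]

theorem evWord_natural {C D : X → V} (f : ∀ x, C x ⟶ D x) (W : Words₂ X) :
    (P.evWord C).app W ≫ (tpowMap f).app (join.obj W) =
      (tens P.ops).obj W ◁ (tpowMap (P.coanMap f)).app (head.obj W) ≫ (P.evWord D).app W := by
  refine extendApp_square (A := ptensor (tens P.ops) (head ⋙ tpow (P.coan C)))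
    (A' := ptensor (tens P.ops) (head ⋙ tpow (P.coan D))) (B := join ⋙ tpow C)
    (B' := join ⋙ tpow D) _ _
    (fun W => (tens P.ops).obj W ◁ (tpowMap (P.coanMap f)).app (head.obj W))
    (fun W => (tpowMap f).app (join.obj W)) ?_ ?_ ?_ ?_ ?_ W
  · change ((λ_ (𝟙_ V)).inv ≫ (𝟙 (𝟙_ V) ⊗ₘ (𝟙 (𝟙_ V) ≫ 𝟙 (𝟙_ V)))) ≫
      𝟙_ V ◁ (tpowMap (P.coanMap f)).app (𝟙_ _) =
        (λ_ (𝟙_ V)).inv ≫ (𝟙 (𝟙_ V) ⊗ₘ (𝟙 (𝟙_ V) ≫ 𝟙 (𝟙_ V)))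
    have h : 𝟙_ V ◁ (tpowMap (P.coanMap f)).app (𝟙_ _) = 𝟙 (𝟙_ V ⊗ 𝟙_ V) :=
      (congrArg (fun t : 𝟙_ V ⟶ 𝟙_ V => 𝟙_ V ◁ t) (tpowMap_unit (P.coanMap f))).trans
        (MonoidalCategory.whiskerLeft_id _ _)
    exact (congrArg _ h).trans (Category.comp_id _)
  · intro a b
    exact evWord_aux ((tens P.ops).obj a) ((tens P.ops).obj b)
      ((tpowMap (P.coanMap f)).app (head.obj a)) ((tpowMap (P.coanMap f)).app (head.obj b)) _
      (tpowMap_tensor (P.coanMap f) (head.obj a) (head.obj b))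
  · exact (Category.assoc _ _ _).trans (Eq.trans (congrArg (fun t : 𝟙_ V ⟶ 𝟙_ V =>
      𝟙 (𝟙_ V) ≫ 𝟙 (𝟙_ V) ≫ t) (tpowMap_unit f)) (congrArg (fun t => 𝟙 (𝟙_ V) ≫ t)
        (Category.comp_id _)))
  · intro a b
    refine (Category.assoc _ _ _).trans ((Category.id_comp _).trans ((Category.id_comp _).trans
      ((tpowMap_tensor f (join.obj a) (join.obj b)).trans ?_)))
    exact ((congrArg (fun t => _ ≫ t) (Category.comp_id _)).trans (Category.comp_id _)).symm
  · intro g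
    exact (NatHom.map_ev (F := P.ops g.1.as) (tpowMap f) g.2).symm

theorem alpha_natural {C D : X → V} (f : ∀ x, C x ⟶ D x) (y : X) :
    P.alpha C y ≫ P.coan₂Map f y = P.coanMap (P.coanMap f) y ≫ P.alpha D y := by
  exact NatHom.contract_natural _ _ _ _ _ _ _ _ _ _ _ (fun W => P.evWord_natural f W)

theorem coanMap_comp {C D E : X → V} (f : ∀ x, C x ⟶ D x) (g : ∀ x, D x ⟶ E x) (y : X) :
    P.coanMap (fun x => f x ≫ g x) y = P.coanMap f y ≫ P.coanMap g y := by
  refine Eq.trans ?_ (NatHom.map_comp (tpowMap f) (tpowMap g)).symm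
  exact congrArg (fun τ => NatHom.map τ) (NatTrans.ext (funext (tpowMap_comp f g)))

/-- `Q₁(C)`, the fibre product of `Δ` and `α`: the representative elements of `P^∧(C)`, whose
diagonal comes from `P^∧(P^∧(C))`. -/
noncomputable def Q₁ (C : X → V) (y : X) : V := pullback (P.diag C y) (P.alpha C y)

/-- `χ₁ : Q₁(C) ⟶ P^∧(C)` -/
noncomputable def chi (C : X → V) (y : X) : P.Q₁ C y ⟶ P.coan C y :=
  pullback.fst (P.diag C y) (P.alpha C y)

/-- `δ₁ : Q₁(C) ⟶ P^∧(P^∧(C))`, the diagonal. -/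
noncomputable def delta₁ (C : X → V) (y : X) : P.Q₁ C y ⟶ P.coan (P.coan C) y :=
  pullback.snd (P.diag C y) (P.alpha C y)

/-- `Q₁(f)` -/
noncomputable def Q₁Map {C D : X → V} (f : ∀ x, C x ⟶ D x) (y : X) : P.Q₁ C y ⟶ P.Q₁ D y :=
  pullback.map _ _ _ _ (P.coanMap f y) (P.coanMap (P.coanMap f) y) (P.coan₂Map f y)
    (P.diag_natural f y) (P.alpha_natural f y)

/-- `d : C ⟶ P^∧(C)`, that is, a natural family of maps `P(w;y) ⊗ C^y ⟶ C^{⊗w}`, is a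
`P`-coalgebra structure on `C`: it is counital and coassociative. -/
structure IsCoalgebra (C : X → V) (d : ∀ y, C y ⟶ P.coan C y) : Prop where
  counit : ∀ y, d y ≫ P.counit C y = 𝟙 (C y)
  coassoc : ∀ y, d y ≫ P.coanMap d y ≫ P.alpha C y = d y ≫ P.diag C y

end ColoredOperad

end Operads

/-- A differential graded vector space over `k`: a vector space with a decomposition
`⨁ n : ℤ, deg n` and a differential of degree `-1`. -/
structure DGVect (k : Type u) [Field k] where
  carrier : Type u
  [addCommGroup : AddCommGroup carrier]
  [module : Module k carrier]
  deg : ℤ → Submodule k carrier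
  isInternal : DirectSum.IsInternal deg
  d : carrier →ₗ[k] carrier
  d_mem : ∀ (n : ℤ) (x : carrier), x ∈ deg n → d x ∈ deg (n - 1)
  d_d : ∀ x : carrier, d (d x) = 0

namespace DGVect

open TensorProduct

attribute [instance] DGVect.addCommGroup DGVect.module

variable {k : Type u} [Field k]

/-- Morphisms: linear maps of degree zero commuting with the differentials. -/
@[ext]
structure Hom (M N : DGVect.{u} k) : Type u where
  lin : M.carrier →ₗ[k] N.carrier
  map_mem : ∀ (n : ℤ) (x : M.carrier), x ∈ M.deg n → lin x ∈ N.deg n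
  map_d : ∀ x : M.carrier, lin (M.d x) = N.d (lin x)

instance category : Category.{u} (DGVect.{u} k) where
  Hom := Hom
  id M := ⟨LinearMap.id, fun _ _ h => h, fun _ => rfl⟩
  comp f g := ⟨g.lin ∘ₗ f.lin, fun n x h => g.map_mem n _ (f.map_mem n x h), fun x =>
    (congrArg g.lin (f.map_d x)).trans (g.map_d _)⟩

theorem hom_ext {M N : DGVect.{u} k} {f g : M ⟶ N} (h : f.lin = g.lin) : f = g := Hom.ext h

theorem comp_lin {M N K : DGVect.{u} k} (f : M ⟶ N) (g : N ⟶ K) :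
    (f ≫ g).lin = g.lin ∘ₗ f.lin := rfl

theorem id_lin (M : DGVect.{u} k) : Hom.lin (𝟙 M) = LinearMap.id := rfl

section Grading

variable {L : Type u} [AddCommGroup L] [Module k L]

/-- A family of submodules with sum everything is a grading if it is separated by linear maps. -/
theorem isInternal_of (A : ℤ → Submodule k L) (htop : ⨆ n, A n = ⊤)
    (h : ∀ (n : ℤ) (x : L), x ∈ A n → x ∈ (⨆ m, ⨆ (_ : m ≠ n), A m) → x = 0) :
    DirectSum.IsInternal A := by
  rw [DirectSum.isInternal_submodule_iff_iSupIndep_and_iSup_eq_top]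
  refine ⟨fun n => Submodule.disjoint_def.mpr (h n), htop⟩

/-- A linear map vanishing on the other summands vanishes on their sum. -/
theorem eq_zero_of_mem_iSup {L' : Type u} [AddCommGroup L'] [Module k L']
    (A : ℤ → Submodule k L) (n : ℤ) (π : L →ₗ[k] L')
    (h₀ : ∀ m, m ≠ n → ∀ x ∈ A m, π x = 0) {x : L}
    (hx : x ∈ (⨆ m, ⨆ (_ : m ≠ n), A m)) : π x = 0 := by
  have : (⨆ m, ⨆ (_ : m ≠ n), A m) ≤ LinearMap.ker π :=
    iSup_le fun m => iSup_le fun hm => fun x hx => h₀ m hm x hx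
  exact this hx

/-- The dg vector space of finite sums of elements of given independent subspaces. -/
def ofFamily (A : ℤ → Submodule k L)
    (h : ∀ (n : ℤ) (x : L), x ∈ A n → x ∈ (⨆ m, ⨆ (_ : m ≠ n), A m) → x = 0)
    (d : L →ₗ[k] L) (hd : ∀ (n : ℤ) (x : L), x ∈ A n → d x ∈ A (n - 1))
    (hdd : ∀ (n : ℤ) (x : L), x ∈ A n → d (d x) = 0) : DGVect.{u} k where
  carrier := (⨆ n, A n : Submodule k L)
  deg n := (A n).comap (⨆ n, A n).subtype
  isInternal := by
    have hle : ∀ n, A n ≤ ⨆ n, A n := fun n => le_iSup A n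
    have hmap : ∀ n, ((A n).comap (⨆ n, A n).subtype).map (⨆ n, A n).subtype = A n := fun n => by
      rw [Submodule.map_comap_subtype, inf_eq_right]
      exact hle n
    refine isInternal_of _ ?_ ?_
    · apply Submodule.map_injective_of_injective (⨆ n, A n).injective_subtype
      simp only [Submodule.map_iSup, hmap, Submodule.map_top, Submodule.range_subtype]
    · intro n x hx hx'
      have := Submodule.mem_map_of_mem (f := (⨆ n, A n).subtype) hx'
      simp only [Submodule.map_iSup, hmap] at this
      exact Subtype.ext (h n x hx this)
  d := d.restrict (p := ⨆ n, A n) (q := ⨆ n, A n) (fun x hx => by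
    have : (⨆ n, A n) ≤ (⨆ n, A n).comap d :=
      iSup_le fun n y hy => Submodule.mem_iSup_of_mem (n - 1) (hd n y hy)
    exact this hx)
  d_mem n x hx := hd n x hx
  d_d x := by
    have : (⨆ n, A n) ≤ LinearMap.ker (d ∘ₗ d) :=
      iSup_le fun n y hy => hdd n y hy
    exact Subtype.ext (this x.2)

end Grading

section Components

variable (M : DGVect.{u} k)

theorem iSup_deg : ⨆ n, M.deg n = ⊤ := M.isInternal.submodule_iSup_eq_top

variable {M} in
theorem lin_ext {L : Type u} [AddCommGroup L] [Module k L] {f g : M.carrier →ₗ[k] L}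
    (h : ∀ (n : ℤ) (x : M.carrier), x ∈ M.deg n → f x = g x) : f = g := by
  have : (⊤ : Submodule k M.carrier) ≤ LinearMap.eqLocus f g := by
    rw [← M.iSup_deg]
    exact iSup_le fun n x hx => h n x hx
  exact LinearMap.ext fun x => this (Submodule.mem_top : x ∈ ⊤)

/-- The decomposition of an element into its homogeneous components. -/
noncomputable def comps : M.carrier →ₗ[k] (ℤ →₀ M.carrier) :=
  (DirectSum.toModule k ℤ (ℤ →₀ M.carrier)
      (fun n => Finsupp.lsingle n ∘ₗ (M.deg n).subtype)) ∘ₗ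
    (LinearEquiv.ofBijective (DirectSum.coeLinearMap M.deg) M.isInternal).symm.toLinearMap

theorem comps_of_mem {n : ℤ} {x : M.carrier} (hx : x ∈ M.deg n) :
    M.comps x = Finsupp.single n x := by
  have h : (LinearEquiv.ofBijective (DirectSum.coeLinearMap M.deg) M.isInternal).symm x =
      DirectSum.lof k ℤ (fun n => M.deg n) n ⟨x, hx⟩ := by
    rw [LinearEquiv.symm_apply_eq]
    exact (DirectSum.coeLinearMap_lof M.deg n ⟨x, hx⟩).symm
  change DirectSum.toModule k ℤ (ℤ →₀ M.carrier) _
    ((LinearEquiv.ofBijective (DirectSum.coeLinearMap M.deg) M.isInternal).symm x) = _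
  rw [h, DirectSum.toModule_lof]
  rfl

/-- The linear map given by `A n` in degree `n`. -/
noncomputable def glue {L : Type u} [AddCommGroup L] [Module k L]
    (A : ℤ → (M.carrier →ₗ[k] L)) : M.carrier →ₗ[k] L :=
  Finsupp.lsum k A ∘ₗ M.comps

theorem glue_of_mem {L : Type u} [AddCommGroup L] [Module k L] (A : ℤ → (M.carrier →ₗ[k] L))
    {n : ℤ} {x : M.carrier} (hx : x ∈ M.deg n) : M.glue A x = A n x := by
  rw [glue, LinearMap.comp_apply, M.comps_of_mem hx]
  simp

/-- The component of degree `n`. -/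
noncomputable def pr (n : ℤ) : M.carrier →ₗ[k] M.carrier :=
  M.glue (fun m => if m = n then LinearMap.id else 0)

theorem pr_of_mem {n : ℤ} {x : M.carrier} (hx : x ∈ M.deg n) : M.pr n x = x := by
  rw [pr, glue_of_mem _ _ hx]
  simp

theorem pr_of_ne {m n : ℤ} (hmn : m ≠ n) {x : M.carrier} (hx : x ∈ M.deg m) : M.pr n x = 0 := by
  rw [pr, glue_of_mem _ _ hx, if_neg hmn]
  rfl

theorem pr_mem (n : ℤ) (x : M.carrier) : M.pr n x ∈ M.deg n := by
  have : (⊤ : Submodule k M.carrier) ≤ (M.deg n).comap (M.pr n) := by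
    rw [← M.iSup_deg]
    refine iSup_le fun m y hy => ?_
    rw [Submodule.mem_comap]
    by_cases h : m = n
    · subst h
      rwa [M.pr_of_mem hy]
    · rw [M.pr_of_ne h hy]
      exact Submodule.zero_mem _
  exact this (Submodule.mem_top : x ∈ ⊤)

/-- The sign `(-1)^n`. -/
def sgn (n : ℤ) : k := ((n.negOnePow : ℤ) : k)

theorem sgn_add (m n : ℤ) : (sgn (m + n) : k) = sgn m * sgn n := by
  simp [sgn, Int.negOnePow_add]

theorem sgn_mul_self (n : ℤ) : (sgn n : k) * sgn n = 1 := by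
  rcases Int.even_or_odd n with h | h
  · simp [sgn, Int.negOnePow_even n h]
  · simp [sgn, Int.negOnePow_odd n h]

theorem sgn_zero : (sgn 0 : k) = 1 := by simp [sgn]

theorem sgn_sub_one (n : ℤ) : (sgn (n - 1) : k) = - sgn n := by
  simp [sgn, Int.negOnePow_sub]

/-- Multiplication by `(-1)^(pq)` in degree `q`. -/
noncomputable def tw (p : ℤ) : M.carrier →ₗ[k] M.carrier :=
  M.glue (fun q => (sgn (p * q) : k) • LinearMap.id)

theorem tw_of_mem (p : ℤ) {q : ℤ} {x : M.carrier} (hx : x ∈ M.deg q) :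
    M.tw p x = (sgn (p * q) : k) • x := by
  rw [tw, glue_of_mem _ _ hx]
  rfl

/-- Multiplication by `(-1)^q` in degree `q`. -/
noncomputable abbrev par : M.carrier →ₗ[k] M.carrier := M.tw 1

theorem par_of_mem {q : ℤ} {x : M.carrier} (hx : x ∈ M.deg q) :
    M.par x = (sgn q : k) • x := by
  rw [par, tw_of_mem _ _ hx, one_mul]

end Components

section Tensor

variable (M N : DGVect.{u} k)

/-- The elements of degree `n` of the tensor product. -/
def tensorDeg (n : ℤ) : Submodule k (M.carrier ⊗[k] N.carrier) :=
  Submodule.span k {t | ∃ p q : ℤ, p + q = n ∧ ∃ x ∈ M.deg p, ∃ y ∈ N.deg q, x ⊗ₜ[k] y = t}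

theorem tmul_mem {p q : ℤ} {x : M.carrier} {y : N.carrier} (hx : x ∈ M.deg p)
    (hy : y ∈ N.deg q) : x ⊗ₜ[k] y ∈ tensorDeg M N (p + q) :=
  Submodule.subset_span ⟨p, q, rfl, x, hx, y, hy, rfl⟩

variable {M N} in
theorem tensorDeg_le {n : ℤ} {S : Submodule k (M.carrier ⊗[k] N.carrier)}
    (h : ∀ p q : ℤ, p + q = n → ∀ x ∈ M.deg p, ∀ y ∈ N.deg q, x ⊗ₜ[k] y ∈ S) :
    tensorDeg M N n ≤ S := by
  refine Submodule.span_le.mpr ?_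
  rintro _ ⟨p, q, hpq, x, hx, y, hy, rfl⟩
  exact h p q hpq x hx y hy

variable {M N} in
theorem tensor_ext {L : Type u} [AddCommGroup L] [Module k L]
    {f g : M.carrier ⊗[k] N.carrier →ₗ[k] L}
    (h : ∀ (p q : ℤ) (x : M.carrier) (y : N.carrier), x ∈ M.deg p → y ∈ N.deg q →
      f (x ⊗ₜ[k] y) = g (x ⊗ₜ[k] y)) : f = g := by
  refine TensorProduct.ext (lin_ext fun p x hx => lin_ext fun q y hy => ?_)
  exact h p q x y hx hy

/-- `d (x ⊗ y) = d x ⊗ y + (-1)^|x| x ⊗ d y` -/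
noncomputable def tensorD : M.carrier ⊗[k] N.carrier →ₗ[k] M.carrier ⊗[k] N.carrier :=
  TensorProduct.map M.d LinearMap.id + TensorProduct.map M.par N.d

theorem tensorD_apply {p : ℤ} {x : M.carrier} (hx : x ∈ M.deg p) (y : N.carrier) :
    tensorD M N (x ⊗ₜ[k] y) = M.d x ⊗ₜ[k] y + (sgn p : k) • x ⊗ₜ[k] N.d y := by
  change M.d x ⊗ₜ[k] y + M.par x ⊗ₜ[k] N.d y = _
  rw [M.par_of_mem hx, TensorProduct.smul_tmul']

/-- The tensor product of dg vector spaces, with `d (x ⊗ y) = d x ⊗ y + (-1)^|x| x ⊗ d y`. -/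
noncomputable def tensor : DGVect.{u} k where
  carrier := M.carrier ⊗[k] N.carrier
  deg := tensorDeg M N
  isInternal := by
    refine isInternal_of _ ?_ ?_
    · rw [eq_top_iff]
      have h : ∀ x y, x ⊗ₜ[k] y ∈ ⨆ n, tensorDeg M N n := by
        intro x y
        have h₁ : (⊤ : Submodule k M.carrier) ≤
            (⨆ n, tensorDeg M N n).comap ((TensorProduct.mk k M.carrier N.carrier).flip y) := by
          rw [← M.iSup_deg]
          refine iSup_le fun p x hx => ?_
          have h₂ : (⊤ : Submodule k N.carrier) ≤
              (⨆ n, tensorDeg M N n).comap (TensorProduct.mk k M.carrier N.carrier x) := by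
            rw [← N.iSup_deg]
            exact iSup_le fun q y hy => Submodule.mem_iSup_of_mem (p + q) (tmul_mem M N hx hy)
          exact h₂ (Submodule.mem_top : y ∈ ⊤)
        exact h₁ (Submodule.mem_top : x ∈ ⊤)
      rw [← TensorProduct.span_tmul_eq_top]
      refine Submodule.span_le.mpr ?_
      rintro _ ⟨x, y, rfl⟩
      exact h x y
    · intro n t ht ht'
      let D : M.carrier ⊗[k] N.carrier →ₗ[k] (ℤ →₀ M.carrier ⊗[k] N.carrier) :=
        Finsupp.lmapDomain _ k (fun p : ℤ × ℤ => p.1 + p.2) ∘ₗ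
          (finsuppTensorFinsupp k k M.carrier N.carrier ℤ ℤ).toLinearMap ∘ₗ
            TensorProduct.map M.comps N.comps
      have hD : ∀ m, ∀ t ∈ tensorDeg M N m, D t = Finsupp.single m t := by
        intro m
        have : tensorDeg M N m ≤ LinearMap.eqLocus D (Finsupp.lsingle m) := by
          refine tensorDeg_le fun p q hpq x hx y hy => ?_
          change Finsupp.mapDomain _ (finsuppTensorFinsupp k k M.carrier N.carrier ℤ ℤ
            (M.comps x ⊗ₜ[k] N.comps y)) = Finsupp.single m (x ⊗ₜ[k] y)
          rw [M.comps_of_mem hx, N.comps_of_mem hy, finsuppTensorFinsupp_single,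
            Finsupp.mapDomain_single, hpq]
        exact fun t ht => this ht
      have h₀ := eq_zero_of_mem_iSup (tensorDeg M N) n (Finsupp.lapply n ∘ₗ D) (by
        intro m hm t ht
        rw [LinearMap.comp_apply, hD m t ht]
        simp [hm]) ht'
      rw [LinearMap.comp_apply, hD n t ht] at h₀
      simpa using h₀
  d := tensorD M N
  d_mem n := by
    refine tensorDeg_le (S := (tensorDeg M N (n - 1)).comap _) fun p q hpq x hx y hy => ?_
    subst hpq
    rw [Submodule.mem_comap, tensorD_apply M N hx]
    refine Submodule.add_mem _ ?_ ?_
    · have := tmul_mem M N (M.d_mem p x hx) hy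
      rwa [show p - 1 + q = p + q - 1 by ring] at this
    · have := tmul_mem M N hx (N.d_mem q y hy)
      rw [show p + (q - 1) = p + q - 1 by ring] at this
      exact Submodule.smul_mem _ _ this
  d_d t := by
    change (tensorD M N ∘ₗ tensorD M N) t =
      (0 : M.carrier ⊗[k] N.carrier →ₗ[k] M.carrier ⊗[k] N.carrier) t
    refine LinearMap.congr_fun (tensor_ext fun p q x y hx hy => ?_) t
    rw [LinearMap.comp_apply, tensorD_apply M N hx, map_add, map_smul, tensorD_apply M N hx,
      tensorD_apply M N (M.d_mem p x hx), M.d_d, N.d_d, sgn_sub_one]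
    simp

variable {M N} in
/-- The tensor product of morphisms. -/
noncomputable def tensorMap {M' N' : DGVect.{u} k} (f : M ⟶ M') (g : N ⟶ N') :
    tensor M N ⟶ tensor M' N' where
  lin := TensorProduct.map f.lin g.lin
  map_mem n := by
    refine tensorDeg_le (S := (tensorDeg M' N' n).comap _) fun p q hpq x hx y hy => ?_
    subst hpq
    exact tmul_mem M' N' (f.map_mem p x hx) (g.map_mem q y hy)
  map_d t := by
    refine LinearMap.congr_fun (f := TensorProduct.map f.lin g.lin ∘ₗ tensorD M N)
      (g := tensorD M' N' ∘ₗ TensorProduct.map f.lin g.lin)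
      (tensor_ext fun p q x y hx hy => ?_) t
    rw [LinearMap.comp_apply, LinearMap.comp_apply, tensorD_apply M N hx,
      TensorProduct.map_tmul, tensorD_apply M' N' (f.map_mem p x hx), map_add, map_smul,
      TensorProduct.map_tmul, TensorProduct.map_tmul, f.map_d, g.map_d]

/-- The unit: `k` in degree zero. -/
def one (k : Type u) [Field k] : DGVect.{u} k where
  carrier := k
  deg n := if n = 0 then ⊤ else ⊥
  isInternal := by
    refine isInternal_of _ ?_ ?_
    · rw [eq_top_iff]
      exact le_iSup_of_le 0 (by simp)
    · intro n x hx hx'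
      by_cases hn : n = 0
      · refine eq_zero_of_mem_iSup _ n LinearMap.id (fun m hm y hy => ?_) hx'
        rw [if_neg (fun h => hm (h.trans hn.symm))] at hy
        exact hy
      · rw [if_neg hn] at hx
        exact hx
  d := 0
  d_mem _ _ _ := Submodule.zero_mem _
  d_d _ := rfl

/-- An isomorphism of dg vector spaces from a linear equivalence. -/
def isoMk {M N : DGVect.{u} k} (e : M.carrier ≃ₗ[k] N.carrier)
    (h : ∀ (n : ℤ) (x : M.carrier), x ∈ M.deg n → e x ∈ N.deg n)
    (hd : ∀ x : M.carrier, e (M.d x) = N.d (e x)) : M ≅ N where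
  hom := ⟨e.toLinearMap, h, hd⟩
  inv := ⟨e.symm.toLinearMap, fun n y hy => by
    have hpr : ∀ x, e (M.pr n x) = N.pr n (e x) := by
      intro x
      refine LinearMap.congr_fun (f := e.toLinearMap ∘ₗ M.pr n) (g := N.pr n ∘ₗ e.toLinearMap)
        (lin_ext fun m x hx => ?_) x
      change e (M.pr n x) = N.pr n (e x)
      by_cases hm : m = n
      · subst hm
        rw [M.pr_of_mem hx, N.pr_of_mem (h _ _ hx)]
      · rw [M.pr_of_ne hm hx, N.pr_of_ne hm (h _ _ hx), map_zero]
    have h₁ := hpr (e.symm y)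
    rw [e.apply_symm_apply, N.pr_of_mem hy] at h₁
    have h₂ : M.pr n (e.symm y) = e.symm y := by
      rw [LinearEquiv.eq_symm_apply, h₁]
    have h₃ := M.pr_mem n (e.symm y)
    rw [h₂] at h₃
    exact h₃, fun y => by
    change e.symm (N.d y) = M.d (e.symm y)
    rw [LinearEquiv.symm_apply_eq, hd, e.apply_symm_apply]⟩
  hom_inv_id := hom_ext (LinearMap.ext e.symm_apply_apply)
  inv_hom_id := hom_ext (LinearMap.ext e.apply_symm_apply)

theorem one_mem {a : k} : a ∈ (one k).deg 0 := by
  change a ∈ (if (0 : ℤ) = 0 then (⊤ : Submodule k k) else ⊥)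
  simp

theorem one_eq_zero {n : ℤ} (hn : n ≠ 0) {a : k} (h : a ∈ (one k).deg n) : a = 0 := by
  change a ∈ (if n = 0 then (⊤ : Submodule k k) else ⊥) at h
  rw [if_neg hn] at h
  exact h

theorem tensor_ext₃ {M N K : DGVect.{u} k} {L : Type u} [AddCommGroup L] [Module k L]
    {f g : (M.carrier ⊗[k] N.carrier) ⊗[k] K.carrier →ₗ[k] L}
    (h : ∀ (p q r : ℤ) (x : M.carrier) (y : N.carrier) (z : K.carrier), x ∈ M.deg p →
      y ∈ N.deg q → z ∈ K.deg r → f ((x ⊗ₜ[k] y) ⊗ₜ[k] z) = g ((x ⊗ₜ[k] y) ⊗ₜ[k] z)) : f = g := by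
  refine TensorProduct.ext (tensor_ext fun p q x y hx hy => lin_ext fun r z hz => ?_)
  exact h p q r x y z hx hy hz

/-- The associativity isomorphism. -/
noncomputable def assocIso (M N K : DGVect.{u} k) :
    tensor (tensor M N) K ≅ tensor M (tensor N K) :=
  isoMk (M := tensor (tensor M N) K) (N := tensor M (tensor N K))
    (TensorProduct.assoc k M.carrier N.carrier K.carrier)
    (fun n => by
      refine tensorDeg_le (M := tensor M N) (N := K)
        (S := (tensorDeg M (tensor N K) n).comap
          (TensorProduct.assoc k M.carrier N.carrier K.carrier).toLinearMap)
        fun s r hs t ht z hz => ?_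
      have : tensorDeg M N s ≤ (tensorDeg M (tensor N K) n).comap
          ((TensorProduct.assoc k M.carrier N.carrier K.carrier).toLinearMap ∘ₗ
            (TensorProduct.mk k (M.carrier ⊗[k] N.carrier) K.carrier).flip z) := by
        refine tensorDeg_le fun p q hpq x hx y hy => ?_
        have := tmul_mem M (tensor N K) hx (tmul_mem N K hy hz)
        rw [← hs, ← hpq, add_assoc]
        exact this
      exact this ht)
    (fun t => by
      refine LinearMap.congr_fun
        (f := (TensorProduct.assoc k M.carrier N.carrier K.carrier).toLinearMap ∘ₗ
          tensorD (tensor M N) K)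
        (g := tensorD M (tensor N K) ∘ₗ
          (TensorProduct.assoc k M.carrier N.carrier K.carrier).toLinearMap)
        (tensor_ext₃ fun p q r x y z hx hy hz => ?_) t
      have h₁ : (tensorD (tensor M N) K ((x ⊗ₜ[k] y) ⊗ₜ[k] z) :
          (M.carrier ⊗[k] N.carrier) ⊗[k] K.carrier) =
          tensorD M N (x ⊗ₜ[k] y) ⊗ₜ[k] z + (sgn (p + q) : k) • ((x ⊗ₜ[k] y) ⊗ₜ[k] K.d z) :=
        tensorD_apply (tensor M N) K (tmul_mem M N hx hy) z
      have h₂ : (tensorD M (tensor N K) (x ⊗ₜ[k] (y ⊗ₜ[k] z)) :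
          M.carrier ⊗[k] (N.carrier ⊗[k] K.carrier)) =
          M.d x ⊗ₜ[k] (y ⊗ₜ[k] z) + (sgn p : k) • (x ⊗ₜ[k] tensorD N K (y ⊗ₜ[k] z)) :=
        tensorD_apply M (tensor N K) hx (y ⊗ₜ[k] z)
      refine Eq.trans (congrArg (TensorProduct.assoc k M.carrier N.carrier K.carrier) h₁)
        (Eq.trans ?_ h₂.symm)
      rw [tensorD_apply M N hx, tensorD_apply N K hy, TensorProduct.add_tmul, sgn_add,
        map_add, map_add, map_smul, TensorProduct.tmul_add, smul_add, TensorProduct.tmul_smul,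
        ← TensorProduct.smul_tmul', map_smul, mul_smul, ← add_assoc]
      rfl)

/-- The left unit isomorphism. -/
noncomputable def lidIso (M : DGVect.{u} k) : tensor (one k) M ≅ M :=
  isoMk (M := tensor (one k) M) (N := M) (TensorProduct.lid k M.carrier)
    (fun n => by
      refine tensorDeg_le (M := one k) (N := M)
        (S := (M.deg n).comap (TensorProduct.lid k M.carrier).toLinearMap)
        fun p q hpq (a : k) ha y hy => ?_
      change a • y ∈ M.deg n
      by_cases hp : p = 0
      · rw [← hpq, hp, zero_add]
        exact Submodule.smul_mem _ _ hy
      · rw [one_eq_zero (k := k) hp ha, zero_smul]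
        exact Submodule.zero_mem _)
    (fun t => by
      refine LinearMap.congr_fun
        (f := (TensorProduct.lid k M.carrier).toLinearMap ∘ₗ tensorD (one k) M)
        (g := M.d ∘ₗ (TensorProduct.lid k M.carrier).toLinearMap)
        (TensorProduct.ext' fun (a : k) y => ?_) t
      have h : (tensorD (one k) M (a ⊗ₜ[k] y) : k ⊗[k] M.carrier) =
          (0 : k) ⊗ₜ[k] y + (sgn 0 : k) • (a ⊗ₜ[k] M.d y) :=
        tensorD_apply (one k) M (p := 0) (x := a) (one_mem (k := k) (a := a)) y
      refine (congrArg (TensorProduct.lid k M.carrier) h).trans ?_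
      change _ = M.d (a • y)
      rw [sgn_zero]
      simp)

/-- The right unit isomorphism. -/
noncomputable def ridIso (M : DGVect.{u} k) : tensor M (one k) ≅ M :=
  isoMk (M := tensor M (one k)) (N := M) (TensorProduct.rid k M.carrier)
    (fun n => by
      refine tensorDeg_le (M := M) (N := one k)
        (S := (M.deg n).comap (TensorProduct.rid k M.carrier).toLinearMap)
        fun p q hpq x hx (a : k) ha => ?_
      change a • x ∈ M.deg n
      by_cases hq : q = 0
      · rw [← hpq, hq, add_zero]
        exact Submodule.smul_mem _ _ hx
      · rw [one_eq_zero (k := k) hq ha, zero_smul]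
        exact Submodule.zero_mem _)
    (fun t => by
      refine LinearMap.congr_fun
        (f := (TensorProduct.rid k M.carrier).toLinearMap ∘ₗ tensorD M (one k))
        (g := M.d ∘ₗ (TensorProduct.rid k M.carrier).toLinearMap)
        (tensor_ext fun p q x (a : k) hx ha => ?_) t
      have h : (tensorD M (one k) (x ⊗ₜ[k] a) : M.carrier ⊗[k] k) =
          M.d x ⊗ₜ[k] a + (sgn p : k) • (x ⊗ₜ[k] (0 : k)) :=
        tensorD_apply M (one k) hx a
      refine (congrArg (TensorProduct.rid k M.carrier) h).trans ?_
      change _ = M.d (a • x)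
      simp)

noncomputable instance monoidalCategory : MonoidalCategory (DGVect.{u} k) where
  tensorObj := tensor
  tensorUnit := one k
  tensorHom := tensorMap
  whiskerLeft M _ _ f := tensorMap (𝟙 M) f
  whiskerRight f M := tensorMap f (𝟙 M)
  associator := assocIso
  leftUnitor := lidIso
  rightUnitor := ridIso
  tensorHom_def _ _ := hom_ext (TensorProduct.ext' fun _ _ => rfl)
  id_tensorHom_id _ _ := hom_ext (TensorProduct.ext' fun _ _ => rfl)
  tensorHom_comp_tensorHom _ _ _ _ := hom_ext (TensorProduct.ext' fun _ _ => rfl)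
  whiskerLeft_id _ _ := hom_ext (TensorProduct.ext' fun _ _ => rfl)
  id_whiskerRight _ _ := hom_ext (TensorProduct.ext' fun _ _ => rfl)
  associator_naturality _ _ _ := hom_ext (TensorProduct.ext_threefold fun _ _ _ => rfl)
  leftUnitor_naturality f := hom_ext (TensorProduct.ext' fun (a : k) x =>
    (map_smul f.lin a x).symm)
  rightUnitor_naturality f := hom_ext (TensorProduct.ext' fun x (a : k) =>
    (map_smul f.lin a x).symm)
  pentagon _ _ _ _ := hom_ext (TensorProduct.ext_fourfold fun _ _ _ _ => rfl)
  triangle _ _ := hom_ext (TensorProduct.ext_threefold fun x (a : k) y =>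
    (TensorProduct.smul_tmul a x y).symm)

end Tensor

section Braiding

variable (M N : DGVect.{u} k)

/-- `x ⊗ y ↦ (-1)^(|x||y|) y ⊗ x` -/
noncomputable def braid : M.carrier ⊗[k] N.carrier →ₗ[k] N.carrier ⊗[k] M.carrier :=
  TensorProduct.lift (M.glue fun p =>
    (LinearMap.lcomp k (N.carrier ⊗[k] M.carrier) (N.tw p)) ∘ₗ
      (TensorProduct.mk k N.carrier M.carrier).flip)

theorem braid_apply {p q : ℤ} {x : M.carrier} {y : N.carrier} (hx : x ∈ M.deg p)
    (hy : y ∈ N.deg q) : braid M N (x ⊗ₜ[k] y) = (sgn (p * q) : k) • (y ⊗ₜ[k] x) := by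
  rw [braid, TensorProduct.lift.tmul, glue_of_mem _ _ hx]
  change N.tw p y ⊗ₜ[k] x = _
  rw [tw_of_mem _ _ hy, TensorProduct.smul_tmul']

theorem braid_braid : braid N M ∘ₗ braid M N = LinearMap.id := by
  refine tensor_ext fun p q x y hx hy => ?_
  rw [LinearMap.comp_apply, braid_apply M N hx hy, map_smul, braid_apply N M hy hx, mul_comm q p,
    smul_smul, sgn_mul_self, one_smul]
  rfl

theorem sgn_mul_sub_one (p q : ℤ) : (sgn ((p - 1) * q) : k) = sgn (p * q) * sgn q := by
  rw [← sgn_add]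
  simp only [sgn]
  rw [show (p - 1) * q = p * q + q - 2 * q by ring, Int.negOnePow_sub, Int.negOnePow_two_mul,
    mul_one]

/-- The symmetry. -/
noncomputable def braidIso : tensor M N ≅ tensor N M :=
  isoMk (M := tensor M N) (N := tensor N M)
    (LinearEquiv.ofLinearMap (braid M N) (braid N M) (braid_braid N M) (braid_braid M N))
    (fun n => by
      refine tensorDeg_le (S := (tensorDeg N M n).comap (braid M N)) fun p q hpq x hx y hy => ?_
      rw [Submodule.mem_comap, braid_apply M N hx hy, ← hpq, add_comm]
      exact Submodule.smul_mem _ _ (tmul_mem N M hy hx))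
    (fun t => by
      refine LinearMap.congr_fun (f := braid M N ∘ₗ tensorD M N) (g := tensorD N M ∘ₗ braid M N)
        (tensor_ext fun p q x y hx hy => ?_) t
      rw [LinearMap.comp_apply, LinearMap.comp_apply, tensorD_apply M N hx, braid_apply M N hx hy,
        map_add, map_smul, map_smul, tensorD_apply N M hy, braid_apply M N (M.d_mem p x hx) hy,
        braid_apply M N hx (N.d_mem q y hy), mul_comm p (q - 1), sgn_mul_sub_one,
        sgn_mul_sub_one, mul_comm q p, smul_smul, smul_add, smul_smul, mul_left_comm,
        sgn_mul_self, mul_one, add_comm])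

theorem braid_hexagon (M N K : DGVect.{u} k) :
    (α_ M N K).hom ≫ (braidIso M (N ⊗ K)).hom ≫ (α_ N K M).hom =
      ((braidIso M N).hom ▷ K) ≫ (α_ N M K).hom ≫ (N ◁ (braidIso M K).hom) := hom_ext (by
    refine tensor_ext₃ (M := M) (N := N) (K := K) fun p q r x y z hx hy hz => ?_
    have h₁ : (braid M (tensor N K) (x ⊗ₜ[k] (y ⊗ₜ[k] z)) :
        (N.carrier ⊗[k] K.carrier) ⊗[k] M.carrier) =
          (sgn (p * (q + r)) : k) • ((y ⊗ₜ[k] z) ⊗ₜ[k] x) :=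
      braid_apply M (tensor N K) hx (tmul_mem N K hy hz)
    change TensorProduct.assoc k N.carrier K.carrier M.carrier
        (braid M (tensor N K) (x ⊗ₜ[k] (y ⊗ₜ[k] z))) =
      TensorProduct.map LinearMap.id (braid M K) (TensorProduct.assoc k N.carrier M.carrier
        K.carrier ((braid M N (x ⊗ₜ[k] y)) ⊗ₜ[k] z))
    refine (congrArg (TensorProduct.assoc k N.carrier K.carrier M.carrier) h₁).trans ?_
    rw [braid_apply M N hx hy, map_smul, ← TensorProduct.smul_tmul', map_smul, map_smul,
      TensorProduct.assoc_tmul, TensorProduct.assoc_tmul, TensorProduct.map_tmul,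
      braid_apply M K hx hz, TensorProduct.tmul_smul, smul_smul, mul_add, sgn_add]
    rfl)

noncomputable instance symmetricCategory : SymmetricCategory (DGVect.{u} k) where
  braiding := braidIso
  braiding_naturality_right M N N' f := hom_ext (by
    refine tensor_ext (M := M) (N := N) fun p q x y hx hy => ?_
    change braid M N' (x ⊗ₜ[k] f.lin y) =
      TensorProduct.map f.lin LinearMap.id (braid M N (x ⊗ₜ[k] y))
    rw [braid_apply M N' hx (f.map_mem q y hy), braid_apply M N hx hy, map_smul]
    rfl)
  braiding_naturality_left {M M'} f N := hom_ext (by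
    refine tensor_ext (M := M) (N := N) fun p q x y hx hy => ?_
    change braid M' N (f.lin x ⊗ₜ[k] y) =
      TensorProduct.map LinearMap.id f.lin (braid M N (x ⊗ₜ[k] y))
    rw [braid_apply M' N (f.map_mem p x hx) hy, braid_apply M N hx hy, map_smul]
    rfl)
  hexagon_forward := braid_hexagon
  hexagon_reverse M N K := by
    have h := congrArg Iso.inv (show (α_ K M N) ≪≫ braidIso K (M ⊗ N) ≪≫ α_ M N K =
      whiskerRightIso (braidIso K M) N ≪≫ α_ M K N ≪≫ whiskerLeftIso M (braidIso K N) from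
      Iso.ext (braid_hexagon K M N))
    simpa using! h
  symmetry M N := hom_ext (braid_braid M N)

end Braiding

section Closed

variable (M N : DGVect.{u} k)

/-- The linear maps of degree `n`. -/
def homDeg (n : ℤ) : Submodule k (M.carrier →ₗ[k] N.carrier) where
  carrier := {φ | ∀ (p : ℤ) (x : M.carrier), x ∈ M.deg p → φ x ∈ N.deg (p + n)}
  add_mem' h h' p x hx := Submodule.add_mem _ (h p x hx) (h' p x hx)
  zero_mem' _ _ _ := Submodule.zero_mem _
  smul_mem' a _ h p x hx := Submodule.smul_mem _ a (h p x hx)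

/-- `(D φ) x = (-1)^|x| (d (φ x) - φ (d x))` -/
noncomputable def homD : (M.carrier →ₗ[k] N.carrier) →ₗ[k] (M.carrier →ₗ[k] N.carrier) :=
  LinearMap.lcomp k N.carrier M.par ∘ₗ
    (LinearMap.compRight k N.d - LinearMap.lcomp k N.carrier M.d)

theorem homD_apply (φ : M.carrier →ₗ[k] N.carrier) {p : ℤ} {x : M.carrier} (hx : x ∈ M.deg p) :
    homD M N φ x = (sgn p : k) • (N.d (φ x) - φ (M.d x)) := by
  change N.d (φ (M.par x)) - φ (M.d (M.par x)) = _
  rw [M.par_of_mem hx, map_smul, map_smul, map_smul, map_smul, smul_sub]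

/-- The internal hom: finite sums of homogeneous linear maps. With this differential,
`x ⊗ φ ↦ φ x` is a morphism. -/
noncomputable def internalHom : DGVect.{u} k :=
  ofFamily (homDeg M N)
    (fun n φ h h' => lin_ext fun p x hx => by
      have h₀ := eq_zero_of_mem_iSup (homDeg M N) n (N.pr (p + n) ∘ₗ LinearMap.applyₗ x)
        (fun m hm ψ hψ => N.pr_of_ne (fun e => hm (add_left_cancel e)) (hψ p x hx)) h'
      change N.pr (p + n) (φ x) = 0 at h₀
      rwa [N.pr_of_mem (h p x hx)] at h₀)
    (homD M N)
    (fun n φ h p x hx => by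
      rw [homD_apply M N φ hx]
      refine Submodule.smul_mem _ _ (Submodule.sub_mem _ ?_ ?_)
      · have := N.d_mem _ _ (h p x hx)
        rwa [← add_sub_assoc]
      · have := h _ _ (M.d_mem p x hx)
        rwa [show p + (n - 1) = p - 1 + n by ring])
    (fun n φ h => lin_ext fun p x hx => by
      rw [homD_apply M N _ hx, homD_apply M N _ hx, homD_apply M N _ (M.d_mem p x hx), M.d_d,
        map_smul, map_sub, N.d_d, sgn_sub_one]
      simp)

variable {M N} in
theorem curry_aux {T : DGVect.{u} k} (f : M.carrier ⊗[k] T.carrier →ₗ[k] N.carrier)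
    (hf : ∀ t, f (tensorD M T t) = N.d (f t)) {p : ℤ} {x : M.carrier} (hx : x ∈ M.deg p)
    (t : T.carrier) : f (x ⊗ₜ[k] T.d t) =
      (sgn p : k) • (N.d (f (x ⊗ₜ[k] t)) - f (M.d x ⊗ₜ[k] t)) := by
  rw [← hf, tensorD_apply M T hx, map_add, map_smul, add_sub_cancel_left, smul_smul,
    sgn_mul_self, one_smul]

variable {M N} in
/-- Currying. -/
noncomputable def curry {T : DGVect.{u} k} (f : tensor M T ⟶ N) : T ⟶ internalHom M N where
  lin := LinearMap.codRestrict (⨆ n, homDeg M N n) (TensorProduct.curry f.lin).flip (by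
    have h : (⊤ : Submodule k T.carrier) ≤
        (⨆ n, homDeg M N n).comap (TensorProduct.curry f.lin).flip := by
      rw [← T.iSup_deg]
      exact iSup_le fun n t ht => Submodule.mem_iSup_of_mem n fun p x hx =>
        f.map_mem (p + n) (x ⊗ₜ[k] t) (tmul_mem M T hx ht)
    exact fun t => h (Submodule.mem_top : t ∈ ⊤))
  map_mem n t ht p x hx := f.map_mem (p + n) (x ⊗ₜ[k] t) (tmul_mem M T hx ht)
  map_d t := Subtype.ext (lin_ext fun p x hx => by
    change f.lin (x ⊗ₜ[k] T.d t) = homD M N ((TensorProduct.curry f.lin).flip t) x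
    rw [homD_apply M N _ hx]
    exact curry_aux f.lin f.map_d hx t)

variable {M N} in
/-- Uncurrying. -/
noncomputable def uncurry {T : DGVect.{u} k} (g : T ⟶ internalHom M N) : tensor M T ⟶ N where
  lin := TensorProduct.lift ((⨆ n, homDeg M N n).subtype ∘ₗ g.lin).flip
  map_mem n := by
    refine tensorDeg_le (S := (N.deg n).comap _) fun p q hpq x hx t ht => ?_
    rw [← hpq]
    exact g.map_mem q t ht p x hx
  map_d t := by
    refine LinearMap.congr_fun
      (f := TensorProduct.lift ((⨆ n, homDeg M N n).subtype ∘ₗ g.lin).flip ∘ₗ tensorD M T)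
      (g := N.d ∘ₗ TensorProduct.lift ((⨆ n, homDeg M N n).subtype ∘ₗ g.lin).flip)
      (tensor_ext fun p q x t hx ht => ?_) t
    have h₁ : (g.lin (T.d t)).1 x = homD M N (g.lin t).1 x :=
      congrArg (fun φ : (internalHom M N).carrier => φ.1 x) (g.map_d t)
    rw [homD_apply M N _ hx] at h₁
    rw [LinearMap.comp_apply, tensorD_apply M T hx, map_add, map_smul]
    change (g.lin t).1 (M.d x) + (sgn p : k) • (g.lin (T.d t)).1 x = N.d ((g.lin t).1 x)
    rw [h₁, smul_smul, sgn_mul_self, one_smul, add_sub_cancel]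

/-- The adjunction between tensor product and internal hom. -/
noncomputable def curryEquiv (M T N : DGVect.{u} k) :
    ((tensorLeft M).obj T ⟶ N) ≃ (T ⟶ internalHom M N) where
  toFun f := curry f
  invFun g := uncurry g
  left_inv _ := hom_ext (TensorProduct.ext' fun _ _ => rfl)
  right_inv _ := hom_ext (LinearMap.ext fun _ => rfl)

noncomputable instance monoidalClosed : MonoidalClosed (DGVect.{u} k) where
  closed M :=
    { rightAdj := Adjunction.rightAdjointOfEquiv (F := tensorLeft M) (curryEquiv M)
        (fun _ _ _ _ _ => rfl)
      adj := Adjunction.adjunctionOfEquivRight (F := tensorLeft M) (curryEquiv M)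
        (fun _ _ _ _ _ => rfl) }

end Closed

section Limits

variable {J : Type u} [SmallCategory J] (F : J ⥤ DGVect.{u} k)

/-- Compatible families of elements of degree `n`. -/
def limDeg (n : ℤ) : Submodule k (∀ j, (F.obj j).carrier) where
  carrier := {x | (∀ j, x j ∈ (F.obj j).deg n) ∧
    ∀ (i j : J) (f : i ⟶ j), (F.map f).lin (x i) = x j}
  add_mem' h h' := ⟨fun j => Submodule.add_mem _ (h.1 j) (h'.1 j), fun i j f =>
    (map_add _ _ _).trans (congrArg₂ (· + ·) (h.2 i j f) (h'.2 i j f))⟩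
  zero_mem' := ⟨fun _ => Submodule.zero_mem _, fun _ _ _ => map_zero _⟩
  smul_mem' a _ h := ⟨fun j => Submodule.smul_mem _ a (h.1 j), fun i j f =>
    (map_smul _ _ _).trans (congrArg (a • ·) (h.2 i j f))⟩

/-- The limit: finite sums of homogeneous compatible families. -/
def lim : DGVect.{u} k :=
  ofFamily (limDeg F)
    (fun n x h h' => funext fun j => by
      have h₀ := eq_zero_of_mem_iSup (limDeg F) n ((F.obj j).pr n ∘ₗ LinearMap.proj j)
        (fun m hm y hy => (F.obj j).pr_of_ne hm (hy.1 j)) h'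
      change (F.obj j).pr n (x j) = 0 at h₀
      rwa [(F.obj j).pr_of_mem (h.1 j)] at h₀)
    (LinearMap.pi fun j => (F.obj j).d ∘ₗ LinearMap.proj j)
    (fun n x h => ⟨fun j => (F.obj j).d_mem n _ (h.1 j), fun i j f =>
      ((F.map f).map_d _).trans (congrArg (F.obj j).d (h.2 i j f))⟩)
    (fun n x h => funext fun j => (F.obj j).d_d _)

/-- The limit cone. -/
def limCone : Cone F where
  pt := lim F
  π :=
    { app := fun j => ⟨LinearMap.proj j ∘ₗ (⨆ n, limDeg F n).subtype, fun n x hx => hx.1 j,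
        fun x => rfl⟩
      naturality := fun i j f => hom_ext (LinearMap.ext fun x => by
        have : (⨆ n, limDeg F n) ≤ LinearMap.eqLocus (LinearMap.proj j)
            ((F.map f).lin ∘ₗ LinearMap.proj i) :=
          iSup_le fun n x hx => (hx.2 i j f).symm
        exact this x.2) }

/-- The limit cone is a limit. -/
def limConeIsLimit : IsLimit (limCone F) where
  lift s :=
    ⟨LinearMap.codRestrict (⨆ n, limDeg F n) (LinearMap.pi fun j => (s.π.app j).lin) (by
      have h : (⊤ : Submodule k s.pt.carrier) ≤
          (⨆ n, limDeg F n).comap (LinearMap.pi fun j => (s.π.app j).lin) := by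
        rw [← s.pt.iSup_deg]
        exact iSup_le fun n t ht => Submodule.mem_iSup_of_mem n
          ⟨fun j => (s.π.app j).map_mem n t ht, fun i j f =>
            LinearMap.congr_fun (congrArg Hom.lin (s.w f)) t⟩
      exact fun t => h (Submodule.mem_top : t ∈ ⊤)),
      fun n t ht => ⟨fun j => (s.π.app j).map_mem n t ht, fun i j f =>
        LinearMap.congr_fun (congrArg Hom.lin (s.w f)) t⟩,
      fun t => Subtype.ext (funext fun j => (s.π.app j).map_d t)⟩
  fac s j := hom_ext (LinearMap.ext fun _ => rfl)
  uniq s m h := hom_ext (LinearMap.ext fun t => Subtype.ext (funext fun j =>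
    LinearMap.congr_fun (congrArg Hom.lin (h j)) t))

instance hasLimits : HasLimits (DGVect.{u} k) where
  has_limits_of_shape _ _ := ⟨fun F => ⟨⟨⟨limCone F, limConeIsLimit F⟩⟩⟩⟩

end Limits

end DGVect

/-! ### Coherence in symmetric monoidal categories -/

section Symmetric

variable {V : Type w₂} [Category.{w} V] [MonoidalCategory V] [SymmetricCategory V]

/-! Speak of elements for brevity. A representative element `c` has values `χ₁(c)(p)` in `C^{⊗w}`
and `δ₁(c)(p)` in `P^∧(C)^{⊗w}` for `p` in `P(w;y)`. The fibre product says that evaluating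
`δ₁(c)(p)` at a word of operations `q` gives `χ₁(c)(p ∘ q)` (`deltaEv_evW'`). Words of operations
separate the elements of `P^∧(C)^{⊗w}` (`separating_evW`), so `α` is monic (`eq_of_comp_alpha`).
Hence `χ₁` is monic, being a base change of `α`, and so are `P^∧(χ₁)` and `P₂^∧(χ₁)`. The heart of
the theorem is therefore the existence of a lift, i.e. that `δ₁(c)(p)` lies in `Q₁(C)^{⊗w}`
(`exists_comult`).

When `w` is one letter, an element `f` of `P^∧(C)` is representative once there are elements `u(q)`
of tensor powers of `P^∧(C)` such that `f(q ∘ r)` is `u(q)` evaluated at `r` (`detects_letter`). For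
`f = δ₁(c)(p)` one takes `u(q) = δ₁(c)(p ∘ q)`; the condition is associativity of the operad
(`compat_deltaEv`). For longer words the criterion must pass to tensor products
(`Probe.Detects.tensor`). Evaluating one factor by its tests, and contracting the result with
functionals, leaves an element of the other factor to which the criterion applies. This puts `f` in
`q ⊗ b` and, by symmetry, in `a ⊗ q'`, and the two meet in `q ⊗ q'`.

The facts about tensor products over a field that this uses are isolated in `HasSlices`, which is
verified for vector spaces and for dg vector spaces. The coalgebra axioms and naturality are then
checked after composing with the monomorphisms above. Coassociativity comes down to `comult_delta`,
which is proved by testing against one more layer of operations. -/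

theorem tensorδ_eq_tensorμ (x y z t : V) : tensorδ x y z t = tensorμ x z y t := by
  simp [tensorδ, tensorμ, SymmetricCategory.braiding_swap_eq_inv_braiding y z]

/-- The braiding is a monoidal transformation. -/
theorem tensorμ_braiding (x y z t : V) :
    tensorμ x y z t ≫ (β_ (x ⊗ z) (y ⊗ t)).hom =
      ((β_ x y).hom ⊗ₘ (β_ z t).hom) ≫ tensorμ y x t z := by
  have h := FreeSymm.tensorμ_braid x z y t
  have e : ∀ a b c d : V, tensorμ a c b d ≫ tensorμ a b c d = 𝟙 _ := fun a b c d => by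
    rw [← tensorδ_eq_tensorμ, tensorδ_tensorμ]
  have : IsIso (tensorμ x z y t) := ⟨tensorμ x y z t, e _ _ _ _, e _ _ _ _⟩
  rw [← cancel_epi (tensorμ x z y t), reassoc_of% h, reassoc_of% e, e, Category.comp_id]

/-- The exchange `x ⊗ (y ⊗ z) ⟶ y ⊗ (x ⊗ z)`. -/
def leftComm (x y z : V) : x ⊗ (y ⊗ z) ⟶ y ⊗ (x ⊗ z) :=
  (α_ x y z).inv ≫ (β_ x y).hom ▷ z ≫ (α_ y x z).hom

theorem leftComm_natural {x x' y y' z z' : V} (f : x ⟶ x') (g : y ⟶ y') (h : z ⟶ z') :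
    (f ⊗ₘ (g ⊗ₘ h)) ≫ leftComm x' y' z' = leftComm x y z ≫ (g ⊗ₘ (f ⊗ₘ h)) := by
  simp only [leftComm, Category.assoc, associator_inv_naturality_assoc, ← associator_naturality]
  simp only [← tensorHom_id, tensorHom_comp_tensorHom_assoc, BraidedCategory.braiding_naturality,
    Category.comp_id, Category.id_comp]

theorem leftComm_natural_mid (x : V) {y y' : V} (g : y ⟶ y') (z : V) :
    x ◁ (g ▷ z) ≫ leftComm x y' z = leftComm x y z ≫ g ▷ (x ⊗ z) := by
  have h := leftComm_natural (𝟙 x) g (𝟙 z)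
  simpa using h

/-- Evaluating the second tensor factor and then the first is evaluating both at once. This lets
tests on a tensor product be applied one factor at a time. -/
theorem whiskerLeft_leftComm_comp {x a x' b g g' : V} (e : x ⊗ a ⟶ g) (e' : x' ⊗ b ⟶ g') :
    x ◁ (leftComm x' a b ≫ a ◁ e') ≫ (α_ x a g').inv ≫ e ▷ g' =
      (α_ x x' (a ⊗ b)).inv ≫ tensorμ x x' a b ≫ (e ⊗ₘ e') := by
  simp [leftComm, tensorμ, tensorHom_def']

theorem whiskerLeft_whiskerLeft_leftComm {x a x' b g g' t : V} (f : t ⟶ a ⊗ b) (e : x ⊗ a ⟶ g)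
    (e' : x' ⊗ b ⟶ g') :
    x ◁ (x' ◁ f ≫ leftComm x' a b ≫ a ◁ e') ≫ (α_ x a g').inv ≫ e ▷ g' =
      (α_ x x' t).inv ≫ (x ⊗ x') ◁ f ≫ tensorμ x x' a b ≫ (e ⊗ₘ e') := by
  rw [MonoidalCategory.whiskerLeft_comp, Category.assoc, whiskerLeft_leftComm_comp]
  simp

/-- Rewrites the exchange through braidings of `y ⊗ z` and of `(x ⊗ z) ⊗ y`, so that statements
about tensoring on the right transfer to tensoring on the left. -/
theorem leftComm_eq (x y z : V) :
    leftComm x y z = x ◁ (β_ y z).hom ≫ (α_ x z y).inv ≫ (β_ (x ⊗ z) y).hom := by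
  have h : x ◁ (β_ y z).hom ≫ x ◁ (β_ z y).hom = 𝟙 _ := by
    rw [← MonoidalCategory.whiskerLeft_comp, SymmetricCategory.symmetry,
      MonoidalCategory.whiskerLeft_id]
  simp [leftComm, reassoc_of% h]

/-- Splits a swap of two pairs into an outer swap for the unprimed pair and an inner one for the
primed pair. It is the permutation needed to freeze the second factor of a test in `left_compat`. -/
theorem braid_tensorμ_swap (x y x' y' t : V) :
    (α_ (x ⊗ y) (x' ⊗ y') t).inv ≫ tensorμ x y x' y' ▷ t ≫ (β_ (x ⊗ x') (y ⊗ y')).hom ▷ t ≫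
      (α_ (y ⊗ y') (x ⊗ x') t).hom =
    (β_ x y).hom ▷ ((x' ⊗ y') ⊗ t) ≫ (α_ y x ((x' ⊗ y') ⊗ t)).hom ≫
      y ◁ (x ◁ ((β_ x' y').hom ▷ t ≫ (α_ y' x' t).hom) ≫ leftComm x y' (x' ⊗ t) ≫
        y' ◁ (α_ x x' t).inv) ≫ (α_ y y' ((x ⊗ x') ⊗ t)).inv := by
  have h : tensorμ x y x' y' ▷ t ≫ (β_ (x ⊗ x') (y ⊗ y')).hom ▷ t =
      ((β_ x y).hom ⊗ₘ (β_ x' y').hom) ▷ t ≫ tensorμ y x y' x' ▷ t := by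
    rw [← comp_whiskerRight, tensorμ_braiding, comp_whiskerRight]
  rw [reassoc_of% h]
  simp only [tensorμ, leftComm, MonoidalCategory.tensorHom_def, comp_whiskerRight, Category.assoc,
    MonoidalCategory.whiskerLeft_comp]
  -- Both sides now contain the same three braidings in the same order; only associators differ.
  monoidal

end Symmetric

/-! ### Two-step evaluation -/

section Interchange

variable {V : Type w₂} [Category.{w} V] [MonoidalCategory V] [SymmetricCategory V]

/-- Apply `u` to the first factor of `x ⊗ y`, then `η` to the second one. -/
def applyTwice {x y t h k : V} (u : x ⊗ t ⟶ h) (η : y ⊗ h ⟶ k) : (x ⊗ y) ⊗ t ⟶ k :=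
  (β_ x y).hom ▷ t ≫ (α_ y x t).hom ≫ y ◁ u ≫ η

theorem whiskerLeft_applyTwice {x y t t' h k : V} (f : t' ⟶ t) (u : x ⊗ t ⟶ h) (η : y ⊗ h ⟶ k) :
    (x ⊗ y) ◁ f ≫ applyTwice u η = applyTwice (x ◁ f ≫ u) η := by
  simp only [applyTwice, MonoidalCategory.whiskerLeft_comp, Category.assoc]
  rw [whisker_exchange_assoc, tensor_whiskerLeft]
  simp only [Category.assoc, Iso.inv_hom_id_assoc]

/-- Interchange law: a tensor product of two-step evaluations is the two-step evaluation of the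
tensor products, because the middle exchange is compatible with braidings and associators. -/
theorem applyTwice_tensor {x x' y y' t t' h h' k k' : V} (u : x ⊗ t ⟶ h) (η : y ⊗ h ⟶ k)
    (u' : x' ⊗ t' ⟶ h') (η' : y' ⊗ h' ⟶ k') :
    applyTwice (tensorμ x x' t t' ≫ (u ⊗ₘ u')) (tensorμ y y' h h' ≫ (η ⊗ₘ η')) =
      tensorμ x x' y y' ▷ (t ⊗ t') ≫ tensorμ (x ⊗ y) (x' ⊗ y') t t' ≫
        (applyTwice u η ⊗ₘ applyTwice u' η') := by
  simp only [applyTwice, ← tensorHom_comp_tensorHom, MonoidalCategory.whiskerLeft_comp,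
    Category.assoc]
  rw [← tensorμ_natural_left_assoc, ← comp_whiskerRight_assoc, FreeSymm.tensorμ_braid,
    comp_whiskerRight_assoc, reassoc_of% tensor_associativity, tensorμ_natural_right_assoc]

end Interchange

/-! ### Slices and separating families -/

section Slices

variable {V : Type w₂} [Category.{w} V] [MonoidalCategory V] [MonoidalClosed V]

/-- The dual object `[b, 𝟙]`. -/
noncomputable abbrev dualObj (b : V) : V := (ihom b).obj (𝟙_ V)

/-- The contraction of the second factor of `a ⊗ b` against the dual of `b`. -/
noncomputable def slice {t a b : V} (f : t ⟶ a ⊗ b) : t ⊗ dualObj b ⟶ a :=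
  f ▷ dualObj b ≫ (α_ a b (dualObj b)).hom ≫ a ◁ (ihom.ev b).app (𝟙_ V) ≫ (ρ_ a).hom

theorem slice_comp_whiskerRight {t a a' b : V} (f : t ⟶ a ⊗ b) (g : a ⟶ a') :
    slice (f ≫ g ▷ b) = slice f ≫ g := by
  simp only [slice, comp_whiskerRight, Category.assoc, associator_naturality_left_assoc,
    ← whisker_exchange_assoc, Functor.id_obj, rightUnitor_naturality]

/-- The contraction touches only `b`, so it commutes with evaluating the factor `a`. -/
theorem slice_whiskerLeft {x t a b g : V} (f : t ⟶ a ⊗ b) (e : x ⊗ a ⟶ g) :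
    x ◁ slice f ≫ e =
      (α_ x t (dualObj b)).inv ≫ slice (x ◁ f ≫ (α_ x a b).inv ≫ e ▷ b) := by
  rw [← Category.assoc (x ◁ f), slice_comp_whiskerRight]
  simp [slice]

/-- Tensors are separated by slices, slices of tensors detect subobjects, and all monomorphisms are
regular: the properties of tensor products over a field that are used for cofree coalgebras. -/
class HasSlices (V : Type w₂) [Category.{w} V] [MonoidalCategory V] [MonoidalClosed V] :
    Prop where
  slice_injective : ∀ {t a b : V} {f g : t ⟶ a ⊗ b}, slice f = slice g → f = g
  factors_of_slice : ∀ {t a b q : V} (i : q ⟶ a) [Mono i] (f : t ⟶ a ⊗ b)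
    (k : t ⊗ dualObj b ⟶ q), k ≫ i = slice f → ∃ f' : t ⟶ q ⊗ b, f' ≫ i ▷ b = f
  regular : ∀ {q a : V} (i : q ⟶ a) [Mono i], ∃ (l : V) (p₁ p₂ : a ⟶ l), i ≫ p₁ = i ≫ p₂ ∧
    ∀ {t : V} (f : t ⟶ a), f ≫ p₁ = f ≫ p₂ → ∃ f' : t ⟶ q, f' ≫ i = f

variable [HasSlices V]

/-- Under slicing, composition with `i ▷ b` becomes composition with `i`, and slicing is injective.
-/
instance mono_whiskerRight {q a : V} (i : q ⟶ a) [Mono i] (b : V) : Mono (i ▷ b) where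
  right_cancellation f g h := by
    apply HasSlices.slice_injective
    rw [← cancel_mono i, ← slice_comp_whiskerRight, h, slice_comp_whiskerRight]

/-- A family of maps `x r ⊗ a ⟶ k r` that distinguishes generalised elements of `a`. -/
def Separating {R : Type v} {a : V} {x k : R → V} (e : ∀ r, x r ⊗ a ⟶ k r) : Prop :=
  ∀ ⦃t : V⦄ (f g : t ⟶ a), (∀ r, x r ◁ f ≫ e r = x r ◁ g ≫ e r) → f = g

/-- Slicing turns generalised elements of `a ⊗ b` into generalised elements of `a` with parameters
`t ⊗ dualObj b`, where `he` applies. -/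
theorem Separating.whiskerRight {R : Type v} {a : V} {x k : R → V} {e : ∀ r, x r ⊗ a ⟶ k r}
    (he : Separating e) (b : V) :
    Separating (fun r => (α_ (x r) a b).inv ≫ e r ▷ b) := by
  intro t f g h
  refine HasSlices.slice_injective (he _ _ fun r => ?_)
  rw [slice_whiskerLeft, slice_whiskerLeft, h r]

end Slices

section SymmetricSlices

variable {V : Type w₂} [Category.{w} V] [MonoidalCategory V] [MonoidalClosed V]
  [SymmetricCategory V] [HasSlices V]

instance mono_whiskerLeft {q a : V} (i : q ⟶ a) [Mono i] (b : V) : Mono (b ◁ i) where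
  right_cancellation f g h := by
    rw [← cancel_mono (β_ b q).hom, ← cancel_mono (i ▷ b)]
    simpa using h =≫ (β_ b a).hom

instance mono_tensorHom {q a q' a' : V} (i : q ⟶ a) [Mono i] (i' : q' ⟶ a') [Mono i'] :
    Mono (i ⊗ₘ i') := by
  rw [MonoidalCategory.tensorHom_def]
  exact mono_comp _ _

/-- The mirror image of `Separating.whiskerRight`, transported along the braiding. -/
theorem Separating.leftComm {R : Type v} {b : V} {x k : R → V} {e : ∀ r, x r ⊗ b ⟶ k r}
    (he : Separating e) (a : V) :
    Separating (fun r => leftComm (x r) a b ≫ a ◁ e r) := by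
  intro t f g h
  rw [← cancel_mono (β_ a b).hom]
  refine he.whiskerRight a _ _ fun r => ?_
  have key : ∀ f : t ⟶ a ⊗ b, (x r ◁ (f ≫ (β_ a b).hom) ≫ (α_ (x r) b a).inv ≫ e r ▷ a) ≫
      (β_ (k r) a).hom = x r ◁ f ≫ _root_.leftComm (x r) a b ≫ a ◁ e r := fun f => by
    rw [leftComm_eq]
    simp only [Category.assoc, MonoidalCategory.whiskerLeft_comp,
      BraidedCategory.braiding_naturality_left]
  rw [← cancel_mono (β_ (k r) a).hom, key, key, h r]

/-- Strip the second factor with `he'`, then the first with `he`; the two successive evaluations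
recombine into the joint one. -/
theorem Separating.tensor {R R' : Type v} {a b : V} {x k : R → V} {x' k' : R' → V}
    {e : ∀ r, x r ⊗ a ⟶ k r} {e' : ∀ r, x' r ⊗ b ⟶ k' r} (he : Separating e)
    (he' : Separating e') :
    Separating (fun r : R × R' => tensorμ (x r.1) (x' r.2) a b ≫ (e r.1 ⊗ₘ e' r.2)) := by
  intro t f g h
  refine he'.leftComm a _ _ fun r' => he.whiskerRight _ _ _ fun r => ?_
  rw [whiskerLeft_whiskerLeft_leftComm, whiskerLeft_whiskerLeft_leftComm, h (r, r')]

/-- If all values of a separating family on the second factor lie in `q ⊗ -`, so does `f`. -/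
theorem Separating.factors {R : Type v} {b : V} {x k : R → V} {e : ∀ r, x r ⊗ b ⟶ k r}
    (he : Separating e) {q a : V} (i : q ⟶ a) [Mono i] {t : V} (f : t ⟶ a ⊗ b)
    (h : ∀ r, ∃ f' : x r ⊗ t ⟶ q ⊗ k r,
      f' ≫ i ▷ k r = x r ◁ f ≫ _root_.leftComm (x r) a b ≫ a ◁ e r) :
    ∃ f' : t ⟶ q ⊗ b, f' ≫ i ▷ b = f := by
  -- With `i` as an equaliser, membership in `q ⊗ b` is governed by an equation between maps into `l
  -- ⊗ b`, which the separating family can test.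
  obtain ⟨l, p₁, p₂, hp, hl⟩ := HasSlices.regular i
  have key : ∀ (r : R) (p : a ⟶ l), x r ◁ (f ≫ p ▷ b) ≫ _root_.leftComm (x r) l b ≫ l ◁ e r =
      (x r ◁ f ≫ _root_.leftComm (x r) a b ≫ a ◁ e r) ≫ p ▷ k r := fun r p => by
    simp only [MonoidalCategory.whiskerLeft_comp, Category.assoc]
    rw [reassoc_of% leftComm_natural_mid, whisker_exchange]
  have hf : f ≫ p₁ ▷ b = f ≫ p₂ ▷ b := he.leftComm l _ _ fun r => by
    obtain ⟨f', hf'⟩ := h r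
    rw [key, key, ← hf', Category.assoc, Category.assoc, ← comp_whiskerRight, hp,
      comp_whiskerRight]
  -- The equation `hf` passes to slices, so every slice of `f` lies in `q`.
  obtain ⟨s, hs⟩ := hl (slice f) (by
    rw [← slice_comp_whiskerRight, hf, slice_comp_whiskerRight])
  exact HasSlices.factors_of_slice i f s hs

end SymmetricSlices

/-! ### Tensor products of tests -/

section TensorTests

variable {V : Type w₂} [Category.{w} V] [MonoidalCategory V] [SymmetricCategory V]
  {x x' y y' t h h' k k' a b : V}

/-- The tensor product of two maps out of triple tensor products. -/
def tensorTest (e : (x ⊗ y) ⊗ a ⟶ k) (e' : (x' ⊗ y') ⊗ b ⟶ k') :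
    ((x ⊗ x') ⊗ (y ⊗ y')) ⊗ (a ⊗ b) ⟶ k ⊗ k' :=
  tensorμ x x' y y' ▷ (a ⊗ b) ≫ tensorμ (x ⊗ y) (x' ⊗ y') a b ≫ (e ⊗ₘ e')

theorem braid_tensorTest (e : (x ⊗ y) ⊗ a ⟶ k) (e' : (x' ⊗ y') ⊗ b ⟶ k') :
    tensorTest e e' ≫ (β_ k k').hom =
      (((β_ x x').hom ⊗ₘ (β_ y y').hom) ⊗ₘ (β_ a b).hom) ≫ tensorTest e' e := by
  simp only [tensorTest, Category.assoc, BraidedCategory.braiding_naturality]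
  rw [← tensorHom_id, ← tensorHom_id, tensorHom_comp_tensorHom_assoc, ← tensorμ_braiding,
    Category.comp_id, reassoc_of% tensorμ_braiding, tensorHom_comp_tensorHom_assoc,
    Category.id_comp]

theorem tensorTest_natural {x₁ x₁' y₁ y₁' a₁ b₁ : V} (f : x₁ ⟶ x) (f' : x₁' ⟶ x')
    (g : y₁ ⟶ y) (g' : y₁' ⟶ y') (i : a₁ ⟶ a) (i' : b₁ ⟶ b) (e : (x ⊗ y) ⊗ a ⟶ k)
    (e' : (x' ⊗ y') ⊗ b ⟶ k') :
    tensorTest (((f ⊗ₘ g) ⊗ₘ i) ≫ e) (((f' ⊗ₘ g') ⊗ₘ i') ≫ e') =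
      (((f ⊗ₘ f') ⊗ₘ (g ⊗ₘ g')) ⊗ₘ (i ⊗ₘ i')) ≫ tensorTest e e' := by
  simp only [tensorTest, ← tensorHom_comp_tensorHom]
  rw [← tensorμ_natural_assoc, ← tensorHom_id, ← tensorHom_id, tensorHom_comp_tensorHom_assoc,
    ← tensorμ_natural, Category.id_comp, tensorHom_comp_tensorHom_assoc, Category.comp_id]

theorem tensorTest_comp {z z' a₁ b₁ : V} (c : x ⊗ y ⟶ z) (c' : x' ⊗ y' ⟶ z') (i : a ⟶ a₁)
    (i' : b ⟶ b₁) (e : z ⊗ a₁ ⟶ h) (e' : z' ⊗ b₁ ⟶ h') (l : h ⟶ k) (l' : h' ⟶ k') :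
    tensorTest ((c ⊗ₘ i) ≫ e ≫ l) ((c' ⊗ₘ i') ≫ e' ≫ l') =
      ((tensorμ x x' y y' ≫ (c ⊗ₘ c')) ⊗ₘ (i ⊗ₘ i')) ≫ (tensorμ z z' a₁ b₁ ≫ (e ⊗ₘ e')) ≫
        (l ⊗ₘ l') := by
  simp only [tensorTest, ← tensorHom_comp_tensorHom]
  rw [← tensorμ_natural_assoc, ← tensorHom_id, tensorHom_comp_tensorHom_assoc, Category.id_comp,
    Category.assoc]

theorem tensorμ_comp {a₁ b₁ : V} (i : a ⟶ a₁) (i' : b ⟶ b₁) (e : x ⊗ a₁ ⟶ h)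
    (e' : x' ⊗ b₁ ⟶ h') :
    (x ⊗ x') ◁ (i ⊗ₘ i') ≫ tensorμ x x' a₁ b₁ ≫ (e ⊗ₘ e') =
      tensorμ x x' a b ≫ ((x ◁ i ≫ e) ⊗ₘ (x' ◁ i' ≫ e')) := by
  rw [tensorμ_natural_right_assoc, tensorHom_comp_tensorHom]

/-- Moves the final braiding back through both steps. The braiding of `x` and `x'` then appears
outside and, inverted, around `u`. -/
theorem braid_applyTwice (u : (x ⊗ x') ⊗ t ⟶ h ⊗ h') (e : y ⊗ h ⟶ k) (e' : y' ⊗ h' ⟶ k') :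
    applyTwice u (tensorμ y y' h h' ≫ (e ⊗ₘ e')) ≫ (β_ k k').hom =
      ((β_ x x').hom ⊗ₘ (β_ y y').hom) ▷ t ≫
        applyTwice ((β_ x' x).hom ▷ t ≫ u ≫ (β_ h h').hom) (tensorμ y' y h' h ≫ (e' ⊗ₘ e)) := by
  -- The outer braiding of `x, x'` cancels the inner one; only that of `y, y'` survives.
  have h₁ : ((β_ x x').hom ⊗ₘ (β_ y y').hom) ▷ t ≫ (β_ (x' ⊗ x) (y' ⊗ y)).hom ▷ t ≫
      (α_ _ _ t).hom ≫ (y' ⊗ y) ◁ (β_ x' x).hom ▷ t =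
      (β_ (x ⊗ x') (y ⊗ y')).hom ▷ t ≫ (α_ _ _ t).hom ≫ (β_ y y').hom ▷ ((x ⊗ x') ⊗ t) := by
    rw [← comp_whiskerRight_assoc, BraidedCategory.braiding_naturality, comp_whiskerRight_assoc,
      ← tensorHom_id (_ ⊗ₘ _), associator_naturality_assoc, ← id_tensorHom,
      tensorHom_comp_tensorHom,
      tensorHom_id, ← comp_whiskerRight, SymmetricCategory.symmetry, Category.comp_id,
      id_whiskerRight, tensorHom_id]
  simp only [applyTwice, MonoidalCategory.whiskerLeft_comp, Category.assoc,
    BraidedCategory.braiding_naturality, reassoc_of% tensorμ_braiding]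
  rw [reassoc_of% h₁, MonoidalCategory.tensorHom_def (β_ y y').hom, Category.assoc,
    whisker_exchange_assoc]

/-- Carries compatibility across the symmetry, so that the argument for the left factor also serves
for the right one. -/
theorem swap_compat {f : t ⟶ a ⊗ b} {e : (x ⊗ y) ⊗ a ⟶ k} {e' : (x' ⊗ y') ⊗ b ⟶ k'}
    {u : (x ⊗ x') ⊗ t ⟶ h ⊗ h'} {v : y ⊗ h ⟶ k} {v' : y' ⊗ h' ⟶ k'}
    (hu : ((x ⊗ x') ⊗ (y ⊗ y')) ◁ f ≫ tensorTest e e' =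
      applyTwice u (tensorμ y y' h h' ≫ (v ⊗ₘ v'))) :
    ((x' ⊗ x) ⊗ (y' ⊗ y)) ◁ (f ≫ (β_ a b).hom) ≫ tensorTest e' e =
      applyTwice ((β_ x' x).hom ▷ t ≫ u ≫ (β_ h h').hom) (tensorμ y' y h' h ≫ (v' ⊗ₘ v)) := by
  rw [← cancel_epi (((β_ x x').hom ⊗ₘ (β_ y y').hom) ▷ t), ← braid_applyTwice, ← hu,
    Category.assoc, braid_tensorTest, MonoidalCategory.whiskerLeft_comp]
  rw [Category.assoc, ← whisker_exchange_assoc, ← id_tensorHom _ (β_ a b).hom, ← tensorHom_id,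
    tensorHom_comp_tensorHom_assoc, Category.comp_id, Category.id_comp]

end TensorTests

section

variable {V : Type w₂} [Category.{w} V] [MonoidalCategory V] [SymmetricCategory V]
  {x x' y y' t h h' k k' a b : V}

/-- Freezing the test `e'` on the second factor leaves a generalised element of `a ⊗ k'` with
parameters `(x' ⊗ y') ⊗ t`. Its values are again computed in two steps: first `u` followed by `v'`
on `h'`, then `v` on `h`. -/
theorem left_compat {f : t ⟶ a ⊗ b} {e : (x ⊗ y) ⊗ a ⟶ k} {e' : (x' ⊗ y') ⊗ b ⟶ k'}
    {u : (x ⊗ x') ⊗ t ⟶ h ⊗ h'} {v : y ⊗ h ⟶ k} {v' : y' ⊗ h' ⟶ k'}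
    (hu : ((x ⊗ x') ⊗ (y ⊗ y')) ◁ f ≫ tensorTest e e' =
      applyTwice u (tensorμ y y' h h' ≫ (v ⊗ₘ v'))) :
    (x ⊗ y) ◁ ((x' ⊗ y') ◁ f ≫ leftComm (x' ⊗ y') a b ≫ a ◁ e') ≫ (α_ (x ⊗ y) a k').inv ≫
        e ▷ k' =
      applyTwice (x ◁ ((β_ x' y').hom ▷ t ≫ (α_ y' x' t).hom) ≫ leftComm x y' (x' ⊗ t) ≫
        y' ◁ (α_ x x' t).inv ≫ y' ◁ u ≫ leftComm y' h h' ≫ h ◁ v')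
        ((α_ y h k').inv ≫ v ▷ k') := by
  rw [whiskerLeft_whiskerLeft_leftComm]
  have h₁ : tensorμ x x' y y' ▷ t ≫ ((x ⊗ y) ⊗ (x' ⊗ y')) ◁ f ≫
      tensorμ (x ⊗ y) (x' ⊗ y') a b ≫ (e ⊗ₘ e') =
      applyTwice u (tensorμ y y' h h' ≫ (v ⊗ₘ v')) := by
    rw [← hu, tensorTest, whisker_exchange_assoc]
  have h₂ : ∀ (x y z t : V), tensorμ x z y t ≫ tensorμ x y z t = 𝟙 _ := fun x y z t => by
    rw [← tensorδ_eq_tensorμ, tensorδ_tensorμ]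
  have h₃ : tensorμ x y x' y' ▷ t ≫ tensorμ x x' y y' ▷ t = 𝟙 _ := by
    rw [← comp_whiskerRight, h₂, id_whiskerRight]
  -- A pair of mutually inverse exchanges is inserted to reach the order of factors in which `hu` is
  -- stated.
  rw [← Category.id_comp ((_ ⊗ _) ◁ f), ← h₃]
  simp only [Category.assoc]
  rw [h₁]
  simp only [applyTwice]
  rw [reassoc_of% braid_tensorμ_swap]
  simp only [MonoidalCategory.whiskerLeft_comp, Category.assoc]
  have h₄ := whiskerLeft_whiskerLeft_leftComm u v v'
  simp only [MonoidalCategory.whiskerLeft_comp, Category.assoc] at h₄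
  rw [h₄]

variable [MonoidalClosed V]

/-- The second step leaves the spectator `g` alone, so `g` may be contracted away before it. -/
theorem slice_applyTwice {g : V} (u : x ⊗ t ⟶ h ⊗ g) (v : y ⊗ h ⟶ k) :
    (α_ (x ⊗ y) t (dualObj g)).inv ≫ slice (applyTwice u ((α_ y h g).inv ≫ v ▷ g)) =
      applyTwice ((α_ x t (dualObj g)).inv ≫ slice u) v := by
  have hs : ∀ {r s c : V} (j : r ⟶ s) (f : s ⟶ c ⊗ g),
      slice (j ≫ f) = j ▷ dualObj g ≫ slice f := fun j f => by simp [slice]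
  simp only [applyTwice, hs, MonoidalCategory.whiskerLeft_comp, Category.assoc]
  rw [slice_whiskerLeft]
  simp only [hs]
  monoidal

end

/-! ### Subobjects detected by probes -/

section Probes

variable {V : Type w₂} [Category.{w} V] [MonoidalCategory V] [SymmetricCategory V]

/-- Two-step tests for generalised elements `f` of `a`: the value of `f` at `x` is asked to be
computed in `k` by a map from `y` out of some `u x` in `h`. -/
structure Probe (a : V) where
  S : Type u
  R : Type u
  base : R → S
  x : S → V
  h : S → V
  y : R → V
  k : R → V
  test : ∀ r, (x (base r) ⊗ y r) ⊗ a ⟶ k r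
  value : ∀ r, y r ⊗ h (base r) ⟶ k r

namespace Probe

variable {a b : V}

/-- The values of `f` are computed from `u`. -/
def Compat (p : Probe.{u} a) {t : V} (f : t ⟶ a) (u : ∀ s, p.x s ⊗ t ⟶ p.h s) : Prop :=
  ∀ r, (p.x (p.base r) ⊗ p.y r) ◁ f ≫ p.test r = applyTwice (u (p.base r)) (p.value r)

/-- `i : q ⟶ a` contains the generalised elements whose values are computed in two steps. -/
def Detects (p : Probe.{u} a) {q : V} (i : q ⟶ a) : Prop :=
  ∀ ⦃t : V⦄ (f : t ⟶ a) (u : ∀ s, p.x s ⊗ t ⟶ p.h s), p.Compat f u → ∃ f' : t ⟶ q, f' ≫ i = f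

/-- The tensor product of probes. -/
def tensor (p : Probe.{u} a) (p' : Probe.{u} b) : Probe.{u} (a ⊗ b) where
  S := p.S × p'.S
  R := p.R × p'.R
  base r := (p.base r.1, p'.base r.2)
  x s := p.x s.1 ⊗ p'.x s.2
  h s := p.h s.1 ⊗ p'.h s.2
  y r := p.y r.1 ⊗ p'.y r.2
  k r := p.k r.1 ⊗ p'.k r.2
  test r := tensorTest (p.test r.1) (p'.test r.2)
  value r := tensorμ _ _ _ _ ≫ (p.value r.1 ⊗ₘ p'.value r.2)

theorem Compat.swap {p : Probe.{u} a} {p' : Probe.{u} b} {t : V} {f : t ⟶ a ⊗ b}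
    {u : ∀ s, (p.tensor p').x s ⊗ t ⟶ (p.tensor p').h s} (hu : (p.tensor p').Compat f u) :
    (p'.tensor p).Compat (f ≫ (β_ a b).hom)
      (fun s => (β_ (p'.x s.1) (p.x s.2)).hom ▷ t ≫ u (s.2, s.1) ≫
        (β_ (p.h s.2) (p'.h s.1)).hom) := by
  rintro ⟨r', r⟩
  exact swap_compat (hu (r, r'))

variable [MonoidalClosed V] [HasSlices V]

/-- Slice away `g`, apply detection with parameters `t ⊗ dualObj g`, and reassemble by
`factors_of_slice`. -/
theorem Detects.whiskerRight {p : Probe.{u} a} {q : V} {i : q ⟶ a} [Mono i] (hp : p.Detects i)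
    {g t : V} (f : t ⟶ a ⊗ g) (u : ∀ s, p.x s ⊗ t ⟶ p.h s ⊗ g)
    (h : ∀ r, (p.x (p.base r) ⊗ p.y r) ◁ f ≫ (α_ _ a g).inv ≫ p.test r ▷ g =
      applyTwice (u (p.base r)) ((α_ _ _ _).inv ≫ p.value r ▷ g)) :
    ∃ f' : t ⟶ q ⊗ g, f' ≫ i ▷ g = f := by
  obtain ⟨s, hs⟩ := hp (slice f) (fun s => (α_ _ _ _).inv ≫ slice (u s)) (fun r => by
    rw [slice_whiskerLeft, h r]
    exact slice_applyTwice _ _)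
  exact HasSlices.factors_of_slice i f s hs

/-- Since the tests of `p'` separate `b`, it suffices that each value of `f` on the second factor
lies in `q ⊗ p'.k r'`. These values satisfy the two-step condition for `p` by `left_compat`. -/
theorem Detects.tensor_left {p : Probe.{u} a} {p' : Probe.{u} b} {q : V} {i : q ⟶ a} [Mono i]
    (hp : p.Detects i) (hp' : Separating p'.test) {t : V} {f : t ⟶ a ⊗ b}
    {u : ∀ s, (p.tensor p').x s ⊗ t ⟶ (p.tensor p').h s} (hu : (p.tensor p').Compat f u) :
    ∃ f' : t ⟶ q ⊗ b, f' ≫ i ▷ b = f := by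
  -- The first-step data come from `left_compat`: apply `u` at `(s, p'.base r')`, then the second
  -- step `p'.value r'` on the right factor.
  refine hp'.factors i f fun r' => hp.whiskerRight _
    (fun s => p.x s ◁ ((β_ _ _).hom ▷ t ≫ (α_ _ _ t).hom) ≫
      leftComm (p.x s) (p'.y r') (p'.x (p'.base r') ⊗ t) ≫ p'.y r' ◁ (α_ _ _ _).inv ≫
      p'.y r' ◁ u (s, p'.base r') ≫ leftComm _ _ _ ≫ p.h s ◁ p'.value r') fun r => ?_
  have h := hu (r, r')
  exact left_compat h

/-- Detection in each factor puts `f` both in `q ⊗ b` and in `a ⊗ q'`; over a field these subobjects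
of `a ⊗ b` intersect in `q ⊗ q'`. -/
theorem Detects.tensor {p : Probe.{u} a} {p' : Probe.{u} b} {q q' : V} {i : q ⟶ a} [Mono i]
    {i' : q' ⟶ b} [Mono i'] (hp : p.Detects i) (hp' : p'.Detects i') (hs : Separating p.test)
    (hs' : Separating p'.test) : (p.tensor p').Detects (i ⊗ₘ i') := by
  intro t f u hu
  obtain ⟨f₁, h₁⟩ := hp.tensor_left hs' hu
  obtain ⟨f₂, h₂⟩ := hp'.tensor_left hs hu.swap
  obtain ⟨l, p₁, p₂, hl, hl'⟩ := HasSlices.regular i'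
  -- As `f` lies in `a ⊗ q'`, the maps `p₁` and `p₂` cannot be told apart after including `q` in
  -- `a`. This inclusion stays monic after tensoring with `l`, so they already agree on `f₁`.
  have key : ∀ p : b ⟶ l, ((f₁ ≫ (β_ q b).hom) ≫ p ▷ q) ≫ l ◁ i = f₂ ≫ (i' ≫ p) ▷ a := by
    intro p
    have h : (f₁ ≫ (β_ q b).hom) ≫ b ◁ i = f₂ ≫ i' ▷ a := by
      rw [h₂, ← h₁, Category.assoc, Category.assoc, BraidedCategory.braiding_naturality_left]
    rw [Category.assoc, ← whisker_exchange, ← Category.assoc, h, Category.assoc,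
      comp_whiskerRight]
  have h₃ : (f₁ ≫ (β_ q b).hom) ≫ p₁ ▷ q = (f₁ ≫ (β_ q b).hom) ≫ p₂ ▷ q := by
    rw [← cancel_mono (l ◁ i), key, key, hl]
  obtain ⟨s, hs⟩ := hl' (slice (f₁ ≫ (β_ q b).hom)) (by
    rw [← slice_comp_whiskerRight, h₃, slice_comp_whiskerRight])
  obtain ⟨f', hf'⟩ := HasSlices.factors_of_slice i' _ s hs
  refine ⟨f' ≫ (β_ q' q).hom, ?_⟩
  rw [MonoidalCategory.tensorHom_def', Category.assoc,
    ← BraidedCategory.braiding_naturality_left_assoc,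
    reassoc_of% hf', SymmetricCategory.symmetry_assoc, h₁]

end Probe

end Probes

/-! ### Monoidality of the canonical maps on words -/

section WordCalculus

open FreeSymm

variable {X : Type u}

/-- `extendApp` recurses on the word, and the monoidal structure maps of lifted functors are
composites of identities; what remains is to erase them. The next five lemmas hold for the same
reason. -/
theorem headHeads_tensor (W W' : Words₃ X) :
    headHeads (W ⊗ W') = headHeads W ⊗ₘ headHeads W' := by
  refine Eq.trans (b := (𝟙 _ ≫ 𝟙 _) ≫ (headHeads W ⊗ₘ headHeads W') ≫ 𝟙 _ ≫ 𝟙 _) rfl ?_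
  simp

theorem joinHeads_tensor (W W' : Words₃ X) :
    joinHeads (W ⊗ W') = joinHeads W ⊗ₘ joinHeads W' := by
  refine Eq.trans (b := (𝟙 _ ≫ 𝟙 _) ≫ (joinHeads W ⊗ₘ joinHeads W') ≫ 𝟙 _ ≫ 𝟙 _) rfl ?_
  simp

theorem joinJoins_tensor (W W' : Words₃ X) :
    joinJoins (W ⊗ W') = joinJoins W ⊗ₘ joinJoins W' := by
  refine Eq.trans (b := (𝟙 _ ≫ 𝟙 _) ≫ (joinJoins W ⊗ₘ joinJoins W') ≫ 𝟙 _ ≫ 𝟙 _) rfl ?_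
  simp

theorem headHeads_unit : headHeads (𝟙_ (Words₃ X)) = 𝟙 _ := by
  refine Eq.trans (b := (𝟙 _ ≫ 𝟙 _) ≫ 𝟙 _ ≫ 𝟙 _) rfl ?_
  simp

theorem joinHeads_unit : joinHeads (𝟙_ (Words₃ X)) = 𝟙 _ := by
  refine Eq.trans (b := (𝟙 _ ≫ 𝟙 _) ≫ 𝟙 _ ≫ 𝟙 _) rfl ?_
  simp

theorem joinJoins_unit : joinJoins (𝟙_ (Words₃ X)) = 𝟙 _ := by
  refine Eq.trans (b := (𝟙 _ ≫ 𝟙 _) ≫ 𝟙 _ ≫ 𝟙 _) rfl ?_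
  simp

variable {V : Type (u + 1)} [Category.{u} V] [MonoidalCategory V] [SymmetricCategory V]

/-- Here the source is a pointwise tensor product, whose structure map is the exchange of middle
factors rather than an identity. -/
theorem innerComp_tensor (P : X → Words X ⥤ V)
    (comp : ∀ y, ptensor (head ⋙ P y) (tens P) ⟶ join ⋙ P y) (W W' : Words₃ X) :
    innerComp P comp (W ⊗ W') = tensorμ _ _ _ _ ≫ (innerComp P comp W ⊗ₘ innerComp P comp W') := by
  refine Eq.trans (b := (((𝟙 _ ≫ 𝟙 _) ⊗ₘ (𝟙 _ ≫ 𝟙 _)) ≫ tensorδ _ _ _ _) ≫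
    (innerComp P comp W ⊗ₘ innerComp P comp W') ≫ 𝟙 _ ≫ 𝟙 _) rfl ?_
  simp only [Category.comp_id, id_tensorHom_id, Category.id_comp]
  rw [tensorδ_eq_tensorμ]

theorem innerComp_unit (P : X → Words X ⥤ V)
    (comp : ∀ y, ptensor (head ⋙ P y) (tens P) ⟶ join ⋙ P y) :
    innerComp P comp (𝟙_ (Words₃ X)) = (λ_ (𝟙_ V)).hom := by
  refine Eq.trans (b := (((𝟙 _ ≫ 𝟙 _) ⊗ₘ (𝟙 _ ≫ 𝟙 _)) ≫ (λ_ (𝟙_ V)).hom) ≫ 𝟙 _ ≫ 𝟙 _) rfl ?_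
  simp only [Category.comp_id, id_tensorHom_id, Category.id_comp]

namespace ColoredOperad

/-- The composition of an operation with a word of operations. -/
def opComp (P : ColoredOperad X V) (y : X) (W : Words₂ X) :
    (P.ops y).obj (head.obj W) ⊗ (tens P.ops).obj W ⟶ (P.ops y).obj (join.obj W) :=
  (P.comp y).app W

variable [MonoidalClosed V] [HasLimits V] (P : ColoredOperad X V) (C : X → V)

/-- The tensor product of the evaluations. -/
noncomputable def evW (W : Words₂ X) :
    (tens P.ops).obj W ⊗ (tpow (P.coan C)).obj (head.obj W) ⟶ (tpow C).obj (join.obj W) :=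
  (P.evWord C).app W

theorem evW_tensor (W W' : Words₂ X) :
    P.evW C (W ⊗ W') =
      tensorμ ((tens P.ops).obj W) ((tens P.ops).obj W') ((tpow (P.coan C)).obj (head.obj W))
        ((tpow (P.coan C)).obj (head.obj W')) ≫ (P.evW C W ⊗ₘ P.evW C W') := by
  refine Eq.trans (b := ((𝟙 _ ⊗ₘ (𝟙 _ ≫ 𝟙 _)) ≫ tensorδ _ _ _ _) ≫
    (P.evW C W ⊗ₘ P.evW C W') ≫ 𝟙 _ ≫ 𝟙 _) rfl ?_
  simp only [Category.comp_id, id_tensorHom_id, Category.id_comp]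
  rw [tensorδ_eq_tensorμ]

theorem evW_unit :
    P.evW C (𝟙_ (Words₂ X)) = (λ_ (𝟙_ V)).hom := by
  refine Eq.trans (b := ((𝟙 _ ⊗ₘ (𝟙 _ ≫ 𝟙 _)) ≫ (λ_ (𝟙_ V)).hom) ≫ 𝟙 _ ≫ 𝟙 _) rfl ?_
  simp only [Category.comp_id, id_tensorHom_id, Category.id_comp]

end ColoredOperad

end WordCalculus

theorem FreeSymm.lift_map_comp {J : Type u} [SmallCategory J] {D : Type w₂} [Category.{w} D]
    [MonoidalCategory D] [SymmetricCategory D] {F : J ⥤ D} {a b c a' b' c' : FreeSymm J}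
    {f : a ⟶ b} {f' : a' ⟶ b'} {g : b ⟶ c} {g' : b' ⟶ c'} {k : b ⊗ b' ⟶ c ⊗ c'}
    (hk : k = g ⊗ₘ g') :
    (lift F).map ((f ⊗ₘ f') ≫ k) = (lift F).map (f ≫ g) ⊗ₘ (lift F).map (f' ≫ g') := by
  rw [hk, tensorHom_comp_tensorHom, lift_map_tensorHom]

section

variable {V : Type w₂} [Category.{w} V] [MonoidalCategory V]

theorem whiskerLeft_id_comp {a b c : V} (e : a ⊗ b ⟶ c) : a ◁ 𝟙 b ≫ e = e := by simp

theorem tensorHom_id_comp_id {a b c d : V} (e : a ⟶ b) (f : b ⊗ c ⟶ d) :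
    (e ⊗ₘ 𝟙 c) ≫ f ≫ 𝟙 d = e ▷ c ≫ f := by simp

theorem unit_separates {a b : V} {f g : a ⟶ b}
    (h : 𝟙_ V ◁ f ≫ (λ_ b).hom = 𝟙_ V ◁ g ≫ (λ_ b).hom) : f = g := by
  simpa using h

/-- By `h` every operation `p` is a composite `1 ∘ p`, so evaluations at composites determine all
evaluations. -/
theorem unit_comp_separates {o p a b g : V} {f₁ f₂ : a ⟶ b} {e : p ⊗ b ⟶ g} {c : o ⊗ p ⟶ p}
    {η : 𝟙_ V ⟶ o} (h : (λ_ p).inv ≫ η ▷ p ≫ c = 𝟙 p)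
    (h' : (o ⊗ p) ◁ f₁ ≫ c ▷ b ≫ e = (o ⊗ p) ◁ f₂ ≫ c ▷ b ≫ e) : p ◁ f₁ ≫ e = p ◁ f₂ ≫ e := by
  have key : ∀ f : a ⟶ b, p ◁ f ≫ e =
      ((λ_ p).inv ≫ η ▷ p) ▷ a ≫ (o ⊗ p) ◁ f ≫ c ▷ b ≫ e := fun f => by
    rw [whisker_exchange_assoc, ← comp_whiskerRight_assoc, Category.assoc, h, id_whiskerRight,
      Category.id_comp]
  rw [key, key, h']

variable [SymmetricCategory V]

/-- The two orders in which tests on a tensor product are written differ by an invertible exchange.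
-/
theorem separating_tensor_aux {x x' y y' t k k' a b : V} {f g : t ⟶ a ⊗ b}
    {e : (x ⊗ y) ⊗ a ⟶ k} {e' : (x' ⊗ y') ⊗ b ⟶ k'}
    (h : ((x ⊗ x') ⊗ (y ⊗ y')) ◁ f ≫ tensorTest e e' =
      ((x ⊗ x') ⊗ (y ⊗ y')) ◁ g ≫ tensorTest e e') :
    ((x ⊗ y) ⊗ (x' ⊗ y')) ◁ f ≫ tensorμ (x ⊗ y) (x' ⊗ y') a b ≫ (e ⊗ₘ e') =
      ((x ⊗ y) ⊗ (x' ⊗ y')) ◁ g ≫ tensorμ (x ⊗ y) (x' ⊗ y') a b ≫ (e ⊗ₘ e') := by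
  have h₂ : ∀ (x y z t : V), tensorμ x z y t ≫ tensorμ x y z t = 𝟙 _ := fun x y z t => by
    rw [← tensorδ_eq_tensorμ, tensorδ_tensorμ]
  have key : ∀ f : t ⟶ a ⊗ b, ((x ⊗ y) ⊗ (x' ⊗ y')) ◁ f ≫ tensorμ (x ⊗ y) (x' ⊗ y') a b ≫
      (e ⊗ₘ e') = tensorμ x y x' y' ▷ t ≫ ((x ⊗ x') ⊗ (y ⊗ y')) ◁ f ≫ tensorTest e e' := by
    intro f
    rw [tensorTest, ← whisker_exchange_assoc, ← comp_whiskerRight_assoc, h₂, id_whiskerRight,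
      Category.id_comp]
  rw [key, key, h]

end

/-! ### Probes of tensor words by composite operations -/

section WordProbes

open FreeSymm

variable {X : Type u} {V : Type (u + 1)} [Category.{u} V] [MonoidalCategory V]
  [SymmetricCategory V] [MonoidalClosed V] [HasLimits V]

/-- A word of decorated letters with a morphism from a given word to the word of its letters. -/
structure Decoration (w : Words X) : Type u where
  word : Words₂ X
  hom : w ⟶ head.obj word

/-- A decoration together with a further decoration of it. -/
structure Refinement (w : Words X) : Type u extends Decoration w where
  refined : Words₃ X
  toHeads : word ⟶ heads.obj refined

namespace ColoredOperad

variable (P : ColoredOperad X V) (C : X → V)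

/-- Evaluation of elements of `P^∧(C)` at composite operations. -/
noncomputable def compEval (W : Words₃ X) :
    ((tens P.ops).obj (heads.obj W) ⊗ (tens P.ops).obj (join₂.obj W)) ⊗
      (tpow (P.coan C)).obj (head.obj (heads.obj W)) ⟶ (tpow C).obj (join.obj (join₂.obj W)) :=
  (innerComp P.ops P.comp W ⊗ₘ (tpow (P.coan C)).map (headHeads W)) ≫
    P.evW C (joins.obj W) ≫ (tpow C).map (joinJoins W)

/-- Evaluation at the last operations. -/
noncomputable def lastEval (W : Words₃ X) :
    (tens P.ops).obj (join₂.obj W) ⊗ (tpow (P.coan C)).obj (join.obj (heads.obj W)) ⟶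
      (tpow C).obj (join.obj (join₂.obj W)) :=
  (tens P.ops).obj (join₂.obj W) ◁ (tpow (P.coan C)).map (joinHeads W) ≫
    P.evW C (join₂.obj W)

/-- Each ingredient is multiplicative in the word. This is what relates the probe of a tensor word
to the tensor product of the probes. -/
theorem compEval_tensor (W W' : Words₃ X) :
    P.compEval C (W ⊗ W') = tensorTest (P.compEval C W) (P.compEval C W') := by
  have h₁ := P.evW_tensor C (joins.obj W) (joins.obj W')
  have h₂ : (tpow (P.coan C)).map (headHeads (W ⊗ W')) =
      (tpow (P.coan C)).map (headHeads W) ⊗ₘ (tpow (P.coan C)).map (headHeads W') := by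
    rw [headHeads_tensor]
    exact lift_map_tensorHom _ _ _
  have h₃ : (tpow C).map (joinJoins (W ⊗ W')) =
      (tpow C).map (joinJoins W) ⊗ₘ (tpow C).map (joinJoins W') := by
    rw [joinJoins_tensor]
    exact lift_map_tensorHom _ _ _
  unfold compEval
  rw [innerComp_tensor, h₂, h₃]
  exact (congrArg (fun t => _ ≫ t ≫ _) h₁).trans (tensorTest_comp _ _ _ _ _ _ _ _).symm

theorem lastEval_tensor (W W' : Words₃ X) :
    P.lastEval C (W ⊗ W') = tensorμ _ _ _ _ ≫ (P.lastEval C W ⊗ₘ P.lastEval C W') := by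
  have h₁ := P.evW_tensor C (join₂.obj W) (join₂.obj W')
  have h₂ : (tpow (P.coan C)).map (joinHeads (W ⊗ W')) =
      (tpow (P.coan C)).map (joinHeads W) ⊗ₘ (tpow (P.coan C)).map (joinHeads W') := by
    rw [joinHeads_tensor]
    exact lift_map_tensorHom _ _ _
  unfold lastEval
  rw [h₂]
  exact (congrArg (fun t => _ ≫ t) h₁).trans (tensorμ_comp _ _ _ _)

/-- The tests for tensor words of representative elements. -/
noncomputable def wordProbe (w : Words X) : Probe.{u} ((tpow (P.coan C)).obj w) where
  S := Decoration w
  R := Refinement w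
  base r := r.toDecoration
  x s := (tens P.ops).obj s.word
  h s := (tpow (P.coan C)).obj (join.obj s.word)
  y r := (tens P.ops).obj (join₂.obj r.refined)
  k r := (tpow C).obj (join.obj (join₂.obj r.refined))
  test r := (((tens P.ops).map r.toHeads ⊗ₘ 𝟙 _) ⊗ₘ
    (tpow (P.coan C)).map (r.hom ≫ head.map r.toHeads)) ≫ P.compEval C r.refined
  value r := _ ◁ (tpow (P.coan C)).map (join.map r.toHeads) ≫ P.lastEval C r.refined

variable {C} in
theorem wordProbe_test_tensor {w w' : Words X} (r : Refinement w) (r' : Refinement w') :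
    (P.wordProbe C (w ⊗ w')).test ⟨⟨r.word ⊗ r'.word, r.hom ⊗ₘ r'.hom⟩,
      r.refined ⊗ r'.refined, r.toHeads ⊗ₘ r'.toHeads⟩ =
      tensorTest ((P.wordProbe C w).test r) ((P.wordProbe C w').test r') := by
  have h₁ := P.compEval_tensor C r.refined r'.refined
  have h₂ : (tpow (P.coan C)).map ((r.hom ⊗ₘ r'.hom) ≫ head.map (r.toHeads ⊗ₘ r'.toHeads)) =
      (tpow (P.coan C)).map (r.hom ≫ head.map r.toHeads) ⊗ₘ
        (tpow (P.coan C)).map (r'.hom ≫ head.map r'.toHeads) := by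
    exact lift_map_comp (lift_map_tensorHom _ _ _)
  have h₃ : (tens P.ops).map (r.toHeads ⊗ₘ r'.toHeads) =
      (tens P.ops).map r.toHeads ⊗ₘ (tens P.ops).map r'.toHeads := lift_map_tensorHom _ _ _
  have h₄ : (𝟙 ((tens P.ops).obj (join₂.obj r.refined) ⊗ (tens P.ops).obj (join₂.obj r'.refined))) =
    𝟙 _ ⊗ₘ 𝟙 _ := (id_tensorHom_id _ _).symm
  refine Eq.trans ?_ (tensorTest_natural _ _ _ _ _ _ _ _).symm
  exact congrArg₂ (fun s t => s ≫ t) (congrArg₂ (fun s t => s ⊗ₘ t)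
    (congrArg₂ (fun s t => s ⊗ₘ t) h₃ h₄) h₂) h₁

variable {C} in
theorem wordProbe_value_tensor {w w' : Words X} (r : Refinement w) (r' : Refinement w') :
    (P.wordProbe C (w ⊗ w')).value ⟨⟨r.word ⊗ r'.word, r.hom ⊗ₘ r'.hom⟩,
      r.refined ⊗ r'.refined, r.toHeads ⊗ₘ r'.toHeads⟩ =
      tensorμ _ _ _ _ ≫ ((P.wordProbe C w).value r ⊗ₘ (P.wordProbe C w').value r') := by
  have h₁ := P.lastEval_tensor C r.refined r'.refined
  have h₂ : (tpow (P.coan C)).map (join.map (r.toHeads ⊗ₘ r'.toHeads)) =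
      (tpow (P.coan C)).map (join.map r.toHeads) ⊗ₘ
        (tpow (P.coan C)).map (join.map r'.toHeads) :=
    (congrArg _ (lift_map_tensorHom _ _ _)).trans (lift_map_tensorHom _ _ _)
  exact (congrArg₂ (fun s t => _ ◁ s ≫ t) h₂ h₁).trans (tensorμ_comp _ _ _ _)

/-- Restricts to concatenated decorations. Not every decoration of `w ⊗ w'` need be one, but these
suffice for detection. -/
theorem compat_tensor {w w' : Words X} {t : V}
    {f : t ⟶ (tpow (P.coan C)).obj w ⊗ (tpow (P.coan C)).obj w'}
    {u : ∀ s, (P.wordProbe C (w ⊗ w')).x s ⊗ t ⟶ (P.wordProbe C (w ⊗ w')).h s}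
    (h : (P.wordProbe C (w ⊗ w')).Compat f u) :
    ((P.wordProbe C w).tensor (P.wordProbe C w')).Compat f
      (fun s => u ⟨s.1.word ⊗ s.2.word, s.1.hom ⊗ₘ s.2.hom⟩) := by
  rintro ⟨r, r'⟩
  refine (congrArg (fun s => _ ≫ s) (P.wordProbe_test_tensor r r')).symm.trans
    ((h ⟨⟨r.word ⊗ r'.word, r.hom ⊗ₘ r'.hom⟩,
      r.refined ⊗ r'.refined, r.toHeads ⊗ₘ r'.toHeads⟩).trans ?_)
  exact congrArg (fun s => applyTwice _ s) (P.wordProbe_value_tensor r r')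

theorem compEval_letter (x : X) (W : Words₂ X) :
    P.compEval C (incl.obj (Discrete.mk x, W)) =
      P.opComp x W ▷ P.coan C x ≫ NatHom.ev (P.ops x) (tpow C) (join.obj W) := by
  refine Eq.trans (b := (P.opComp x W ⊗ₘ 𝟙 (P.coan C x)) ≫
    NatHom.ev (P.ops x) (tpow C) (join.obj W) ≫ 𝟙 _) rfl ?_
  rw [Category.comp_id, tensorHom_id]

theorem lastEval_letter (x : X) (W : Words₂ X) :
    P.lastEval C (incl.obj (Discrete.mk x, W)) = P.evW C W := by
  refine Eq.trans (b := _ ◁ 𝟙 ((tpow (P.coan C)).obj (head.obj W)) ≫ P.evW C W) rfl ?_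
  exact whiskerLeft_id_comp (a := (tens P.ops).obj W) (P.evW C W)

/-- The words of operations separate the tensor powers of `P^∧(C)`. -/
theorem separating_evW [HasSlices V] (w : Words X) :
    Separating (a := (tpow (P.coan C)).obj w) (fun s : Decoration w =>
      (tens P.ops).obj s.word ◁ (tpow (P.coan C)).map s.hom ≫ P.evW C s.word) := by
  induction w with
  | of x =>
    intro t f g h
    -- The one-letter word `(x, z)` evaluates at `P(z;x)`, and the evaluations for all `z` determine
    -- a map into the end.
    refine NatHom.hom_ext (F := P.ops x.as) (G := tpow C) fun z => ?_
    have e := whiskerLeft_id_comp (NatHom.ev (P.ops x.as) (tpow C) z)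
    exact (congrArg (fun s => _ ◁ f ≫ s) e).symm.trans
      ((h ⟨incl.obj (x, z), 𝟙 _⟩).trans (congrArg (fun s => _ ◁ g ≫ s) e))
  | unit =>
    intro t f g h
    have e : (𝟙_ V) ◁ 𝟙 (𝟙_ V) ≫ P.evW C (𝟙_ (Words₂ X)) = (λ_ (𝟙_ V)).hom :=
      (whiskerLeft_id_comp (a := 𝟙_ V) (b := 𝟙_ V) _).trans (P.evW_unit C)
    exact unit_separates ((congrArg (fun s => _ ◁ f ≫ s) e).symm.trans
      ((h ⟨𝟙_ _, 𝟙 _⟩).trans (congrArg (fun s => _ ◁ g ≫ s) e)))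
  | tensor a b iha ihb =>
    intro t f g h
    refine (iha.tensor ihb) f g fun r => ?_
    have e : _ ◁ (tpow (P.coan C)).map (r.1.hom ⊗ₘ r.2.hom) ≫
        P.evW C (r.1.word ⊗ r.2.word) = _ :=
      (congrArg₂ (fun s t => _ ◁ s ≫ t) (lift_map_tensorHom _ _ _)
        (P.evW_tensor C r.1.word r.2.word)).trans (tensorμ_comp _ _ _ _)
    exact (congrArg (fun s => _ ◁ f ≫ s) e).symm.trans
      ((h ⟨r.1.word ⊗ r.2.word, r.1.hom ⊗ₘ r.2.hom⟩).trans (congrArg (fun s => _ ◁ g ≫ s) e))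

theorem wordProbe_test_id (W : Words₃ X) :
    (P.wordProbe C (head.obj (heads.obj W))).test ⟨⟨heads.obj W, 𝟙 _⟩, W, 𝟙 _⟩ =
      P.compEval C W := by
  refine Eq.trans (b := ((𝟙 _ ⊗ₘ 𝟙 _) ⊗ₘ (𝟙 _ ≫ 𝟙 _)) ≫ P.compEval C W) rfl ?_
  rw [Category.comp_id, id_tensorHom_id, id_tensorHom_id, Category.id_comp]

theorem compEval_unit :
    P.compEval C (𝟙_ (Words₃ X)) = (λ_ (𝟙_ V)).hom ▷ 𝟙_ V ≫ (λ_ (𝟙_ V)).hom := by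
  have h₁ : innerComp P.ops P.comp (𝟙_ (Words₃ X)) = (λ_ (𝟙_ V)).hom := innerComp_unit _ _
  have h₂ : (tpow (P.coan C)).map (headHeads (𝟙_ (Words₃ X))) = 𝟙 (𝟙_ V) := by
    rw [headHeads_unit]
    rfl
  have h₃ : (tpow C).map (joinJoins (𝟙_ (Words₃ X))) = 𝟙 (𝟙_ V) := by
    rw [joinJoins_unit]
    rfl
  exact (congrArg₂ (fun s t => s ≫ t) (congrArg₂ (fun s t => s ⊗ₘ t) h₁ h₂)
    (congrArg₂ (fun s t => s ≫ t) (P.evW_unit C) h₃)).trans (tensorHom_id_comp_id _ _)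

/-- Restricting to composite operations loses nothing, because the operad has units; longer words
follow by `Separating.tensor`. -/
theorem separating_test [HasSlices V] (w : Words X) : Separating (P.wordProbe C w).test := by
  induction w with
  | of x =>
    obtain ⟨x⟩ := x
    intro t f g h
    refine NatHom.hom_ext (F := P.ops x) (G := tpow C) fun z => ?_
    have e := (P.wordProbe_test_id C (incl.obj (Discrete.mk x, incl.obj (Discrete.mk x, z)))).trans
      (P.compEval_letter C x (incl.obj (Discrete.mk x, z)))
    -- The letter `x` is decorated by `x` and refined by `z`. The composites tested are `o ∘ p` with
    -- `o` in `P(x;x)`, among them `1 ∘ p = p`.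
    have h' := (congrArg (fun s => _ ◁ f ≫ s) e).symm.trans
      ((h ⟨⟨incl.obj (Discrete.mk x, letter x), 𝟙 _⟩,
        incl.obj (Discrete.mk x, incl.obj (Discrete.mk x, z)), 𝟙 _⟩).trans
          (congrArg (fun s => _ ◁ g ≫ s) e))
    exact unit_comp_separates (P.one_comp x z) h'
  | unit =>
    intro t f g h
    have e := (P.wordProbe_test_id C (𝟙_ _)).trans (P.compEval_unit C)
    have h' : (_ ⊗ _) ◁ f ≫ _ = (_ ⊗ _) ◁ g ≫ _ := (congrArg (fun s => _ ◁ f ≫ s) e).symm.trans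
      ((h ⟨⟨𝟙_ _, 𝟙 _⟩, 𝟙_ _, 𝟙 _⟩).trans (congrArg (fun s => _ ◁ g ≫ s) e))
    exact unit_separates (unit_comp_separates (η := 𝟙 _)
      ((Category.assoc _ _ _).symm.trans ((congrArg (fun s => s ≫ _) (by simp)).trans
        (λ_ (𝟙_ V)).inv_hom_id)) h')
  | tensor a b iha ihb =>
    intro t f g h
    refine (iha.tensor ihb) f g fun r => ?_
    have e := P.wordProbe_test_tensor (C := C) r.1 r.2
    exact separating_tensor_aux ((congrArg (fun s => _ ◁ f ≫ s) e).symm.trans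
      ((h ⟨⟨r.1.word ⊗ r.2.word, r.1.hom ⊗ₘ r.2.hom⟩, r.1.refined ⊗ r.2.refined,
        r.1.toHeads ⊗ₘ r.2.toHeads⟩).trans (congrArg (fun s => _ ◁ g ≫ s) e)))

end ColoredOperad

end WordProbes

/-! ### Evaluations of representative elements -/

section

variable {V : Type w₂} [Category.{w} V] [MonoidalCategory V]

theorem diag_aux {o p g t t₁ t₂ : V} {r : t ⟶ t₁} {d : t₁ ⟶ t₂} {c : o ⟶ p} {e : p ⊗ t ⟶ g}
    {e₁ : p ⊗ t₁ ⟶ g} {e₂ : o ⊗ t₂ ⟶ g} (h₁ : o ◁ d ≫ e₂ = c ▷ t₁ ≫ e₁)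
    (h₂ : p ◁ r ≫ e₁ = e) : o ◁ (r ≫ d) ≫ e₂ = c ▷ t ≫ e := by
  rw [MonoidalCategory.whiskerLeft_comp, Category.assoc, h₁, whisker_exchange_assoc, h₂]

theorem alpha_aux {x t a a' b g : V} {f : t ⟶ a} {f' : t ⟶ a'} {α : a ⟶ b} {α' : a' ⟶ b}
    {e : x ⊗ b ⟶ g} (h : f ≫ α = f' ≫ α') : x ◁ f ≫ x ◁ α ≫ e = x ◁ f' ≫ x ◁ α' ≫ e := by
  rw [← MonoidalCategory.whiskerLeft_comp_assoc, h, MonoidalCategory.whiskerLeft_comp_assoc]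

theorem whisker_cancel_aux {y a b c d g : V} {u u' : a ⟶ b} {i : b ⟶ c} {m : a ⟶ d}
    {v v' : d ⟶ c} {e : y ⊗ c ⟶ g} (h : u ≫ i = m ≫ v) (h' : u' ≫ i = m ≫ v')
    (h'' : y ◁ v ≫ e = y ◁ v' ≫ e) : y ◁ u ≫ y ◁ i ≫ e = y ◁ u' ≫ y ◁ i ≫ e := by
  rw [← MonoidalCategory.whiskerLeft_comp_assoc, h, ← MonoidalCategory.whiskerLeft_comp_assoc, h',
    MonoidalCategory.whiskerLeft_comp_assoc, h'', MonoidalCategory.whiskerLeft_comp_assoc]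

end

section

variable {V : Type w₂} [Category.{w} V] [MonoidalCategory V] [SymmetricCategory V]

theorem applyTwice_cancel {x y t h k : V} {u u' : x ⊗ t ⟶ h} {η : y ⊗ h ⟶ k}
    (h : applyTwice u η = applyTwice u' η) : y ◁ u ≫ η = y ◁ u' ≫ η := by
  simpa only [applyTwice, cancel_epi] using h

theorem whisker_left_eq_applyTwice {x y t h k : V} (u : x ⊗ t ⟶ h) (η : y ⊗ h ⟶ k) :
    y ◁ u ≫ η = (α_ y x t).inv ≫ (β_ y x).hom ▷ t ≫ applyTwice u η := by
  rw [applyTwice, ← comp_whiskerRight_assoc, SymmetricCategory.symmetry, id_whiskerRight,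
    Category.id_comp, Iso.inv_hom_id_assoc]

theorem applyTwice_comp {x y t h h' k : V} (u : x ⊗ t ⟶ h) (a : h ⟶ h') (η : y ⊗ h' ⟶ k) :
    applyTwice (u ≫ a) η = applyTwice u (y ◁ a ≫ η) := by
  simp [applyTwice]

theorem whiskerRight_applyTwice {x x' y t h k : V} (f : x' ⟶ x) (u : x ⊗ t ⟶ h)
    (η : y ⊗ h ⟶ k) :
    (f ▷ y) ▷ t ≫ applyTwice u η = applyTwice (f ▷ t ≫ u) η := by
  simp only [applyTwice, MonoidalCategory.whiskerLeft_comp, Category.assoc]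
  rw [← comp_whiskerRight_assoc, BraidedCategory.braiding_naturality_left,
    comp_whiskerRight_assoc, associator_naturality_middle_assoc]

/-- Both composites permute `x, y, p` into `p, x, y`; the first also swaps `x` and `y` and back
again. -/
theorem braid_assoc_swap (x y p : V) :
    (β_ x y).hom ▷ p ≫ (α_ y x p).hom ≫ y ◁ (β_ x p).hom ≫ (β_ y (p ⊗ x)).hom =
      (β_ (x ⊗ y) p).hom ≫ (α_ p x y).inv := by
  have h₁ : (β_ y (p ⊗ x)).hom = (α_ y p x).inv ≫ (β_ y p).hom ▷ x ≫ (α_ p y x).hom ≫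
      p ◁ (β_ y x).hom ≫ (α_ p x y).inv := by simp
  have h₂ : (α_ y x p).hom ≫ y ◁ (β_ x p).hom ≫ (α_ y p x).inv ≫ (β_ y p).hom ▷ x ≫
      (α_ p y x).hom = (β_ (y ⊗ x) p).hom := by simp
  rw [h₁, reassoc_of% h₂, ← BraidedCategory.braiding_naturality_left_assoc,
    ← comp_whiskerRight_assoc, SymmetricCategory.symmetry, id_whiskerRight, Category.id_comp]

/-- Compatibility of two-step evaluations, from associativity of compositions. -/
theorem compat_of_assoc {x y j q pw pj p₂ mj m₂ mw aw aj aW a₂ cj c₂ : V} {dj : pj ⊗ q ⟶ aj}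
    {ej : j ⊗ aj ⟶ cj} {oj : pj ⊗ j ⟶ mj} {xj : mj ⊗ q ⟶ cj} {d₂ : p₂ ⊗ q ⟶ a₂}
    {e₂ : y ⊗ a₂ ⟶ c₂} {o₂ : p₂ ⊗ y ⟶ m₂} {x₂ : m₂ ⊗ q ⟶ c₂} {dw : pw ⊗ q ⟶ aw}
    {f : pw ⟶ pj} {i : aw ⟶ aj} {l : cj ⟶ c₂} {l' : mj ⟶ m₂} {dW : mw ⊗ q ⟶ aW}
    {b : mw ⟶ p₂} {i₂ : aW ⟶ a₂} {ow : pw ⊗ x ⟶ mw} {n : x ⊗ y ⟶ j}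
    (hj : j ◁ dj ≫ ej = (α_ _ _ _).inv ≫ (β_ j pj).hom ▷ q ≫ oj ▷ q ≫ xj)
    (h₂ : y ◁ d₂ ≫ e₂ = (α_ _ _ _).inv ≫ (β_ y p₂).hom ▷ q ≫ o₂ ▷ q ≫ x₂)
    (hf : f ▷ q ≫ dj = dw ≫ i) (hx : xj ≫ l = l' ▷ q ≫ x₂) (hb : b ▷ q ≫ d₂ = dW ≫ i₂)
    (ha : (f ⊗ₘ n) ≫ oj ≫ l' = (α_ _ _ _).inv ≫ (ow ≫ b) ▷ y ≫ o₂) :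
    (x ⊗ y) ◁ dw ≫ (n ⊗ₘ i) ≫ ej ≫ l =
      applyTwice ((α_ x pw q).inv ≫ (β_ x pw).hom ▷ q ≫ ow ▷ q ≫ dW) (y ◁ i₂ ≫ e₂) := by
  -- Each side is brought to the form `x₂` applied to a map into `m₂`, that is, to one evaluation at
  -- one total composite. The two bracketings of that composite agree by `ha`.
  have e₁ : (x ⊗ y) ◁ dw ≫ (n ⊗ₘ i) ≫ ej ≫ l = (α_ (x ⊗ y) pw q).inv ≫
      ((β_ (x ⊗ y) pw).hom ≫ (f ⊗ₘ n) ≫ oj ≫ l') ▷ q ≫ x₂ := by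
    have : (x ⊗ y) ◁ dw ≫ (n ⊗ₘ i) = (n ⊗ₘ (f ▷ q)) ≫ j ◁ dj := by
      rw [← id_tensorHom, ← id_tensorHom, tensorHom_comp_tensorHom, tensorHom_comp_tensorHom, hf,
        Category.id_comp, Category.comp_id]
    rw [reassoc_of% this, reassoc_of% hj, hx, ← tensorHom_id f, associator_inv_naturality_assoc,
      tensorHom_id, ← comp_whiskerRight_assoc (n ⊗ₘ f), BraidedCategory.braiding_naturality]
    simp only [comp_whiskerRight, Category.assoc]
  have e₂ : applyTwice ((α_ x pw q).inv ≫ (β_ x pw).hom ▷ q ≫ ow ▷ q ≫ dW) (y ◁ i₂ ≫ e₂) =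
      (α_ (x ⊗ y) pw q).inv ≫ ((β_ x y).hom ▷ pw ≫ (α_ y x pw).hom ≫
        y ◁ (β_ x pw).hom ≫ y ◁ (ow ≫ b) ≫ (β_ y p₂).hom ≫ o₂) ▷ q ≫ x₂ := by
    rw [← applyTwice_comp]
    simp only [Category.assoc]
    rw [← hb]
    simp only [applyTwice, MonoidalCategory.whiskerLeft_comp, Category.assoc]
    rw [h₂]
    monoidal
  rw [e₁, e₂, ha, BraidedCategory.braiding_naturality_right_assoc, reassoc_of% braid_assoc_swap]

end

section Coalgebras

open FreeSymm

variable {X : Type u} {V : Type (u + 1)} [Category.{u} V] [MonoidalCategory V]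
  [SymmetricCategory V] [MonoidalClosed V] [HasLimits V]

instance mono_tpowMap [HasSlices V] {C D : X → V} (f : ∀ x, C x ⟶ D x) [∀ x, Mono (f x)]
    (w : Words X) : Mono ((tpowMap f).app w) := by
  induction w with
  | of x => exact inferInstanceAs (Mono (f x.as))
  | unit =>
    have h : (tpowMap f).app (𝟙_ (Words X)) = 𝟙 (𝟙_ V) := tpowMap_unit f
    change Mono ((tpowMap f).app (𝟙_ (Words X)))
    exact (congrArg (fun f : 𝟙_ V ⟶ 𝟙_ V => Mono f) h).mpr inferInstance
  | tensor a b iha ihb =>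
    have h := tpowMap_tensor f a b
    change Mono ((tpowMap f).app (a ⊗ b))
    rw [h]
    exact mono_tensorHom _ _

namespace ColoredOperad

variable (P : ColoredOperad X V) (C : X → V)

theorem alpha_ev (y : X) (W : Words₂ X) :
    ((P.ops y).obj (head.obj W) ⊗ (tens P.ops).obj W) ◁ P.alpha C y ≫
        NatHom.ev (ptensor (head ⋙ P.ops y) (tens P.ops)) (join ⋙ tpow C) W =
      applyTwice (NatHom.ev (P.ops y) (tpow (P.coan C)) (head.obj W)) (P.evW C W) :=
  NatHom.contract_ev head (P.ops y) (tpow (P.coan C)) (tens P.ops) (join ⋙ tpow C) (P.evWord C) W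

theorem diag_ev (y : X) (W : Words₂ X) :
    ((P.ops y).obj (head.obj W) ⊗ (tens P.ops).obj W) ◁ P.diag C y ≫
        NatHom.ev (ptensor (head ⋙ P.ops y) (tens P.ops)) (join ⋙ tpow C) W =
      P.opComp y W ▷ P.coan C y ≫ NatHom.ev (P.ops y) (tpow C) (join.obj W) := by
  have h₁ := NatHom.pre_ev (G := join ⋙ tpow C) (P.comp y) W
  have h₂ := NatHom.restrict_ev (F := P.ops y) (G := tpow C) join W
  exact diag_aux h₁ h₂

/-- An element of `P^∧(P^∧(C))` is determined by its values in `P^∧(C)^{⊗w}`, and these by their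
evaluations at words of operations, which is exactly what `α` records. -/
theorem eq_of_comp_alpha [HasSlices V] {t : V} {y : X} {f g : t ⟶ P.coan (P.coan C) y}
    (h : f ≫ P.alpha C y = g ≫ P.alpha C y) : f = g := by
  refine NatHom.hom_ext fun w => P.separating_evW C w _ _ fun s => ?_
  -- `α` is evaluated only at words of the form `head W`; naturality along `w ⟶ head s.word` reduces
  -- a general `w` to that case.
  have key : ∀ f : t ⟶ P.coan (P.coan C) y,
      ((P.ops y).obj w ◁ f ≫ NatHom.ev (P.ops y) (tpow (P.coan C)) w) ≫
        (tpow (P.coan C)).map s.hom = (P.ops y).map s.hom ▷ t ≫ (P.ops y).obj _ ◁ f ≫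
          NatHom.ev (P.ops y) (tpow (P.coan C)) _ := fun f => by
    rw [Category.assoc, ← NatHom.ev_natural, whisker_exchange_assoc]
  have h' : ∀ f : t ⟶ P.coan (P.coan C) y, _ := fun f =>
    (whiskerLeft_applyTwice f (NatHom.ev (P.ops y) (tpow (P.coan C)) (head.obj s.word))
      (P.evW C s.word)).symm.trans ((congrArg (fun k => _ ◁ f ≫ k)
        (P.alpha_ev C y s.word)).symm)
  have h'' := applyTwice_cancel ((h' f).trans ((alpha_aux h).trans (h' g).symm))
  exact whisker_cancel_aux (key f) (key g) h''

/-- `χ₁` is the base change of the monomorphism `α` along `Δ`. -/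
instance mono_chi [HasSlices V] (y : X) : Mono (P.chi C y) := by
  have : Mono (P.alpha C y) := ⟨fun _ _ h => P.eq_of_comp_alpha C h⟩
  exact pullback.fst_of_mono

theorem chi_diag (y : X) : P.chi C y ≫ P.diag C y = P.delta₁ C y ≫ P.alpha C y :=
  pullback.condition

/-- Values of representative elements. -/
noncomputable def chiEv (y : X) (w : Words X) :
    (P.ops y).obj w ⊗ P.Q₁ C y ⟶ (tpow C).obj w :=
  (P.ops y).obj w ◁ P.chi C y ≫ NatHom.ev (P.ops y) (tpow C) w

/-- Values of the diagonal of representative elements. -/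
noncomputable def deltaEv (y : X) (w : Words X) :
    (P.ops y).obj w ⊗ P.Q₁ C y ⟶ (tpow (P.coan C)).obj w :=
  (P.ops y).obj w ◁ P.delta₁ C y ≫ NatHom.ev (P.ops y) (tpow (P.coan C)) w

variable {C}

theorem chiEv_natural (y : X) {w w' : Words X} (f : w ⟶ w') :
    (P.ops y).map f ▷ P.Q₁ C y ≫ P.chiEv C y w' = P.chiEv C y w ≫ (tpow C).map f := by
  rw [chiEv, chiEv, Category.assoc, ← NatHom.ev_natural, whisker_exchange_assoc]

theorem deltaEv_natural (y : X) {w w' : Words X} (f : w ⟶ w') :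
    (P.ops y).map f ▷ P.Q₁ C y ≫ P.deltaEv C y w' =
      P.deltaEv C y w ≫ (tpow (P.coan C)).map f := by
  rw [deltaEv, deltaEv, Category.assoc, ← NatHom.ev_natural, whisker_exchange_assoc]

/-- The equation of the fibre product, evaluated at `W`: `δ₁(c)(p)` evaluated at the word of
operations `q` is `χ₁(c)(p ∘ q)`. -/
theorem deltaEv_evW' (y : X) (W : Words₂ X) :
    applyTwice (P.deltaEv C y (head.obj W)) (P.evW C W) =
      P.opComp y W ▷ P.Q₁ C y ≫ P.chiEv C y (join.obj W) := by
  have h₁ := whiskerLeft_applyTwice (P.delta₁ C y)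
    (NatHom.ev (P.ops y) (tpow (P.coan C)) (head.obj W)) (P.evW C W)
  rw [← P.alpha_ev C y W] at h₁
  refine h₁.symm.trans ((alpha_aux (P.chi_diag C y)).symm.trans ?_)
  refine (congrArg (fun k => _ ◁ P.chi C y ≫ k) (P.diag_ev C y W)).trans ?_
  rw [chiEv, whisker_exchange_assoc]

theorem deltaEv_evW (y : X) (W : Words₂ X) :
    (tens P.ops).obj W ◁ P.deltaEv C y (head.obj W) ≫ P.evW C W =
      (α_ _ _ _).inv ≫ (β_ ((tens P.ops).obj W) ((P.ops y).obj (head.obj W))).hom ▷ P.Q₁ C y ≫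
        P.opComp y W ▷ P.Q₁ C y ≫ P.chiEv C y (join.obj W) := by
  rw [← deltaEv_evW', whisker_left_eq_applyTwice]

end ColoredOperad

end Coalgebras

/-! ### Detection of representative elements -/

section

variable {V : Type w₂} [Category.{w} V] [MonoidalCategory V]

theorem letter_test_aux {p p' o a g c : V} {m : p ⟶ p'} {e : p' ⊗ o ⟶ g} {l : g ⊗ a ⟶ c} :
    (((𝟙 p ≫ m) ⊗ₘ 𝟙 o) ⊗ₘ (𝟙 a ≫ 𝟙 a)) ≫ e ▷ a ≫ l = (m ▷ o) ▷ a ≫ e ▷ a ≫ l := by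
  simp

theorem compat_letter_aux {p o t a a' g c : V} {f : t ⟶ a} {b : t ⟶ a'} {d : a ⟶ g} {α : a' ⟶ g}
    {e : (p ⊗ o) ⊗ g ⟶ c} {ed : (p ⊗ o) ⊗ a ⟶ c} {eα : (p ⊗ o) ⊗ a' ⟶ c}
    (hd : (p ⊗ o) ◁ d ≫ e = ed) (hα : (p ⊗ o) ◁ α ≫ e = eα)
    (h : (p ⊗ o) ◁ f ≫ ed = (p ⊗ o) ◁ b ≫ eα) :
    (p ⊗ o) ◁ (f ≫ d) ≫ e = (p ⊗ o) ◁ (b ≫ α) ≫ e := by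
  simp only [MonoidalCategory.whiskerLeft_comp, Category.assoc, hd, hα, h]

/-- `h₁` is naturality for the second morphism and `h₂` for the composite, both after evaluation;
comparing them gives naturality for the first. -/
theorem letter_natural_aux₂ {p p' p'' o t h h' h'' c : V} {m : p ⟶ p'} {m' : p' ⟶ p''}
    {m'' : p ⟶ p''} {φ : p ⊗ t ⟶ h} {φ' : p' ⊗ t ⟶ h'} {φ'' : p'' ⊗ t ⟶ h''} {e : o ⊗ h'' ⟶ c}
    {i : h ⟶ h'} {i' : h' ⟶ h''} {i'' : h ⟶ h''} (hm : m'' = m ≫ m') (hi : i'' = i ≫ i')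
    (h₁ : o ◁ (m' ▷ t ≫ φ'') ≫ e = o ◁ (φ' ≫ i') ≫ e)
    (h₂ : o ◁ (m'' ▷ t ≫ φ'') ≫ e = o ◁ (φ ≫ i'') ≫ e) :
    o ◁ (m ▷ t ≫ φ') ≫ o ◁ i' ≫ e = o ◁ (φ ≫ i) ≫ o ◁ i' ≫ e := by
  subst hm hi
  simp only [MonoidalCategory.whiskerLeft_comp, Category.assoc, comp_whiskerRight] at h₁ h₂ ⊢
  rw [← h₁, h₂]

end

section

variable {V : Type w₂} [Category.{w} V] [MonoidalCategory V] [SymmetricCategory V]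

theorem letter_id_aux {p o t h a c : V} {m : p ⟶ p} {φ : p ⊗ t ⟶ h} {e : o ⊗ h ⟶ c}
    {i : h ⟶ h} {f : t ⟶ a}
    {n : (p ⊗ o) ⊗ a ⟶ c} (hm : m = 𝟙 p) (hi : i = 𝟙 h)
    (h₁ : (p ⊗ o) ◁ f ≫ (m ▷ o) ▷ a ≫ n = applyTwice φ (o ◁ i ≫ e)) :
    (p ⊗ o) ◁ f ≫ n = applyTwice φ e := by
  subst hm hi
  simpa using h₁

theorem letter_natural_aux {p p' o t h h' g a c : V} {m : p ⟶ p'} {φ : p ⊗ t ⟶ h}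
    {φ' : p' ⊗ t ⟶ h'} {e : o ⊗ h' ⟶ c} {i : h ⟶ h'} {f : t ⟶ a} {n : p' ⊗ o ⟶ g}
    {l : g ⊗ a ⟶ c}
    (h₁ : (p ⊗ o) ◁ f ≫ (m ▷ o) ▷ a ≫ n ▷ a ≫ l = applyTwice φ (o ◁ i ≫ e))
    (h₂ : (p' ⊗ o) ◁ f ≫ n ▷ a ≫ l = applyTwice φ' e) :
    o ◁ (m ▷ t ≫ φ') ≫ e = o ◁ (φ ≫ i) ≫ e := by
  apply applyTwice_cancel
  rw [applyTwice_comp φ i, ← h₁, ← whiskerRight_applyTwice, ← h₂, whisker_exchange_assoc (m ▷ o)]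

end

section Detection

open FreeSymm

variable {X : Type u} {V : Type (u + 1)} [Category.{u} V] [MonoidalCategory V]
  [SymmetricCategory V] [MonoidalClosed V] [HasLimits V]

namespace ColoredOperad

variable (P : ColoredOperad X V) (C : X → V)

/-- Decorations of one-letter words. -/
abbrev letterDecoration (x : X) (z : Words X) : Decoration (letter x) :=
  ⟨incl.obj (Discrete.mk x, z), 𝟙 _⟩

/-- Refined decorations of one-letter words. -/
abbrev letterRefinement (x : X) {z : Words X} {W : Words₂ X} (σ : z ⟶ head.obj W) :
    Refinement (letter x) :=
  { letterDecoration x z with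
    refined := incl.obj (Discrete.mk x, W)
    toHeads := incl.map (X := (Discrete.mk x, z)) (Y := (Discrete.mk x, head.obj W)) (𝟙 _, σ) }

theorem wordProbe_test_letter (x : X) {z : Words X} {W : Words₂ X} (σ : z ⟶ head.obj W) :
    (P.wordProbe C (letter x)).test (letterRefinement x σ) =
      ((P.ops x).map σ ▷ (tens P.ops).obj W) ▷ P.coan C x ≫
        P.opComp x W ▷ P.coan C x ≫ NatHom.ev (P.ops x) (tpow C) (join.obj W) := by
  refine Eq.trans (b := (((𝟙 _ ≫ (P.ops x).map σ) ⊗ₘ 𝟙 _) ⊗ₘ (𝟙 _ ≫ 𝟙 _)) ≫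
    P.compEval C (incl.obj (Discrete.mk x, W))) rfl ?_
  exact (congrArg (fun s => _ ≫ s) (P.compEval_letter C x W)).trans letter_test_aux

theorem wordProbe_value_letter (x : X) {z : Words X} {W : Words₂ X} (σ : z ⟶ head.obj W) :
    (P.wordProbe C (letter x)).value (letterRefinement x σ) =
      (tens P.ops).obj W ◁ (tpow (P.coan C)).map σ ≫ P.evW C W :=
  congrArg (fun s => _ ≫ s) (P.lastEval_letter C x W)

theorem compat_letter {x : X} {t : V} {f : t ⟶ P.coan C x}
    {u : ∀ s, (P.wordProbe C (letter x)).x s ⊗ t ⟶ (P.wordProbe C (letter x)).h s}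
    (h : (P.wordProbe C (letter x)).Compat f u) {z : Words X} {W : Words₂ X}
    (σ : z ⟶ head.obj W) :
    ((P.ops x).obj z ⊗ (tens P.ops).obj W) ◁ f ≫ ((P.ops x).map σ ▷ (tens P.ops).obj W) ▷
      P.coan C x ≫ P.opComp x W ▷ P.coan C x ≫ NatHom.ev (P.ops x) (tpow C) (join.obj W) =
      applyTwice (u (letterDecoration x z))
        ((tens P.ops).obj W ◁ (tpow (P.coan C)).map σ ≫ P.evW C W) :=
  (congrArg (fun s => _ ≫ s) (P.wordProbe_test_letter C x σ)).symm.trans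
    ((h (letterRefinement x σ)).trans
      (congrArg (fun s => applyTwice _ s) (P.wordProbe_value_letter C x σ)))

theorem compat_letter_id {x : X} {t : V} {f : t ⟶ P.coan C x}
    {u : ∀ s, (P.wordProbe C (letter x)).x s ⊗ t ⟶ (P.wordProbe C (letter x)).h s}
    (h : (P.wordProbe C (letter x)).Compat f u) (W : Words₂ X) :
    ((P.ops x).obj (head.obj W) ⊗ (tens P.ops).obj W) ◁ f ≫
      P.opComp x W ▷ P.coan C x ≫ NatHom.ev (P.ops x) (tpow C) (join.obj W) =
      applyTwice (u (letterDecoration x (head.obj W))) (P.evW C W) := by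
  have h' := P.compat_letter C h (𝟙 (head.obj W))
  exact letter_id_aux ((P.ops x).map_id _) ((tpow (P.coan C)).map_id _) h'

/-- Compatibility does not ask `u` to be natural, but forces it: refinements carry a morphism `σ`,
so naturality holds after evaluation, and evaluations separate by `separating_evW`. -/
theorem compat_letter_natural [HasSlices V] {x : X} {t : V} {f : t ⟶ P.coan C x}
    {u : ∀ s, (P.wordProbe C (letter x)).x s ⊗ t ⟶ (P.wordProbe C (letter x)).h s}
    (h : (P.wordProbe C (letter x)).Compat f u) {z z' : Words X} (g : z ⟶ z') :
    (P.ops x).map g ▷ t ≫ u (letterDecoration x z') =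
      u (letterDecoration x z) ≫ (tpow (P.coan C)).map g := by
  have key : ∀ {z : Words X} {W : Words₂ X} (σ : z ⟶ head.obj W),
      (tens P.ops).obj W ◁ ((P.ops x).map σ ▷ t ≫ u (letterDecoration x (head.obj W))) ≫
        P.evW C W = (tens P.ops).obj W ◁ (u (letterDecoration x z) ≫
          (tpow (P.coan C)).map σ) ≫ P.evW C W :=
    fun {z W} σ => letter_natural_aux (P.compat_letter C h σ) (P.compat_letter_id C h W)
  refine P.separating_evW C z' _ _ fun s => ?_
  exact letter_natural_aux₂ ((P.ops x).map_comp g s.hom) ((tpow (P.coan C)).map_comp g s.hom)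
    (key s.hom) (key (g ≫ s.hom))

/-- Being natural, `u` assembles into a map `b` to `P^∧(P^∧(C))`. Compatibility then reads `Δ f = α
b`, so `f` and `b` define a map to the fibre product. -/
theorem detects_letter [HasSlices V] (x : X) :
    (P.wordProbe C (letter x)).Detects (q := P.Q₁ C x) (P.chi C x) := by
  intro t f u h
  have hn : ∀ {z z' : Words X} (g : z ⟶ z'), _ := fun g => P.compat_letter_natural C h g
  let b : t ⟶ P.coan (P.coan C) x := NatHom.lift (F := P.ops x) (G := tpow (P.coan C))
    (fun z => u (letterDecoration x z)) hn
  have hb : f ≫ P.diag C x = b ≫ P.alpha C x := by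
    refine NatHom.hom_ext fun W => ?_
    refine compat_letter_aux (P.diag_ev C x W) (P.alpha_ev C x W) ?_
    refine (P.compat_letter_id C h W).trans ((whiskerLeft_applyTwice _ _ _).trans ?_).symm
    exact congrArg (fun s => applyTwice s _) (NatHom.lift_ev (F := P.ops x)
      (G := tpow (P.coan C)) (fun z => u (letterDecoration x z)) hn (head.obj W))
  exact ⟨pullback.lift f b hb, pullback.lift_fst _ _ _⟩

/-- Tensor words of representative elements are detected by their values. -/
theorem detects_tpowMap [HasSlices V] (w : Words X) :
    (P.wordProbe C w).Detects ((tpowMap (P.chi C)).app w) := by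
  induction w with
  | of x => exact P.detects_letter C x.as
  | unit =>
    intro t f u h
    exact ⟨f, (congrArg (fun s => f ≫ s) (tpowMap_unit (P.chi C))).trans (Category.comp_id _)⟩
  | tensor a b iha ihb =>
    intro t f u h
    obtain ⟨f', hf'⟩ := (iha.tensor ihb (P.separating_test C a) (P.separating_test C b)) f _
      (P.compat_tensor C h)
    exact ⟨f', (congrArg (fun s => f' ≫ s) (tpowMap_tensor (P.chi C) a b)).trans hf'⟩

end ColoredOperad

end Detection

/-! ### Lifting the diagonal -/

section

variable {V : Type w₂} [Category.{w} V] [MonoidalCategory V]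

theorem assoc_natural_aux {x y j pw px ph pj mh mj m₂ mw th p₂ : V} {m : pw ⟶ px} {m' : px ⟶ ph}
    {m'' : pw ⟶ ph} {hh : ph ⟶ pj} {τ : x ⟶ th} {ic : th ⊗ y ⟶ j} {cj : pj ⊗ j ⟶ mj}
    {jj : mj ⟶ m₂} {ch : ph ⊗ th ⟶ mh} {jh : mh ⟶ p₂} {c₂ : p₂ ⊗ y ⟶ m₂} {cw : px ⊗ x ⟶ mw}
    {jτ : mw ⟶ mh} (hm : m'' = m ≫ m')
    (ha : (hh ⊗ₘ ic) ≫ cj ≫ jj = (α_ ph th y).inv ≫ (ch ≫ jh) ▷ y ≫ c₂)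
    (hn : (m' ⊗ₘ τ) ≫ ch = cw ≫ jτ) :
    ((m'' ≫ hh) ⊗ₘ (τ ▷ y ≫ ic)) ≫ cj ≫ jj =
      (α_ pw x y).inv ≫ ((m ▷ x ≫ cw) ≫ jτ ≫ jh) ▷ y ≫ c₂ := by
  subst hm
  have h₁ : ((m ≫ m') ⊗ₘ τ) ≫ ch = (m ▷ x ≫ cw) ≫ jτ := by
    rw [Category.assoc, ← hn, ← tensorHom_id, tensorHom_comp_tensorHom_assoc, Category.id_comp]
  rw [← tensorHom_comp_tensorHom_assoc, ha, ← tensorHom_id, associator_inv_naturality_assoc,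
    tensorHom_id, ← comp_whiskerRight_assoc, reassoc_of% h₁, Category.assoc]

variable [SymmetricCategory V]

/-- Reduces to `compat_of_assoc`: `ha` is associativity of the operad, `hn` the equivariance of its
composition, and `hi` to `hjh` are naturality of the evaluations. -/
theorem compat_of_operad_assoc {x y j q pw px ph pj p₂ mj m₂ mw mh th aw ah aj aW aH a₂ cj' c₂' : V}
    {dw : pw ⊗ q ⟶ aw} {dh : ph ⊗ q ⟶ ah} {dj : pj ⊗ q ⟶ aj} {d₂ : p₂ ⊗ q ⟶ a₂}
    {dW : mw ⊗ q ⟶ aW} {dH : mh ⊗ q ⟶ aH} {xj : mj ⊗ q ⟶ cj'} {x₂ : m₂ ⊗ q ⟶ c₂'}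
    {ej : j ⊗ aj ⟶ cj'} {e₂ : y ⊗ a₂ ⟶ c₂'} {m : pw ⟶ px} {m' : px ⟶ ph} {m'' : pw ⟶ ph}
    {hh : ph ⟶ pj} {τ : x ⟶ th} {ic : th ⊗ y ⟶ j} {cj : pj ⊗ j ⟶ mj} {jj : mj ⟶ m₂}
    {ch : ph ⊗ th ⟶ mh} {jh : mh ⟶ p₂} {c₂ : p₂ ⊗ y ⟶ m₂} {cw : px ⊗ x ⟶ mw} {jτ : mw ⟶ mh}
    {i : aw ⟶ ah} {i' : ah ⟶ aj} {l : cj' ⟶ c₂'} {iτ : aW ⟶ aH} {ih : aH ⟶ a₂}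
    (hj : j ◁ dj ≫ ej = (α_ _ _ _).inv ≫ (β_ j pj).hom ▷ q ≫ cj ▷ q ≫ xj)
    (h₂ : y ◁ d₂ ≫ e₂ = (α_ _ _ _).inv ≫ (β_ y p₂).hom ▷ q ≫ c₂ ▷ q ≫ x₂)
    (hm : m'' = m ≫ m')
    (ha : (hh ⊗ₘ ic) ≫ cj ≫ jj = (α_ ph th y).inv ≫ (ch ≫ jh) ▷ y ≫ c₂)
    (hn : (m' ⊗ₘ τ) ≫ ch = cw ≫ jτ) (hi : m'' ▷ q ≫ dh = dw ≫ i)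
    (hi' : hh ▷ q ≫ dj = dh ≫ i') (hl : jj ▷ q ≫ x₂ = xj ≫ l) (hτ : jτ ▷ q ≫ dH = dW ≫ iτ)
    (hjh : jh ▷ q ≫ d₂ = dH ≫ ih) :
    (x ⊗ y) ◁ dw ≫ ((τ ⊗ₘ 𝟙 y) ⊗ₘ i) ≫ (ic ⊗ₘ i') ≫ ej ≫ l =
      applyTwice ((α_ x pw q).inv ≫ (β_ x pw).hom ▷ q ≫ (m ▷ x ≫ cw) ▷ q ≫ dW)
        (y ◁ iτ ≫ y ◁ ih ≫ e₂) := by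
  rw [tensorHom_comp_tensorHom_assoc, tensorHom_id, ← MonoidalCategory.whiskerLeft_comp_assoc]
  refine compat_of_assoc hj h₂ ?_ hl.symm ?_ (assoc_natural_aux hm ha hn)
  · rw [comp_whiskerRight, Category.assoc, hi', reassoc_of% hi]
  · rw [comp_whiskerRight, Category.assoc, hjh, reassoc_of% hτ]

end

section Comultiplication

open FreeSymm

variable {X : Type u} {V : Type (u + 1)} [Category.{u} V] [MonoidalCategory V]
  [SymmetricCategory V] [MonoidalClosed V] [HasLimits V]

namespace ColoredOperad

variable (P : ColoredOperad X V) (C : X → V)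

/-- Values of the diagonal of representative elements at composite operations. -/
noncomputable def deltaComp (y : X) {w : Words X} (s : Decoration w) :
    (tens P.ops).obj s.word ⊗ ((P.ops y).obj w ⊗ P.Q₁ C y) ⟶
      (tpow (P.coan C)).obj (join.obj s.word) :=
  (α_ _ _ _).inv ≫ (β_ ((tens P.ops).obj s.word) ((P.ops y).obj w)).hom ▷ P.Q₁ C y ≫
    ((P.ops y).map s.hom ▷ (tens P.ops).obj s.word ≫ P.opComp y s.word) ▷ P.Q₁ C y ≫
      P.deltaEv C y (join.obj s.word)

/-- For operations `p, q, r`: the value of `δ₁(c)(p)` at `q ∘ r` is `χ₁(c)(p ∘ (q ∘ r)) = χ₁(c)((p ∘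
q) ∘ r)`, which is the value of `δ₁(c)(p ∘ q)` at `r`. -/
theorem compat_deltaEv (y : X) (w : Words X) :
    (P.wordProbe C w).Compat (P.deltaEv C y w) (fun s => P.deltaComp C y s) := fun r =>
  compat_of_operad_assoc (P.deltaEv_evW y (joins.obj r.refined))
    (P.deltaEv_evW y (join₂.obj r.refined)) ((P.ops y).map_comp r.hom (head.map r.toHeads))
    (P.assoc y r.refined) ((P.comp y).naturality r.toHeads) (P.deltaEv_natural y _)
    (P.deltaEv_natural y (headHeads r.refined)) (P.chiEv_natural y (joinJoins r.refined))
    (P.deltaEv_natural y (join.map r.toHeads)) (P.deltaEv_natural y (joinHeads r.refined))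

/-- The diagonal of a representative element consists of representative elements. -/
theorem exists_comult [HasSlices V] (y : X) :
    ∃ δ : P.Q₁ C y ⟶ P.coan (P.Q₁ C) y, δ ≫ P.coanMap (P.chi C) y = P.delta₁ C y := by
  -- The values of the diagonal on `P(w;y)` form a generalised element with parameters `P(w;y) ⊗
  -- Q₁(C)`; detection lifts it to `Q₁(C)^{⊗w}`.
  choose g hg using fun w => P.detects_tpowMap C w _ _ (P.compat_deltaEv C y w)
  -- The lifts are chosen word by word. They are natural all the same, since tensor powers of `χ₁`
  -- are monic.
  have hn : ∀ {w w' : Words X} (f : w ⟶ w'), (P.ops y).map f ▷ P.Q₁ C y ≫ g w' =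
      g w ≫ (tpow (P.Q₁ C)).map f := fun {w w'} f => by
    rw [← cancel_mono ((tpowMap (P.chi C)).app w'), Category.assoc, Category.assoc, hg,
      NatTrans.naturality, reassoc_of% (hg w), deltaEv_natural]
  refine ⟨NatHom.lift g hn, NatHom.hom_ext fun w => ?_⟩
  rw [MonoidalCategory.whiskerLeft_comp, Category.assoc, coanMap, NatHom.map_ev, ← Category.assoc,
    NatHom.lift_ev]
  exact hg w

end ColoredOperad

end Comultiplication

/-! ### Counit and evaluation of diagonals -/

section

variable {V : Type w₂} [Category.{w} V] [MonoidalCategory V]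

theorem unit_ev_aux {o a a' b : V} {η : 𝟙_ V ⟶ o} {r : a ⟶ a'} {e : o ⊗ a' ⟶ b} {k : o ⊗ a ⟶ b}
    (h : o ◁ r ≫ e = k) : r ≫ (λ_ a').inv ≫ η ▷ a' ≫ e = (λ_ a).inv ≫ η ▷ a ≫ k := by
  rw [leftUnitor_inv_naturality_assoc, whisker_exchange_assoc, h]

theorem whiskerRight_id_comp {a b c : V} (e : a ⊗ b ⟶ c) : 𝟙 a ▷ b ≫ e = e := by simp

variable [SymmetricCategory V]

theorem counit_aux {o p q a b g : V} {η : 𝟙_ V ⟶ o} {d : o ⊗ q ⟶ a} {e : p ⊗ a ⟶ g}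
    {c : o ⊗ p ⟶ b} {x : b ⊗ q ⟶ g} {x' : p ⊗ q ⟶ g}
    (h : p ◁ d ≫ e = (α_ p o q).inv ≫ (β_ p o).hom ▷ q ≫ c ▷ q ≫ x)
    (hc : ((λ_ p).inv ≫ η ▷ p ≫ c) ▷ q ≫ x = x') :
    p ◁ ((λ_ q).inv ≫ η ▷ q ≫ d) ≫ e = x' := by
  have h₁ : p ◁ (λ_ q).inv ≫ p ◁ η ▷ q ≫ (α_ p o q).inv ≫ (β_ p o).hom ▷ q =
      ((λ_ p).inv ≫ η ▷ p) ▷ q := by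
    rw [associator_inv_naturality_middle_assoc, ← comp_whiskerRight,
      BraidedCategory.braiding_naturality_right]
    simp
  rw [← hc]
  simp only [MonoidalCategory.whiskerLeft_comp, Category.assoc, h]
  rw [reassoc_of% h₁]
  simp

theorem applyTwice_leftUnitor :
    applyTwice (λ_ (𝟙_ V)).hom (λ_ (𝟙_ V)).hom = (λ_ (𝟙_ V)).hom ▷ 𝟙_ V ≫ (λ_ (𝟙_ V)).hom := by
  simp [applyTwice]
  monoidal

theorem tensor_value_aux {x x' y y' q q' a a' h h' k k' : V} {i : q ⟶ a} {i' : q' ⟶ a'}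
    {e : (x ⊗ y) ⊗ a ⟶ k} {e' : (x' ⊗ y') ⊗ a' ⟶ k'} {E : x ⊗ q ⟶ h} {E' : x' ⊗ q' ⟶ h'}
    {l : y ⊗ h ⟶ k} {l' : y' ⊗ h' ⟶ k'} (ha : (x ⊗ y) ◁ i ≫ e = applyTwice E l)
    (hb : (x' ⊗ y') ◁ i' ≫ e' = applyTwice E' l') :
    ((x ⊗ x') ⊗ (y ⊗ y')) ◁ (i ⊗ₘ i') ≫ tensorTest e e' =
      applyTwice (tensorμ x x' q q' ≫ (E ⊗ₘ E')) (tensorμ y y' h h' ≫ (l ⊗ₘ l')) := by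
  rw [applyTwice_tensor, ← ha, ← hb, tensorTest, whisker_exchange_assoc, tensorμ_comp]

theorem value_natural_aux {x x' y q q' a a' h h' k : V} {m : x ⟶ x'} {r : q ⟶ q'} {i : q ⟶ a}
    {i' : q' ⟶ a'} {s : a ⟶ a'} {e : (x' ⊗ y) ⊗ a' ⟶ k} {E : x ⊗ q ⟶ h} {E' : x' ⊗ q' ⟶ h'}
    {j : h ⟶ h'} {l : y ⊗ h' ⟶ k} (hi : r ≫ i' = i ≫ s) (hE : (m ⊗ₘ r) ≫ E' = E ≫ j)
    (h : (x' ⊗ y) ◁ i' ≫ e = applyTwice E' l) :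
    (x ⊗ y) ◁ i ≫ ((m ⊗ₘ 𝟙 y) ⊗ₘ (𝟙 a ≫ s)) ≫ e = applyTwice E (y ◁ j ≫ l) := by
  have h₁ : (x ⊗ y) ◁ i ≫ ((m ⊗ₘ 𝟙 y) ⊗ₘ (𝟙 a ≫ s)) =
      (x ⊗ y) ◁ r ≫ (m ▷ y) ▷ q' ≫ (x' ⊗ y) ◁ i' := by
    rw [← whisker_exchange, ← MonoidalCategory.whiskerLeft_comp_assoc, hi, Category.id_comp,
      tensorHom_id, MonoidalCategory.tensorHom_def', MonoidalCategory.whiskerLeft_comp_assoc]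
  rw [← Category.assoc, h₁, Category.assoc, Category.assoc, h, whiskerRight_applyTwice,
    whiskerLeft_applyTwice, ← applyTwice_comp, ← hE,
    MonoidalCategory.tensorHom_def', Category.assoc]

/-- The test value of `d = v ≫ i` is computed in two ways, from `c` and from `v` through `E`; the
isomorphisms at the start of `applyTwice` cancel. -/
theorem coassoc_aux {x y p q g a h k : V} {v : p ⊗ q ⟶ g} {i : g ⟶ a} {d : p ⊗ q ⟶ a}
    {e : (x ⊗ y) ⊗ a ⟶ k} {c : x ⊗ (p ⊗ q) ⟶ h} {l : y ⊗ h ⟶ k} {E : x ⊗ g ⟶ h}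
    (hv : v ≫ i = d) (h₁ : (x ⊗ y) ◁ d ≫ e = applyTwice c l)
    (h₂ : (x ⊗ y) ◁ i ≫ e = applyTwice E l) : y ◁ (x ◁ v ≫ E) ≫ l = y ◁ c ≫ l := by
  apply applyTwice_cancel
  rw [← whiskerLeft_applyTwice, ← h₂, ← h₁, ← hv, MonoidalCategory.whiskerLeft_comp_assoc]

theorem coassoc_aux₂ {p x q g a h m : V} {v : p ⊗ q ⟶ g} {i : g ⟶ a} {e : x ⊗ a ⟶ h}
    {c : p ⊗ x ⟶ m} {d : m ⊗ q ⟶ h}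
    (H : x ◁ v ≫ x ◁ i ≫ e = (α_ x p q).inv ≫ (β_ x p).hom ▷ q ≫ ((𝟙 p ▷ x) ≫ c) ▷ q ≫ d) :
    applyTwice (v ≫ i) e = c ▷ q ≫ d := by
  rw [applyTwice_comp, applyTwice, H, Iso.hom_inv_id_assoc, ← comp_whiskerRight_assoc,
    SymmetricCategory.symmetry, id_whiskerRight, Category.id_comp, id_whiskerRight,
    Category.id_comp]

end

section CoalgebraAxioms

open FreeSymm

variable {X : Type u} {V : Type (u + 1)} [Category.{u} V] [MonoidalCategory V]
  [SymmetricCategory V] [MonoidalClosed V] [HasLimits V]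

namespace ColoredOperad

variable (P : ColoredOperad X V) (C : X → V)

theorem counit_natural {C D : X → V} (f : ∀ x, C x ⟶ D x) (y : X) :
    P.coanMap f y ≫ P.counit D y = P.counit C y ≫ f y := by
  have h := NatHom.map_ev (F := P.ops y) (tpowMap f) (letter y)
  rw [tpowMap_letter] at h
  exact (unit_ev_aux h).trans
    ((Category.assoc _ _ _).trans (congrArg (fun k => _ ≫ k) (Category.assoc _ _ _))).symm

/-- Evaluated at `p`, the left side is `δ₁(c)(1)` at `p`, that is `χ₁(c)(1 ∘ p)`; the left unit law
of the operad finishes. -/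
theorem delta_counit (y : X) : P.delta₁ C y ≫ P.counit (P.coan C) y = P.chi C y := by
  have h₁ : P.delta₁ C y ≫ P.counit (P.coan C) y =
      (λ_ (P.Q₁ C y)).inv ≫ P.one y ▷ P.Q₁ C y ≫ P.deltaEv C y (letter y) := unit_ev_aux rfl
  rw [h₁]
  refine NatHom.hom_ext (F := P.ops y) (G := tpow C) fun z => ?_
  refine counit_aux (P.deltaEv_evW y (incl.obj (Discrete.mk y, z))) ?_
  refine (congrArg (fun s => s ▷ P.Q₁ C y ≫ _) (P.one_comp y z)).trans ?_
  exact whiskerRight_id_comp (P.chiEv C y z)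

/-- Evaluation of the diagonals of tensor words of representative elements. -/
noncomputable def deltaWord (W : Words₂ X) :
    (tens P.ops).obj W ⊗ (tpow (P.Q₁ C)).obj (head.obj W) ⟶ (tpow (P.coan C)).obj (join.obj W) :=
  (tens P.ops).obj W ◁ (tpowMap (P.delta₁ C)).app (head.obj W) ≫ P.evW (P.coan C) W

theorem deltaWord_tensor (W W' : Words₂ X) :
    P.deltaWord C (W ⊗ W') =
      tensorμ ((tens P.ops).obj W) ((tens P.ops).obj W') ((tpow (P.Q₁ C)).obj (head.obj W))
        ((tpow (P.Q₁ C)).obj (head.obj W')) ≫ (P.deltaWord C W ⊗ₘ P.deltaWord C W') :=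
  (congrArg₂ (fun s t => _ ◁ s ≫ t) (tpowMap_tensor _ (head.obj W) (head.obj W'))
    (P.evW_tensor (P.coan C) W W')).trans (tensorμ_comp _ _ _ _)

theorem deltaWord_unit : P.deltaWord C (𝟙_ (Words₂ X)) = (λ_ (𝟙_ V)).hom :=
  (congrArg₂ (fun s t => 𝟙_ V ◁ s ≫ t) (tpowMap_unit (P.delta₁ C)) (P.evW_unit (P.coan C))).trans
    (whiskerLeft_id_comp _)

theorem deltaWord_natural {W W' : Words₂ X} (f : W ⟶ W') :
    ((tens P.ops).map f ⊗ₘ (tpow (P.Q₁ C)).map (head.map f)) ≫ P.deltaWord C W' =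
      P.deltaWord C W ≫ (tpow (P.coan C)).map (join.map f) := by
  have h : ((tens P.ops).map f ⊗ₘ (tpow (P.coan (P.coan C))).map (head.map f)) ≫
      P.evW (P.coan C) W' = P.evW (P.coan C) W ≫ (tpow (P.coan C)).map (join.map f) :=
    (P.evWord (P.coan C)).naturality f
  rw [deltaWord, deltaWord, Category.assoc, ← h, ← id_tensorHom, ← id_tensorHom,
    tensorHom_comp_tensorHom_assoc, tensorHom_comp_tensorHom_assoc, NatTrans.naturality,
    Category.comp_id, Category.id_comp]

theorem lastEval_unit : P.lastEval C (𝟙_ (Words₃ X)) = (λ_ (𝟙_ V)).hom := by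
  have h : (tpow (P.coan C)).map (joinHeads (𝟙_ (Words₃ X))) = 𝟙 (𝟙_ V) := by
    rw [joinHeads_unit]
    rfl
  exact (congrArg₂ (fun s t => 𝟙_ V ◁ s ≫ t) h (P.evW_unit C)).trans (whiskerLeft_id_comp _)

/-- The relation `deltaEv_evW'` for whole words: it is the case of one letter, and tensor words
follow by interchange of two-step evaluations. -/
theorem chi_compEval (W : Words₃ X) :
    ((tens P.ops).obj (heads.obj W) ⊗ (tens P.ops).obj (join₂.obj W)) ◁
        (tpowMap (P.chi C)).app (head.obj (heads.obj W)) ≫ P.compEval C W =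
      applyTwice (P.deltaWord C (heads.obj W)) (P.lastEval C W) := by
  induction W with
  | of g =>
    obtain ⟨⟨x⟩, W⟩ := g
    have h := P.deltaEv_evW' (C := C) x W
    rw [chiEv, ← whisker_exchange_assoc] at h
    refine (congrArg (fun s => _ ≫ s) (P.compEval_letter C x W)).trans (h.symm.trans ?_)
    exact congrArg (fun s => applyTwice _ s) (P.lastEval_letter C x W).symm
  | unit =>
    refine (congrArg₂ (fun s t => (𝟙_ V ⊗ 𝟙_ V) ◁ s ≫ t) (tpowMap_unit (P.chi C))
      (P.compEval_unit C)).trans ((whiskerLeft_id_comp _).trans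
        (applyTwice_leftUnitor.symm.trans ?_))
    exact (congrArg₂ (fun s t => applyTwice s t) (P.deltaWord_unit C) (P.lastEval_unit C)).symm
  | tensor a b iha ihb =>
    refine (congrArg₂ (fun s t => _ ◁ s ≫ t) (tpowMap_tensor (P.chi C) _ _)
      (P.compEval_tensor C a b)).trans ((tensor_value_aux iha ihb).trans ?_)
    exact (congrArg₂ (fun s t => applyTwice s t) (P.deltaWord_tensor C (heads.obj a) (heads.obj b))
      (P.lastEval_tensor C a b)).symm

/-- Evaluations of two-step decorations separate tensor powers of `P^∧(C)`. -/
theorem separating_lastEval [HasSlices V] (W : Words₂ X) :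
    Separating (a := (tpow (P.coan C)).obj (join.obj W))
      (fun r : (W' : Words₃ X) × (W ⟶ heads.obj W') =>
        (tens P.ops).obj (join₂.obj r.1) ◁ (tpow (P.coan C)).map (join.map r.2) ≫
          P.lastEval C r.1) := by
  induction W with
  | of g =>
    obtain ⟨⟨x⟩, z⟩ := g
    intro t f g h
    -- On the letter `(x, z)` the family contains all evaluations by decorations of `z`, each seen
    -- as a one-letter refinement.
    refine P.separating_evW C z f g fun s => ?_
    have e := P.wordProbe_value_letter C x s.hom
    exact (congrArg (fun k => _ ◁ f ≫ k) e).symm.trans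
      ((h ⟨_, (letterRefinement x s.hom).toHeads⟩).trans (congrArg (fun k => _ ◁ g ≫ k) e))
  | unit =>
    intro t f g h
    have e : (𝟙_ V) ◁ 𝟙 (𝟙_ V) ≫ P.lastEval C (𝟙_ (Words₃ X)) = (λ_ (𝟙_ V)).hom :=
      (whiskerLeft_id_comp (a := 𝟙_ V) (b := 𝟙_ V) _).trans (P.lastEval_unit C)
    exact unit_separates ((congrArg (fun s => _ ◁ f ≫ s) e).symm.trans
      ((h ⟨𝟙_ _, 𝟙 _⟩).trans (congrArg (fun s => _ ◁ g ≫ s) e)))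
  | tensor a b iha ihb =>
    intro t f g h
    refine (iha.tensor ihb) f g fun r => ?_
    have e : _ ◁ (tpow (P.coan C)).map (join.map (r.1.2 ⊗ₘ r.2.2)) ≫
        P.lastEval C (r.1.1 ⊗ r.2.1) = _ :=
      (congrArg₂ (fun s t => _ ◁ s ≫ t)
        ((congrArg _ (lift_map_tensorHom _ _ _)).trans (lift_map_tensorHom _ _ _))
        (P.lastEval_tensor C r.1.1 r.2.1)).trans (tensorμ_comp _ _ _ _)
    exact (congrArg (fun s => _ ◁ f ≫ s) e).symm.trans
      ((h ⟨r.1.1 ⊗ r.2.1, r.1.2 ⊗ₘ r.2.2⟩).trans (congrArg (fun s => _ ◁ g ≫ s) e))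

end ColoredOperad

end CoalgebraAxioms

/-! ### The coalgebra axioms and naturality -/

section CofreeCoalgebra

open FreeSymm

variable {X : Type u} {V : Type (u + 1)} [Category.{u} V] [MonoidalCategory V]
  [SymmetricCategory V] [MonoidalClosed V] [HasLimits V]

namespace ColoredOperad

variable (P : ColoredOperad X V) (C : X → V)

/-- Transports `chi_compEval` along `f`, using that tensor powers of `χ₁` and `deltaWord` are
natural in the word. -/
theorem chi_test (W : Words₂ X) {W' : Words₃ X} (f : W ⟶ heads.obj W') :
    ((tens P.ops).obj W ⊗ (tens P.ops).obj (join₂.obj W')) ◁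
        (tpowMap (P.chi C)).app (head.obj W) ≫
        (P.wordProbe C (head.obj W)).test ⟨⟨W, 𝟙 _⟩, W', f⟩ =
      applyTwice (P.deltaWord C W) ((tens P.ops).obj (join₂.obj W') ◁
        (tpow (P.coan C)).map (join.map f) ≫ P.lastEval C W') := by
  have h := value_natural_aux ((tpowMap (P.chi C)).naturality (head.map f))
    (P.deltaWord_natural C f) (P.chi_compEval C W')
  refine Eq.trans ?_ h
  have e : (tpow (P.coan C)).map (𝟙 (head.obj W) ≫ head.map f) =
      𝟙 _ ≫ (tpow (P.coan C)).map (head.map f) := by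
    rw [Category.id_comp, Category.id_comp]
  exact congrArg (fun s => _ ◁ (tpowMap (P.chi C)).app (head.obj W) ≫ (_ ⊗ₘ s) ≫ _) e

theorem coan₂_mono [HasSlices V] {C D : X → V} (f : ∀ x, C x ⟶ D x) [∀ x, Mono (f x)] (y : X) :
    Mono (P.coan₂Map f y) where
  right_cancellation g h e := NatHom.hom_ext fun W => by
    have m := mono_tpowMap f (join.obj W)
    rw [← cancel_mono ((tpowMap f).app (join.obj W))]
    have k := NatHom.map_ev (F := ptensor (head ⋙ P.ops y) (tens P.ops))
      (Functor.whiskerLeft join (tpowMap f)) W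
    have k' : ∀ {t : V} (g : t ⟶ P.coan₂ C y),
      (_ ◁ g ≫ NatHom.ev (ptensor (head ⋙ P.ops y) (tens P.ops)) (join ⋙ tpow C) W) ≫
      (tpowMap f).app (join.obj W) = _ ◁ (g ≫ P.coan₂Map f y) ≫
        NatHom.ev (ptensor (head ⋙ P.ops y) (tens P.ops)) (join ⋙ tpow D) W := fun g => by
      rw [MonoidalCategory.whiskerLeft_comp, Category.assoc, Category.assoc]
      exact congrArg (fun s => _ ◁ g ≫ s) k.symm
    exact (k' g).trans ((congrArg (fun s => _ ◁ s ≫ _) e).trans (k' h).symm)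

variable {C}

theorem ev_tpowMap {C D : X → V} (f : ∀ x, C x ⟶ D x) {y : X} {t : V} (d : t ⟶ P.coan C y)
    (w : Words X) :
    ((P.ops y).obj w ◁ d ≫ NatHom.ev (P.ops y) (tpow C) w) ≫ (tpowMap f).app w =
      (P.ops y).obj w ◁ (d ≫ P.coanMap f y) ≫ NatHom.ev (P.ops y) (tpow D) w := by
  rw [MonoidalCategory.whiskerLeft_comp, Category.assoc, Category.assoc, coanMap, NatHom.map_ev]

/-- A lift of the diagonal computes the values of the diagonal at composite operations. -/
theorem comult_deltaWord [HasSlices V] {y : X} {d : P.Q₁ C y ⟶ P.coan (P.Q₁ C) y}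
    (hd : d ≫ P.coanMap (P.chi C) y = P.delta₁ C y) (W : Words₂ X) :
    (tens P.ops).obj W ◁ ((P.ops y).obj (head.obj W) ◁ d ≫
        NatHom.ev (P.ops y) (tpow (P.Q₁ C)) (head.obj W)) ≫ P.deltaWord C W =
      P.deltaComp C y ⟨W, 𝟙 _⟩ := by
  -- Both sides are tested against a third layer of operations. The left is governed by `chi_test`,
  -- the right by `compat_deltaEv`; as `d` lifts `δ₁`, they compute the same values of `δ₁(c)(p)`.
  refine P.separating_lastEval C W _ _ fun r => ?_
  exact coassoc_aux
    ((P.ev_tpowMap (P.chi C) d (head.obj W)).trans (congrArg (fun s => _ ◁ s ≫ _) hd))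
    (P.compat_deltaEv C y (head.obj W) ⟨⟨W, 𝟙 _⟩, r.1, r.2⟩) (P.chi_test C W r.2)

/-- A lift of the diagonal is compatible with the diagonals of `P^∧(C)`. -/
theorem comult_delta [HasSlices V] {y : X} {d : P.Q₁ C y ⟶ P.coan (P.Q₁ C) y}
    (hd : d ≫ P.coanMap (P.chi C) y = P.delta₁ C y) :
    d ≫ P.coanMap (P.delta₁ C) y ≫ P.alpha (P.coan C) y =
      P.delta₁ C y ≫ P.diag (P.coan C) y := by
  refine NatHom.hom_ext fun W => ?_
  rw [← Category.assoc]
  refine compat_letter_aux (P.alpha_ev (P.coan C) y W) (P.diag_ev (P.coan C) y W) ?_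
  have h := P.comult_deltaWord hd W
  have e : (P.ops y).map (𝟙 (head.obj W)) = 𝟙 _ := (P.ops y).map_id _
  rw [deltaComp, e] at h
  exact (whiskerLeft_applyTwice _ _ _).trans ((congrArg (fun s => applyTwice s _)
    (P.ev_tpowMap (P.delta₁ C) d (head.obj W)).symm).trans
      ((coassoc_aux₂ h).trans (whisker_exchange_assoc _ _ _).symm))

variable (C)

/-- The coalgebra of representative elements. -/
theorem isCoalgebra_of_lift [HasSlices V] {d : ∀ y, P.Q₁ C y ⟶ P.coan (P.Q₁ C) y}
    (hd : ∀ y, d y ≫ P.coanMap (P.chi C) y = P.delta₁ C y) : P.IsCoalgebra (P.Q₁ C) d where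
  counit y := by
    -- After `χ₁`, naturality of the counit turns the claim into `δ₁ ≫ ε = χ₁`.
    rw [← cancel_mono (P.chi C y), Category.assoc, ← counit_natural, reassoc_of% hd, delta_counit,
      Category.id_comp]
  coassoc y := by
    -- After `P₂^∧(χ₁)`, naturality of `α` and `Δ` replaces the outer `d` by `δ₁` on the right and
    -- the inner one on the left, leaving `comult_delta`.
    have := P.coan₂_mono (P.chi C) y
    rw [← cancel_mono (P.coan₂Map (P.chi C) y)]
    simp only [Category.assoc]
    rw [alpha_natural, diag_natural, reassoc_of% hd, ← P.comult_delta (hd y),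
      ← reassoc_of% P.coanMap_comp, funext hd]

variable {C}

theorem Q₁Map_chi {C D : X → V} (f : ∀ x, C x ⟶ D x) (y : X) :
    P.Q₁Map f y ≫ P.chi D y = P.chi C y ≫ P.coanMap f y :=
  pullback.lift_fst _ _ _

theorem Q₁Map_delta {C D : X → V} (f : ∀ x, C x ⟶ D x) (y : X) :
    P.Q₁Map f y ≫ P.delta₁ D y = P.delta₁ C y ≫ P.coanMap (P.coanMap f) y :=
  pullback.lift_snd _ _ _

theorem mono_coanMap [HasSlices V] {C D : X → V} (f : ∀ x, C x ⟶ D x) [∀ x, Mono (f x)] (y : X) :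
    Mono (P.coanMap f y) where
  right_cancellation g h e := NatHom.hom_ext fun w => by
    rw [← cancel_mono ((tpowMap f).app w), ev_tpowMap, ev_tpowMap, e]

/-- The representative elements of `P^∧(C)` form a `P`-coalgebra, naturally in `C`. -/
theorem exists_coalgebra_Q₁ [HasSlices V] :
    (∀ (C : X → V) (y : X), Mono (P.chi C y)) ∧
    ∃ δ : ∀ (C : X → V) (y : X), P.Q₁ C y ⟶ P.coan (P.Q₁ C) y,
      (∀ C : X → V, P.IsCoalgebra (P.Q₁ C) (δ C)) ∧
      (∀ (C : X → V) (y : X), δ C y ≫ P.coanMap (P.chi C) y = P.delta₁ C y) ∧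
      (∀ (C D : X → V) (f : ∀ x, C x ⟶ D x) (y : X),
        δ C y ≫ P.coanMap (P.Q₁Map f) y = P.Q₁Map f y ≫ δ D y) := by
  refine ⟨fun C y => inferInstance, ?_⟩
  -- The choice is harmless: `P^∧(χ₁)` is monic, so the lift is unique. For the same reason
  -- naturality may be checked after `P^∧(χ₁)`, where it becomes naturality of `δ₁`.
  choose δ hδ using fun (C : X → V) (y : X) => P.exists_comult C y
  refine ⟨δ, fun C => P.isCoalgebra_of_lift C (hδ C), hδ, fun C D f y => ?_⟩
  have := P.mono_coanMap (P.chi D) y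
  rw [← cancel_mono (P.coanMap (P.chi D) y), Category.assoc, Category.assoc, hδ, Q₁Map_delta,
    ← coanMap_comp, funext (P.Q₁Map_chi f), coanMap_comp, reassoc_of% hδ]

end ColoredOperad

end CofreeCoalgebra

/-! ### Linear algebra: tensors and functionals -/

section Contraction

open TensorProduct

variable {k : Type u} [Field k] {A A' B : Type u} [AddCommGroup A] [Module k A] [AddCommGroup A']
  [Module k A'] [AddCommGroup B] [Module k B]

/-- The contraction `a ⊗ b ↦ φ b • a`. -/
noncomputable def contraction (A : Type u) [AddCommGroup A] [Module k A] (φ : B →ₗ[k] k) :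
    A ⊗[k] B →ₗ[k] A :=
  (TensorProduct.rid k A).toLinearMap ∘ₗ φ.lTensor A

theorem contraction_tmul (φ : B →ₗ[k] k) (a : A) (b : B) :
    contraction A φ (a ⊗ₜ[k] b) = φ b • a := by
  simp [contraction]

theorem contraction_rTensor (φ : B →ₗ[k] k) (g : A →ₗ[k] A') (t : A ⊗[k] B) :
    contraction A' φ (g.rTensor B t) = g (contraction A φ t) := by
  induction t with
  | zero => simp
  | tmul a b => simp [contraction_tmul]
  | add s t hs ht => rw [map_add, map_add, map_add, map_add, hs, ht]

/-- A set of functionals whose contractions detect zero tensors. -/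
def DetectsTensors (S : Set (B →ₗ[k] k)) : Prop :=
  ∀ (A : Type u) [AddCommGroup A] [Module k A] (t : A ⊗[k] B),
    (∀ φ ∈ S, contraction A φ t = 0) → t = 0

/-- The contractions with the coordinate functionals of a basis of `B` are the coordinates of the
tensor. -/
theorem detectsTensors_univ : DetectsTensors (Set.univ : Set (B →ₗ[k] k)) := by
  intro A _ _ t h
  classical
  let b := Module.Basis.ofVectorSpace k B
  have key : ∀ (t : A ⊗[k] B) i, TensorProduct.equivFinsuppOfBasisRight b t i =
      contraction A (b.coord i) t := fun t i => by
    induction t with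
    | zero => simp
    | tmul a c =>
      rw [TensorProduct.equivFinsuppOfBasisRight_apply_tmul_apply, contraction_tmul]
      rfl
    | add s t hs ht => rw [map_add, map_add, Finsupp.add_apply, hs, ht]
  rw [← (TensorProduct.equivFinsuppOfBasisRight (M := A) b).map_eq_zero_iff]
  ext i
  rw [key, h _ (Set.mem_univ _)]
  rfl

theorem DetectsTensors.ext {S : Set (B →ₗ[k] k)} (hS : DetectsTensors S) {s t : A ⊗[k] B}
    (h : ∀ φ ∈ S, contraction A φ s = contraction A φ t) : s = t := by
  rw [← sub_eq_zero]
  exact hS A _ fun φ hφ => by rw [map_sub, h φ hφ, sub_self]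

/-- A tensor whose contractions lie in a subspace lies in its tensor product. -/
theorem DetectsTensors.mem_range {S : Set (B →ₗ[k] k)} (hS : DetectsTensors S)
    (g : A' →ₗ[k] A) (t : A ⊗[k] B)
    (h : ∀ φ ∈ S, contraction A φ t ∈ LinearMap.range g) :
    t ∈ LinearMap.range (g.rTensor B) := by
  -- By right exactness of `- ⊗ B`, the range is the kernel of the map to `(A / range g) ⊗ B`, where
  -- `S` detects zero.
  have hex : Function.Exact g (LinearMap.range g).mkQ :=
    LinearMap.exact_iff.mpr (Submodule.ker_mkQ _)
  rw [← LinearMap.exact_iff.mp (rTensor_exact B hex (Submodule.mkQ_surjective _)),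
    LinearMap.mem_ker]
  refine hS _ _ fun φ hφ => ?_
  rw [contraction_rTensor, Submodule.mkQ_apply, Submodule.Quotient.mk_eq_zero]
  exact h φ hφ

/-- Maps into the image of an injective linear map lift. -/
theorem exists_comp_eq_of_injective {T : Type u} [AddCommGroup T] [Module k T] (j : A' →ₗ[k] A)
    (hj : Function.Injective j) (f : T →ₗ[k] A) (h : ∀ t, f t ∈ LinearMap.range j) :
    ∃ f' : T →ₗ[k] A', ∀ t, j (f' t) = f t := by
  -- Over a field an injection splits.
  obtain ⟨g, hg⟩ := j.exists_leftInverse_of_injective (LinearMap.ker_eq_bot.mpr hj)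
  refine ⟨g ∘ₗ f, fun t => ?_⟩
  obtain ⟨s, hs⟩ := h t
  have : g (j s) = s := LinearMap.congr_fun hg s
  rw [LinearMap.comp_apply, ← hs, this]

end Contraction

/-! ### Slices of vector spaces -/

section VectorSpaces

variable {k : Type u} [Field k]

theorem ModuleCat.ihom_ev_tmul (b : ModuleCat.{u} k) (φ : b ⟶ 𝟙_ (ModuleCat.{u} k)) (y : b) :
    ((ihom.ev b).app (𝟙_ _)).hom (TensorProduct.tmul k y (φ : (dualObj b : ModuleCat.{u} k))) =
      φ.hom y := by
  rw [← MonoidalClosed.uncurry_id_eq_ev]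
  rfl

/-- Links the categorical slice to the linear contraction, so that the results on functionals apply.
-/
theorem ModuleCat.slice_tmul {t a b : ModuleCat.{u} k} (f : t ⟶ a ⊗ b) (x : t) (φ : b →ₗ[k] k) :
    (slice f).hom (TensorProduct.tmul k x
      (ModuleCat.ofHom φ : (dualObj b : ModuleCat.{u} k))) =
      contraction (k := k) a φ (f.hom x) := by
  have key := TensorProduct.ext' (g := ((α_ a b (dualObj b)).hom ≫ a ◁ (ihom.ev b).app (𝟙_ _) ≫
      (ρ_ a).hom).hom ∘ₗ (TensorProduct.mk k (TensorProduct k a b)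
        (dualObj b : ModuleCat.{u} k)).flip
        (ModuleCat.ofHom φ)) (h := contraction (k := k) a φ) fun z y => by
    rw [contraction_tmul]
    exact congrArg (fun c : k => c • z) (ModuleCat.ihom_ev_tmul b (ModuleCat.ofHom φ) y)
  exact LinearMap.congr_fun key (f.hom x)

instance : HasSlices (ModuleCat.{u} k) where
  slice_injective {t a b f g} h := by
    refine ModuleCat.hom_ext (LinearMap.ext fun x => detectsTensors_univ.ext fun φ _ => ?_)
    have h₁ := ModuleCat.slice_tmul f x φ
    have h₂ := ModuleCat.slice_tmul g x φ
    rw [h] at h₁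
    exact h₁.symm.trans h₂
  factors_of_slice {t a b q} i _ f l h := by
    have hi : Function.Injective i.hom := (ModuleCat.mono_iff_injective i).mp inferInstance
    have hr : ∀ x, f.hom x ∈ LinearMap.range (i.hom.rTensor b) := fun x =>
      detectsTensors_univ.mem_range i.hom _ fun φ _ => by
        rw [← ModuleCat.slice_tmul f x φ, ← h]
        exact ⟨_, rfl⟩
    obtain ⟨f', hf'⟩ := exists_comp_eq_of_injective _
      (Module.Flat.rTensor_preserves_injective_linearMap (M := b) i.hom hi) f.hom hr
    exact ⟨ModuleCat.ofHom f', ModuleCat.hom_ext (LinearMap.ext hf')⟩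
  regular {q a} i _ := by
    have hi : Function.Injective i.hom := (ModuleCat.mono_iff_injective i).mp inferInstance
    -- A monomorphism is the equaliser of the projection to its cokernel and zero.
    refine ⟨ModuleCat.of k (a ⧸ LinearMap.range i.hom), ModuleCat.ofHom (Submodule.mkQ _), 0, ?_,
      fun {t} f hf => ?_⟩
    · ext x
      simp
    · obtain ⟨f', hf'⟩ := exists_comp_eq_of_injective _ hi f.hom fun x => by
        have := LinearMap.congr_fun (congrArg ModuleCat.Hom.hom hf) x
        simpa using this
      exact ⟨ModuleCat.ofHom f', ModuleCat.hom_ext (LinearMap.ext hf')⟩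

end VectorSpaces

/-! ### Slices of dg vector spaces -/

namespace DGVect

open TensorProduct

variable {k : Type u} [Field k]

section Homogeneous

theorem comps_apply (M : DGVect.{u} k) (n : ℤ) (x : M.carrier) : M.comps x n = M.pr n x := by
  refine LinearMap.congr_fun (f := Finsupp.lapply n ∘ₗ M.comps) (g := M.pr n)
    (lin_ext fun m y hy => ?_) x
  rw [LinearMap.comp_apply, M.comps_of_mem hy, Finsupp.lapply_apply]
  by_cases h : m = n
  · subst h
    rw [M.pr_of_mem hy, Finsupp.single_eq_same]
  · rw [M.pr_of_ne h hy, Finsupp.single_eq_of_ne (Ne.symm h)]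

theorem sum_comps (M : DGVect.{u} k) (x : M.carrier) :
    Finsupp.lsum k (fun _ : ℤ => (LinearMap.id : M.carrier →ₗ[k] M.carrier)) (M.comps x) = x := by
  refine LinearMap.congr_fun (f := Finsupp.lsum k (fun _ : ℤ => LinearMap.id) ∘ₗ M.comps)
    (g := LinearMap.id) (lin_ext fun m y hy => ?_) x
  rw [LinearMap.comp_apply, M.comps_of_mem hy]
  simp

theorem eq_zero_of_pr {M : DGVect.{u} k} {x : M.carrier} (h : ∀ n, M.pr n x = 0) : x = 0 := by
  have : M.comps x = 0 := Finsupp.ext fun n => (M.comps_apply n x).trans (h n)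
  rw [← M.sum_comps x, this, map_zero]

theorem pr_lin {M N : DGVect.{u} k} (f : M ⟶ N) (n : ℤ) (x : M.carrier) :
    N.pr n (f.lin x) = f.lin (M.pr n x) := by
  refine LinearMap.congr_fun (f := N.pr n ∘ₗ f.lin) (g := f.lin ∘ₗ M.pr n)
    (lin_ext fun m y hy => ?_) x
  rw [LinearMap.comp_apply, LinearMap.comp_apply]
  by_cases h : m = n
  · subst h
    rw [M.pr_of_mem hy, N.pr_of_mem (f.map_mem _ _ hy)]
  · rw [M.pr_of_ne h hy, N.pr_of_ne h (f.map_mem _ _ hy), map_zero]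

theorem mem_deg_of_pr {M : DGVect.{u} k} {n : ℤ} {x : M.carrier} (h : M.pr n x = x) :
    x ∈ M.deg n := h ▸ M.pr_mem n x

end Homogeneous

section Subobjects

/-- The zero morphism. -/
def zeroHom (M N : DGVect.{u} k) : M ⟶ N where
  lin := 0
  map_mem n _ _ := (N.deg n).zero_mem
  map_d _ := (map_zero N.d).symm

/-- The elements of degree `n` of the kernel. -/
def kernelDeg {M N : DGVect.{u} k} (f : M ⟶ N) (n : ℤ) : Submodule k M.carrier :=
  LinearMap.ker f.lin ⊓ M.deg n

/-- The kernel of a morphism. -/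
def kernel {M N : DGVect.{u} k} (f : M ⟶ N) : DGVect.{u} k :=
  ofFamily (kernelDeg f)
    (fun n x hx hx' => by
      have h := eq_zero_of_mem_iSup (kernelDeg f) n (M.pr n)
        (fun m hm y hy => M.pr_of_ne hm hy.2) hx'
      rwa [M.pr_of_mem hx.2] at h)
    M.d
    (fun n x hx => ⟨(f.map_d x).trans ((congrArg N.d hx.1).trans (map_zero _)),
      M.d_mem n x hx.2⟩)
    (fun _ x _ => M.d_d x)

/-- The inclusion of the kernel. -/
def kernelInclusion {M N : DGVect.{u} k} (f : M ⟶ N) : kernel f ⟶ M where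
  lin := (⨆ n, kernelDeg f n).subtype
  map_mem _ _ hx := hx.2
  map_d _ := rfl

/-- The inclusion of the dg kernel becomes zero after `f`, hence is zero. The dg kernel contains all
homogeneous components of an element of the linear kernel, so that element vanishes. -/
theorem injective_of_mono {M N : DGVect.{u} k} (f : M ⟶ N) [Mono f] :
    Function.Injective f.lin := by
  have h₀ : kernelInclusion f = zeroHom _ _ := by
    rw [← cancel_mono f]
    refine hom_ext (LinearMap.ext fun x => ?_)
    have : (⨆ n, kernelDeg f n) ≤ LinearMap.ker f.lin :=
      iSup_le fun n => inf_le_left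
    exact (LinearMap.mem_ker.mp (this x.2)).trans (map_zero f.lin).symm
  rw [← LinearMap.ker_eq_bot, Submodule.eq_bot_iff]
  intro x hx
  refine eq_zero_of_pr fun n => ?_
  have h₁ : M.pr n x ∈ kernelDeg f n :=
    ⟨(pr_lin f n x).symm.trans ((congrArg (N.pr n) hx).trans (map_zero _)), M.pr_mem n x⟩
  exact LinearMap.congr_fun (congrArg Hom.lin h₀)
    ⟨M.pr n x, Submodule.mem_iSup_of_mem n h₁⟩

/-- Morphisms into the image of an injective morphism lift. -/
theorem exists_lift {M N T : DGVect.{u} k} (j : M ⟶ N) (hj : Function.Injective j.lin)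
    (f : T ⟶ N) (h : ∀ t, f.lin t ∈ LinearMap.range j.lin) : ∃ f' : T ⟶ M, f' ≫ j = f := by
  obtain ⟨g, hg⟩ := exists_comp_eq_of_injective j.lin hj f.lin h
  -- The linear lift respects degrees and differentials automatically, because `j` does and is
  -- injective.
  refine ⟨⟨g, fun n x hx => mem_deg_of_pr (hj ?_), fun x => hj ?_⟩,
    hom_ext (LinearMap.ext hg)⟩
  · rw [← pr_lin, hg, N.pr_of_mem (f.map_mem n x hx)]
  · rw [hg, j.map_d, hg, f.map_d]

/-- The cokernel of a morphism. -/
def cokernel {M N : DGVect.{u} k} (f : M ⟶ N) : DGVect.{u} k where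
  carrier := N.carrier ⧸ LinearMap.range f.lin
  deg n := (N.deg n).map (LinearMap.range f.lin).mkQ
  isInternal := by
    refine isInternal_of _ ?_ ?_
    · rw [← Submodule.map_iSup, N.iSup_deg, Submodule.map_top, Submodule.range_mkQ]
    · rintro n _ ⟨x, hx, rfl⟩ hx'
      have hp : LinearMap.range f.lin ≤ (LinearMap.range f.lin).comap (N.pr n) := by
        rintro _ ⟨y, rfl⟩
        exact ⟨M.pr n y, (pr_lin f n y).symm⟩
      have h := eq_zero_of_mem_iSup _ n (Submodule.mapQ _ _ (N.pr n) hp) (by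
        rintro m hm _ ⟨y, hy, rfl⟩
        rw [Submodule.mkQ_apply, Submodule.mapQ_apply, N.pr_of_ne hm hy,
          Submodule.Quotient.mk_zero]) hx'
      rwa [Submodule.mkQ_apply, Submodule.mapQ_apply, N.pr_of_mem hx] at h
  d := Submodule.mapQ _ _ N.d (by
    rintro _ ⟨y, rfl⟩
    exact ⟨M.d y, f.map_d y⟩)
  d_mem := by
    rintro n _ ⟨x, hx, rfl⟩
    exact ⟨N.d x, N.d_mem n x hx, rfl⟩
  d_d x := by
    obtain ⟨y, rfl⟩ := Submodule.mkQ_surjective _ x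
    exact congrArg (Submodule.mkQ _) (N.d_d y)

/-- The projection to the cokernel. -/
def cokernelProj {M N : DGVect.{u} k} (f : M ⟶ N) : N ⟶ cokernel f where
  lin := (LinearMap.range f.lin).mkQ
  map_mem _ x hx := ⟨x, hx, rfl⟩
  map_d _ := rfl

end Subobjects

section Slices

/-- The internal dual contains only finite sums of homogeneous functionals. They suffice, since `φ ∘
pr n` is homogeneous for every functional `φ` and a tensor is recovered from its components along
the grading of `M`. -/
theorem detectsTensors_homogeneous (M : DGVect.{u} k) :
    DetectsTensors {φ : M.carrier →ₗ[k] k | ∃ n, φ ∈ homDeg M (one k) n} := by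
  intro A _ _ t h
  have h₁ : ∀ n, (M.pr n).lTensor A t = 0 := fun n => by
    refine detectsTensors_univ A _ fun φ _ => ?_
    have h₂ : contraction A φ ((M.pr n).lTensor A t) = contraction A (φ ∘ₗ M.pr n) t := by
      rw [contraction, contraction, LinearMap.lTensor_comp]
      rfl
    rw [h₂]
    -- The functional `φ ∘ pr n` lives on degree `n` and the unit object sits in degree `0`, hence
    -- the degree `-n`.
    refine h _ ⟨-n, fun p x hx => ?_⟩
    by_cases hp : p = n
    · subst hp
      rw [add_neg_cancel]
      exact one_mem (k := k)
    · have h₃ : φ (M.pr n x) = 0 := by rw [M.pr_of_ne hp hx, map_zero]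
      exact (congrArg (fun a => a ∈ (one k).deg (p + -n)) h₃).mpr (Submodule.zero_mem _)
  have h₂ : M.comps.lTensor A t = 0 := by
    rw [← (TensorProduct.finsuppRight k k A M.carrier ℤ).map_eq_zero_iff]
    refine Finsupp.ext fun n => ?_
    rw [TensorProduct.finsuppRight_apply, ← LinearMap.comp_apply, ← LinearMap.lTensor_comp]
    exact (congrArg (fun φ => LinearMap.lTensor A φ t)
      (LinearMap.ext (M.comps_apply n))).trans (h₁ n)
  have h₃ : Finsupp.lsum k (fun _ : ℤ => LinearMap.id) ∘ₗ M.comps = LinearMap.id :=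
    LinearMap.ext M.sum_comps
  rw [← LinearMap.id_apply (R := k) t, ← LinearMap.lTensor_id, ← h₃, LinearMap.lTensor_comp,
    LinearMap.comp_apply, h₂, map_zero]

theorem ihom_ev_tmul (b : DGVect.{u} k) (φ : (internalHom b (one k)).carrier) (y : b.carrier) :
    ((ihom.ev b).app (𝟙_ (DGVect.{u} k))).lin (y ⊗ₜ[k] φ) = φ.1 y := by
  rw [← MonoidalClosed.uncurry_id_eq_ev]
  rfl

theorem slice_tmul {t a b : DGVect.{u} k} (f : t ⟶ a ⊗ b) (x : t.carrier)
    (φ : (internalHom b (one k)).carrier) :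
    (slice f).lin (x ⊗ₜ[k] φ) = contraction a.carrier φ.1 (f.lin x) := by
  have key := TensorProduct.ext' (g := ((α_ a b (dualObj b)).hom ≫ a ◁ (ihom.ev b).app (𝟙_ _) ≫
      (ρ_ a).hom).lin ∘ₗ (TensorProduct.mk k (a.carrier ⊗[k] b.carrier)
        (internalHom b (one k)).carrier).flip φ) (h := contraction a.carrier φ.1) fun z y => by
    exact (congrArg (fun c : k => c • z) (ihom_ev_tmul b φ y)).trans
      (contraction_tmul (A := a.carrier) φ.1 z y).symm
  exact LinearMap.congr_fun key (f.lin x)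

instance : HasSlices (DGVect.{u} k) where
  slice_injective {t a b f g} h := by
    refine hom_ext (LinearMap.ext fun x => (detectsTensors_homogeneous b).ext fun φ ⟨n, hn⟩ => ?_)
    have h₁ := slice_tmul f x ⟨φ, Submodule.mem_iSup_of_mem n hn⟩
    have h₂ := slice_tmul g x ⟨φ, Submodule.mem_iSup_of_mem n hn⟩
    rw [h] at h₁
    exact h₁.symm.trans h₂
  factors_of_slice {t a b q} i _ f l h := by
    refine exists_lift (i ▷ b) (Module.Flat.rTensor_preserves_injective_linearMap (M := b.carrier)
      i.lin (injective_of_mono i)) f fun x =>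
        (detectsTensors_homogeneous b).mem_range i.lin (f.lin x) fun φ ⟨n, hn⟩ => ?_
    have h₁ := slice_tmul f x ⟨φ, Submodule.mem_iSup_of_mem n hn⟩
    rw [← h] at h₁
    exact ⟨_, h₁⟩
  regular {q a} i _ := by
    -- As for vector spaces, `i` equalises the cokernel projection and zero; `exists_lift` makes the
    -- linear factorisation a dg morphism.
    refine ⟨cokernel i, cokernelProj i, zeroHom _ _, hom_ext (LinearMap.ext fun x => ?_),
      fun {t} f hf => exists_lift i (injective_of_mono i) f fun x => ?_⟩
    · exact (Submodule.Quotient.mk_eq_zero _).mpr ⟨x, rfl⟩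
    · exact (Submodule.Quotient.mk_eq_zero _).mp (LinearMap.congr_fun (congrArg Hom.lin hf) x)

end Slices

end DGVect

/-- Both cases instantiate `exists_coalgebra_Q₁`; beyond the closed symmetric structure and limits,
only `HasSlices` enters. -/
theorem mainTheorem4 (k : Type u) [Field k] (X : Type u) :
    (∀ P : ColoredOperad X (ModuleCat.{u} k),
      (∀ (C : X → ModuleCat.{u} k) (y : X), Mono (P.chi C y)) ∧
      ∃ δ : ∀ (C : X → ModuleCat.{u} k) (y : X), P.Q₁ C y ⟶ P.coan (P.Q₁ C) y,
        (∀ C : X → ModuleCat.{u} k, P.IsCoalgebra (P.Q₁ C) (δ C)) ∧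
        (∀ (C : X → ModuleCat.{u} k) (y : X),
          δ C y ≫ P.coanMap (P.chi C) y = P.delta₁ C y) ∧
        (∀ (C D : X → ModuleCat.{u} k) (f : ∀ x, C x ⟶ D x) (y : X),
          δ C y ≫ P.coanMap (P.Q₁Map f) y = P.Q₁Map f y ≫ δ D y)) ∧
    (∀ P : ColoredOperad X (DGVect.{u} k),
      (∀ (C : X → DGVect.{u} k) (y : X), Mono (P.chi C y)) ∧
      ∃ δ : ∀ (C : X → DGVect.{u} k) (y : X), P.Q₁ C y ⟶ P.coan (P.Q₁ C) y,
        (∀ C : X → DGVect.{u} k, P.IsCoalgebra (P.Q₁ C) (δ C)) ∧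
        (∀ (C : X → DGVect.{u} k) (y : X),
          δ C y ≫ P.coanMap (P.chi C) y = P.delta₁ C y) ∧
        (∀ (C D : X → DGVect.{u} k) (f : ∀ x, C x ⟶ D x) (y : X),
          δ C y ≫ P.coanMap (P.Q₁Map f) y = P.Q₁Map f y ≫ δ D y)) :=
  ⟨fun P => P.exists_coalgebra_Q₁, fun P => P.exists_coalgebra_Q₁⟩
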